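/- Let $n\ge 0$ and $d\ge 1$ be integers. Let $\Delta_{n,d}$ be the set of $n$-tuples $(Z^{(1)},\dots,Z^{(n)})$ of non-negative Hermitian $d\times d$ matrices with $\sum_{k=1}^n Z^{(k)}\le \mathrm{Id}$, seen as a subset of $\mathbb R^{nd^2}$ through the real coordinates $\mathrm{Re}\,Z^{(k)}_{ij}$, $\mathrm{Im}\,Z^{(k)}_{ij}$ ($i<j$) and $Z^{(k)}_{ii}$, and set $Z^{(n+1)}=\mathrm{Id}-\sum_{k=1}^n Z^{(k)}$. For $\mathbf a=(a_1,\dots,a_{n+1})$ with all $a_k>0$ let $D_{\mathbf a}$ be the probability measure on $\Delta_{n,d}$ with density $C\prod_{k=1}^{n+1}\det(Z^{(k)})^{a_k-1}$ with respect to the Lebesgue measure in these coordinates, where $C$ is the normalizing constant. Definitions. A co-metric on an open set $\Omega\subset\mathbb R^N$ is a symmetric matrix of smooth functions $g=(g^{ij})$, with $\Gamma(f,h)=\sum_{ij}g^{ij}\partial_if\,\partial_jh$ (extended complex bilinearly to complex valued functions); it is elliptic on $\Omega$ if $g(x)$ is positive definite for every $x\in\Omega$. A diffusion operator with co-metric $\Gamma$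 is $L f=\sum_{ij}g^{ij}\partial^2_{ij}f+\sum_ib^i\partial_if$ with $b^i$ smooth on $\Omega$ (extended complex linearly to complex valued functions); it is symmetric with respect to a measure $\mu$ if $\int fL(h)\,d\mu=\int hL(f)\,d\mu$ for all smooth $f,h$ compactly supported in $\Omega$. The triple $(\Omega,\Gamma,\mu)$ is a polynomial model if: $\Omega$ is a bounded connected non-empty open set with piecewise $C^1$ boundary (there are finitely many $C^1$ functions $\varphi_s$ such that $\partial\Omega$ is the closure of the set $R$ of those points $x$ near which, for some $s$, $\Omega=\{\varphi_s>0\}$ with $\varphi_s(x)=0$, $d\varphi_s(x)\ne0$, and $\partial\Omega\setminus R$ is null for the $(N-1)$-dimensional Hausdorff measure); $\Gamma$ is elliptic on $\Omega$; $\mu$ is a probability measure on $\Omega$ with smooth positive density; and there is a diffusion operator $L$ with co-metric $\Gamma$ which is symmetric with respect to $\mu$, satisfies $\int PL(Q)\,d\mu=\int QL(P)\,d\mu$ for all polynomials $P,Q$, and is such that for every $m$ the space of polynomials of total degree at most $m$ has an $L^2(\mu)$-orthonormal basis made of eigenvectors of $L$. Let $A=(A_{pq})_{1\le p,q\le n+1}$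 be a real symmetric matrix. It is called irreducible if for any $p\neq q$ there is a path $p=p_0,p_1,\dots,p_k=q$ with $A_{p_ip_{i+1}}\ne0$ for $0\le i<k$. Theorem. 1. There is a co-metric $\Gamma_A$ given by $$\Gamma_A(Z^{(p)}_{ij},Z^{(q)}_{kl})=\delta_{pq}\sum_{s=1}^{n+1}A_{sp}\big(Z^{(s)}_{il}Z^{(p)}_{kj}+Z^{(s)}_{kj}Z^{(p)}_{il}\big)-A_{pq}\big(Z^{(q)}_{il}Z^{(p)}_{kj}+Z^{(p)}_{il}Z^{(q)}_{kj}\big)$$ for $1\le p,q\le n$ and $1\le i,j,k,l\le d$. Moreover, for $1\le p,q\le n+1$, $$\Gamma_A(Z^{(p)}_{ij},Z^{(q)}_{kl})=\sum_{r,s=1}^{n+1}\ \sum_{a,b,c,e=1}^{d} A_{rs}(\delta_{pq}\delta_{pr}-\delta_{pr}\delta_{qs})(\delta_{ak}\delta_{bj}\delta_{ci}\delta_{el}+\delta_{ai}\delta_{bl}\delta_{ck}\delta_{ej})\,Z^{(r)}_{ab}Z^{(s)}_{ce}.$$ 2. $\Gamma_A$ is elliptic on the interior of $\Delta_{n,d}$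 if and only if $A_{pq}\ge0$ for all $p\ne q$ and $A$ is irreducible. 3. In this case, for every $\mathbf a$ with positive entries, $(\mathrm{int}\,\Delta_{n,d},\Gamma_A,D_{\mathbf a})$ is a polynomial model, and every diffusion operator $L_{A,\mathbf a}$ on $\mathrm{int}\,\Delta_{n,d}$ with co-metric $\Gamma_A$ that is symmetric with respect to $D_{\mathbf a}$ satisfies there, for $1\le p\le n$ and $1\le i,j\le d$, $$L_{A,\mathbf a}(Z^{(p)}_{ij})=\sum_{q=1}^{n+1}2(a_p+d-1)A_{pq}Z^{(q)}_{ij}-\sum_{q=1}^{n+1}2(a_q+d-1)A_{pq}Z^{(p)}_{ij}.$$ -/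

import Mathlib

open MeasureTheory Topology
open scoped ContDiff ComplexOrder

noncomputable section

/-! ### Diffusion operators and polynomial models on open subsets of `ℝ^ι` -/

section PolynomialModels

variable {ι : Type*} [Fintype ι] [DecidableEq ι]

/-- The partial derivative `∂_i f`, for functions with values in a real normed space
(used with values in `ℝ` and in `ℂ`). -/
def partialDeriv {F : Type*} [NormedAddCommGroup F] [NormedSpace ℝ F]
    (i : ι) (f : (ι → ℝ) → F) (x : ι → ℝ) : F :=
  fderiv ℝ f x (Pi.single i 1)

/-- The diffusion operator `L f = ∑ g^{ij} ∂_i ∂_j f + ∑ b^i ∂_i f`. On complex valued functions this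
is the complex linear extension of the operator on real valued functions. -/
def diffusionOp {F : Type*} [NormedAddCommGroup F] [NormedSpace ℝ F]
    (g : ι → ι → (ι → ℝ) → ℝ) (b : ι → (ι → ℝ) → ℝ) (f : (ι → ℝ) → F) (x : ι → ℝ) : F :=
  (∑ i, ∑ j, g i j x • partialDeriv i (partialDeriv j f) x) + ∑ i, b i x • partialDeriv i f x

/-- The carré du champ operator `Γ(f, h) = ∑ g^{ij} ∂_i f ∂_j h` of the co-metric `g`. On complex
valued functions this is the complex bilinear extension. -/
def carreDuChamp {F : Type*} [NormedRing F] [NormedAlgebra ℝ F]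
    (g : ι → ι → (ι → ℝ) → ℝ) (f h : (ι → ℝ) → F) (x : ι → ℝ) : F :=
  ∑ i, ∑ j, g i j x • (partialDeriv i f x * partialDeriv j h x)

/-- The co-metric `g` is elliptic on `Ω`: the matrix `(g^{ij}(x))` is positive definite at
every point of `Ω`. -/
def IsEllipticOn (Ω : Set (ι → ℝ)) (g : ι → ι → (ι → ℝ) → ℝ) : Prop :=
  ∀ x ∈ Ω, (Matrix.of fun i j => g i j x).PosDef

/-- The diffusion operator with co-metric `g` and drift `b` has a smooth drift on `Ω` and is symmetric
with respect to `μ` on smooth functions compactly supported in `Ω`. -/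
def IsSymmetricDiffusion (Ω : Set (ι → ℝ)) (g : ι → ι → (ι → ℝ) → ℝ) (b : ι → (ι → ℝ) → ℝ)
    (μ : Measure (ι → ℝ)) : Prop :=
  (∀ i, ContDiffOn ℝ ∞ (b i) Ω) ∧
  ∀ f h : (ι → ℝ) → ℝ,
    ContDiff ℝ ∞ f → HasCompactSupport f → tsupport f ⊆ Ω →
    ContDiff ℝ ∞ h → HasCompactSupport h → tsupport h ⊆ Ω →
    ∫ x, f x * diffusionOp g b h x ∂μ = ∫ x, h x * diffusionOp g b f x ∂μ

/-- The points of the boundary of `Ω` near which `Ω` is one side `{φ > 0}` of the hypersurface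
`{φ = 0}`, with `φ` non critical at the point. -/
def regularBoundary (Ω : Set (ι → ℝ)) (φ : (ι → ℝ) → ℝ) : Set (ι → ℝ) :=
  {x | φ x = 0 ∧ fderiv ℝ φ x ≠ 0 ∧ ∀ᶠ y in 𝓝 x, (y ∈ Ω ↔ 0 < φ y)}

/-- `Ω` has a piecewise `C¹` boundary: there are finitely many `C¹` functions such that the
boundary is the closure of the pieces on which it is a regular hypersurface defined by one of them,
and the remaining singular part of the boundary is negligible for the Hausdorff measure of
codimension one. -/
def HasPiecewiseC1Boundary (Ω : Set (ι → ℝ)) : Prop :=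
  ∃ (N : ℕ) (φ : Fin N → (ι → ℝ) → ℝ), (∀ s, ContDiff ℝ 1 (φ s)) ∧
    frontier Ω = closure (⋃ s, regularBoundary Ω (φ s)) ∧
    Measure.hausdorffMeasure ((Fintype.card ι : ℝ) - 1)
      (frontier Ω \ ⋃ s, regularBoundary Ω (φ s)) = 0

/-- `(Ω, g, μ)` is a polynomial model on the bounded domain `Ω`: the domain has a piecewise `C¹`
boundary, the co-metric `g` is smooth and elliptic on `Ω`, `μ` is a probability measure on `Ω` with a
smooth positive density, and there is a diffusion operator with co-metric `g` which is symmetric with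
respect to `μ`, on test functions and on polynomials, and for which each space of polynomials of
degree at most `m` has an orthonormal basis of `L²(μ)` made of eigenvectors. -/
structure IsPolynomialModel (Ω : Set (ι → ℝ)) (g : ι → ι → (ι → ℝ) → ℝ)
    (μ : Measure (ι → ℝ)) : Prop where
  isOpen : IsOpen Ω
  isConnected : IsConnected Ω
  isBounded : Bornology.IsBounded Ω
  boundary : HasPiecewiseC1Boundary Ω
  smooth_coMetric : ∀ i j, ContDiffOn ℝ ∞ (g i j) Ω
  elliptic : IsEllipticOn Ω g
  isProbability : IsProbabilityMeasure μ
  density : ∃ ρ : (ι → ℝ) → ℝ, ContDiffOn ℝ ∞ ρ Ω ∧ (∀ x ∈ Ω, 0 < ρ x) ∧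
    μ = (volume.restrict Ω).withDensity fun x => ENNReal.ofReal (ρ x)
  generator : ∃ b : ι → (ι → ℝ) → ℝ, IsSymmetricDiffusion Ω g b μ ∧
    (∀ P Q : MvPolynomial ι ℝ,
      ∫ x, MvPolynomial.eval x P * diffusionOp g b (fun y => MvPolynomial.eval y Q) x ∂μ =
        ∫ x, MvPolynomial.eval x Q * diffusionOp g b (fun y => MvPolynomial.eval y P) x ∂μ) ∧
    ∀ m : ℕ, ∃ (N : ℕ)
      (e : Module.Basis (Fin N) ℝ (MvPolynomial.restrictTotalDegree ι ℝ m)) (ev : Fin N → ℝ),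
      (∀ s t, ∫ x, MvPolynomial.eval x (e s : MvPolynomial ι ℝ) *
          MvPolynomial.eval x (e t : MvPolynomial ι ℝ) ∂μ = if s = t then 1 else 0) ∧
      ∀ s, ∀ x ∈ Ω,
        diffusionOp g b (fun y => MvPolynomial.eval y (e s : MvPolynomial ι ℝ)) x =
          ev s * MvPolynomial.eval x (e s : MvPolynomial ι ℝ)

end PolynomialModels

/-! ### The complex matrix simplex -/

section MatrixSimplex

variable {n d : ℕ}

/-- Real coordinates on `n`-tuples of Hermitian `d × d` matrices: for `i < j` the coordinate
`(k, i, j)` is the real part of `Z^{(k)}_{ij}` and `(k, j, i)` is its imaginary part, and `(k, i, i)`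
is the real entry `Z^{(k)}_{ii}`. -/
abbrev CoordIndex (n d : ℕ) : Type := Fin n × Fin d × Fin d

/-- The Hermitian matrix `Z^{(k)}`, `k = 1, …, n`, with real coordinates `x`. -/
def hermMatrix (x : CoordIndex n d → ℝ) (k : Fin n) : Matrix (Fin d) (Fin d) ℂ :=
  Matrix.of fun i j =>
    if i = j then (x (k, i, i) : ℂ)
    else if i < j then (x (k, i, j) : ℂ) + (x (k, j, i) : ℂ) * Complex.I
    else (x (k, j, i) : ℂ) - (x (k, i, j) : ℂ) * Complex.I

/-- The matrices `Z^{(1)}, …, Z^{(n)}, Z^{(n+1)}`, where `Z^{(n+1)} = 1 - Z^{(1)} - ⋯ - Z^{(n)}`. -/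
def simplexMatrix (x : CoordIndex n d → ℝ) : Fin (n + 1) → Matrix (Fin d) (Fin d) ℂ :=
  Fin.snoc (fun k => hermMatrix x k) (1 - ∑ k, hermMatrix x k)

/-- The complex matrix simplex `Δ_{n,d}`. -/
def matrixSimplex (n d : ℕ) : Set (CoordIndex n d → ℝ) :=
  {x | (∀ k, (hermMatrix x k).PosSemidef) ∧ (1 - ∑ k, hermMatrix x k).PosSemidef}

/-- The unnormalized Dirichlet density `∏_{k=1}^{n+1} det(Z^{(k)})^{a_k - 1}`
(determinants of Hermitian matrices are real). -/
def dirichletDensity (a : Fin (n + 1) → ℝ) (x : CoordIndex n d → ℝ) : ℝ :=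
  ∏ k, ((simplexMatrix x k).det.re) ^ (a k - 1)

/-- The measure on `Δ_{n,d}` with density `dirichletDensity a` with respect to the Lebesgue
measure in the coordinates. -/
def dirichletWeight (n d : ℕ) (a : Fin (n + 1) → ℝ) : Measure (CoordIndex n d → ℝ) :=
  (volume.restrict (matrixSimplex n d)).withDensity fun x => ENNReal.ofReal (dirichletDensity a x)

/-- The matrix Dirichlet measure `D_a`, normalized to have total mass one. -/
def matrixDirichlet (n d : ℕ) (a : Fin (n + 1) → ℝ) : Measure (CoordIndex n d → ℝ) :=
  (dirichletWeight n d a Set.univ)⁻¹ • dirichletWeight n d a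

/-! ### The co-metric `Γ_A` -/

/-- The prescribed value of `Γ_A(Z^{(p)}_{ij}, Z^{(q)}_{kl})` for `p, q ≤ n`. -/
def gammaEntry (A : Matrix (Fin (n + 1)) (Fin (n + 1)) ℝ) (x : CoordIndex n d → ℝ)
    (p : Fin n) (i j : Fin d) (q : Fin n) (k l : Fin d) : ℂ :=
  let Z := simplexMatrix x
  let p' := p.castSucc
  let q' := q.castSucc
  (if p = q then
      ∑ s, (A s p' : ℂ) * (Z s i l * Z p' k j + Z s k j * Z p' i l)
    else 0) -
    (A p' q' : ℂ) * (Z q' i l * Z p' k j + Z p' i l * Z q' k j)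

/-- The linear expression of the real coordinate `(i, j)` of a Hermitian matrix in its entries:
`Z_{ii}`, `(Z_{ij} + Z_{ji}) / 2` for `i < j`, and `(Z_{ji} - Z_{ij}) / (2 √-1)` for `j < i`. -/
def coordOfEntries (i j : Fin d) (W : Fin d → Fin d → ℂ) : ℂ :=
  if i = j then W i i
  else if i < j then (W i j + W j i) / 2
  else (W j i - W i j) / (2 * Complex.I)

/-- The co-metric `Γ_A` in the real coordinates, obtained by bilinearity from its values on the
entries of the matrices (these combinations are real numbers). -/
def coMetric (A : Matrix (Fin (n + 1)) (Fin (n + 1)) ℝ) (u v : CoordIndex n d)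
    (x : CoordIndex n d → ℝ) : ℝ :=
  (coordOfEntries u.2.1 u.2.2 fun i j =>
    coordOfEntries v.2.1 v.2.2 fun k l => gammaEntry A x u.1 i j v.1 k l).re

/-- The Kronecker symbol. -/
def kron {α : Type*} [DecidableEq α] (s t : α) : ℝ := if s = t then 1 else 0

/-- The coefficients `(A^{p,q}_{ij,kl})^{ab,ce}_{r,s}` of `Γ_A(Z^{(p)}_{ij}, Z^{(q)}_{kl})` on
`Z^{(r)}_{ab} Z^{(s)}_{ce}`. -/
def gammaTensor (A : Matrix (Fin (n + 1)) (Fin (n + 1)) ℝ)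
    (p q : Fin (n + 1)) (i j k l : Fin d) (r s : Fin (n + 1)) (a b c e : Fin d) : ℝ :=
  A r s * (kron p q * kron p r - kron p r * kron q s) *
    (kron a k * kron b j * kron c i * kron e l + kron a i * kron b l * kron c k * kron e j)

/-- The matrix `A` is irreducible: any two distinct indices are joined by a path along which the
entries of `A` do not vanish. -/
def IsIrreducibleMatrix (A : Matrix (Fin (n + 1)) (Fin (n + 1)) ℝ) : Prop :=
  ∀ p q, p ≠ q → Relation.TransGen (fun r s => A r s ≠ 0) p q

end MatrixSimplex

end

/-!
The four assertions are proved in the real coordinates of the matrices `Z^{(1)}, …, Z^{(n)}`, where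
`Γ_A` has polynomial coefficients of degree two. The prescribed values extend to a bilinear
expression `fullEntry` in all `n + 1` matrices whose sum over one of the indices vanishes; this is
why the values on `Z^{(n+1)} = 1 - ∑ Z^{(k)}` are given by the same formula
(`carreDuChamp_simplexMatrix`, `fullEntry_eq_sum_gammaTensor`).

*Ellipticity.* On the cotangent vector with matrices `M_1, …, M_n` and `M_{n+1} = 0`, the form `Γ_A`
is `∑_{p, q} A_{pq} tr (Z_p (M_p - M_q) Z_q (M_p - M_q))`. Each trace is nonnegative for Hermitian
arguments and vanishes only if `M_p = M_q`, so that nonnegative entries of an irreducible matrix make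
the form definite. Conversely, at points where all `Z_p` are scalar and for scalar `M_p` it is a graph
Laplacian with weights `A_{pq}`. Concentrating the `Z_p` on two indices isolates one entry, and the
indicator function of a connected component gives the irreducibility (`isEllipticOn_iff`).

*Boundary.* The interior of the simplex consists of the points where all `Z^{(p)}` are positive
definite. Its boundary is regular where exactly one `Z^{(p)}` is singular, with a kernel of
dimension one, and `det Z^{(p)}` is then a defining function. The remaining boundary points have two
independent supporting hyperplanes. For a convex set such points form a null set for the Hausdorff
measure of codimension one: they are nearest points of a countable union of planes of codimension
two (`hausdorffMeasure_eq_zero_of_two_supports`).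

*Finiteness of the Dirichlet measure.* The diagonal entries of a matrix can be integrated out one
after the other, since each leading minor is an affine function of its last diagonal entry whose
slope is the preceding minor. This makes `∏ det(Z^{(k)})^{a_k - 1}` integrable over `n + 1`
independent matrices in a cube. By Fubini the density of their sum is finite at some positive
definite `S`, and the congruence that takes `S` to the identity turns it into the Dirichlet integral
(`lintegral_dirichletDensity_lt_top`).

*Generator.* The boundary equation `Γ_A(det Z^{(q)}, ·) = det Z^{(q)} · (affine)`
(`sum_coMetric_mul_partialDeriv_detFun`), together with the divergence of `Γ_A`
(`sum_partialDeriv_coMetric`), shows that the drift `div g + g ∇ log ρ` of the reversible operator is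
affine. It also makes the boundary terms in the integration by parts vanish in the limit of cutoffs
depending on the product of the determinants
(`IsDivergenceForm.integral_mul_diffusionOp_eq_neg`), so that the operator is symmetric on
polynomials. It does not raise the degree, hence it is diagonalized in each space of polynomials of
bounded degree (`exists_basis_eigenvectors`). Finally, the symmetry on test functions determines the
drift (`IsDivergenceForm.drift_unique`), and the formula for the generator follows.
-/

noncomputable section


/-! ### Real coordinates of Hermitian matrices -/

section Coordinates

variable {n d : ℕ}

/-- The derivative of the entry `(i, j)` of a Hermitian matrix with respect to its real coordinate
`(a, b)`: the matrices `basisEntry a b` form the real basis dual to the coordinates. -/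
def basisEntry (a b i j : Fin d) : ℂ :=
  if i = j then (if (a, b) = (i, i) then 1 else 0)
  else if i < j then
    (if (a, b) = (i, j) then 1 else 0) + (if (a, b) = (j, i) then 1 else 0) * Complex.I
  else (if (a, b) = (j, i) then 1 else 0) - (if (a, b) = (i, j) then 1 else 0) * Complex.I

/-- The coefficient of the entry `W k l` in the linear expression `coordOfEntries a b W`. -/
def coordCoeff (a b k l : Fin d) : ℂ :=
  coordOfEntries a b fun k' l' => if k' = k ∧ l' = l then 1 else 0

lemma coordOfEntries_add (a b : Fin d) (V W : Fin d → Fin d → ℂ) :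
    coordOfEntries a b (fun i j => V i j + W i j) =
      coordOfEntries a b V + coordOfEntries a b W := by
  unfold coordOfEntries; split_ifs <;> ring

lemma coordOfEntries_mul (a b : Fin d) (c : ℂ) (W : Fin d → Fin d → ℂ) :
    coordOfEntries a b (fun i j => c * W i j) = c * coordOfEntries a b W := by
  unfold coordOfEntries; split_ifs <;> ring

lemma coordOfEntries_sum {α : Type*} (s : Finset α) (a b : Fin d) (W : α → Fin d → Fin d → ℂ) :
    coordOfEntries a b (fun i j => ∑ t ∈ s, W t i j) = ∑ t ∈ s, coordOfEntries a b (W t) := by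
  classical
  induction s using Finset.induction_on with
  | empty => simp [coordOfEntries]
  | insert t s ht ih => simp only [Finset.sum_insert ht, coordOfEntries_add, ih]

lemma coordOfEntries_eq_sum (a b : Fin d) (W : Fin d → Fin d → ℂ) :
    coordOfEntries a b W = ∑ k, ∑ l, coordCoeff a b k l * W k l := by
  have h : W = fun i j => ∑ k, ∑ l, W k l * (if i = k ∧ j = l then 1 else 0) := by
    funext i j
    simp [ite_and]
  conv_lhs => rw [h]
  rw [coordOfEntries_sum]
  refine Finset.sum_congr rfl fun k _ => ?_
  rw [coordOfEntries_sum]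
  refine Finset.sum_congr rfl fun l _ => ?_
  rw [coordOfEntries_mul, mul_comm]
  rfl

/-- A complex matrix is recovered from its (complex) coordinates. -/
lemma sum_coordOfEntries_mul_basisEntry (W : Fin d → Fin d → ℂ) (i j : Fin d) :
    ∑ a, ∑ b, coordOfEntries a b W * basisEntry a b i j = W i j := by
  unfold basisEntry
  rcases lt_trichotomy i j with h | h | h
  · simp only [h.ne, if_false, h, if_true, Prod.mk.injEq, ite_and, mul_add, ← mul_assoc, mul_ite,
      mul_one, mul_zero, Finset.sum_add_distrib, ite_mul, zero_mul]
    simp [coordOfEntries, h.ne, h.ne', h, h.not_gt]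
    field_simp
    ring
  · subst h
    simp [ite_and, coordOfEntries]
  · simp only [h.ne', if_false, h.not_gt, Prod.mk.injEq, ite_and, mul_sub, ← mul_assoc, mul_ite,
      mul_one, mul_zero, Finset.sum_sub_distrib, ite_mul, zero_mul]
    simp [coordOfEntries, h.ne, h.ne', h, h.not_gt]
    field_simp
    ring

lemma sum_coordCoeff_mul_basisEntry (k l i j : Fin d) :
    ∑ a, ∑ b, coordCoeff a b k l * basisEntry a b i j = if i = k ∧ j = l then 1 else 0 :=
  sum_coordOfEntries_mul_basisEntry _ i j

lemma hermMatrix_apply_eq_sum (x : CoordIndex n d → ℝ) (p : Fin n) (i j : Fin d) :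
    hermMatrix x p i j = ∑ a, ∑ b, (x (p, a, b) : ℂ) * basisEntry a b i j := by
  unfold basisEntry
  rcases lt_trichotomy i j with h | h | h
  · simp only [h.ne, if_false, h, if_true, Prod.mk.injEq, ite_and, mul_add, ← mul_assoc, mul_ite,
      mul_one, mul_zero, Finset.sum_add_distrib, ite_mul, zero_mul]
    simp [hermMatrix, h.ne, h]
  · subst h
    simp [ite_and, hermMatrix]
  · simp only [h.ne', if_false, h.not_gt, Prod.mk.injEq, ite_and, mul_sub, ← mul_assoc, mul_ite,
      mul_one, mul_zero, Finset.sum_sub_distrib, ite_mul, zero_mul]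
    simp [hermMatrix, h.ne', h.not_gt]

lemma hermMatrix_isHermitian (x : CoordIndex n d → ℝ) (p : Fin n) :
    (hermMatrix x p).IsHermitian := by
  ext i j
  rcases lt_trichotomy i j with h | h | h
  · simp [hermMatrix, h.ne, h.ne', h, h.not_gt]
  · subst h; simp [hermMatrix]
  · simp [hermMatrix, h.ne, h.ne', h, h.not_gt, sub_eq_add_neg]

lemma coordOfEntries_conj (a b : Fin d) (W : Fin d → Fin d → ℂ) :
    coordOfEntries a b (fun i j => starRingEnd ℂ (W j i)) = starRingEnd ℂ (coordOfEntries a b W) := by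
  unfold coordOfEntries
  split_ifs
  · rfl
  · simp only [map_div₀, map_add, map_ofNat, add_comm]
  · simp only [map_div₀, map_sub, map_mul, Complex.conj_I, map_ofNat]
    rw [mul_neg, div_neg, ← neg_div, neg_sub]

/-- The coordinates of a Hermitian matrix are real. -/
lemma coordOfEntries_re_of_hermitian (a b : Fin d) {W : Fin d → Fin d → ℂ}
    (h : ∀ i j, starRingEnd ℂ (W j i) = W i j) :
    ((coordOfEntries a b W).re : ℂ) = coordOfEntries a b W := by
  rw [← Complex.conj_eq_iff_re, ← coordOfEntries_conj]
  simp only [h]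

/-- The point of `ℝ^{nd²}` whose matrices are the Hermitian matrices `W p`. -/
def coordVec (W : Fin n → Matrix (Fin d) (Fin d) ℂ) : CoordIndex n d → ℝ :=
  fun u => (coordOfEntries u.2.1 u.2.2 (W u.1)).re

lemma hermMatrix_coordVec {W : Fin n → Matrix (Fin d) (Fin d) ℂ} (hW : ∀ p, (W p).IsHermitian)
    (p : Fin n) : hermMatrix (coordVec W) p = W p := by
  ext i j
  rw [hermMatrix_apply_eq_sum]
  have h : ∀ a b, ((coordVec W (p, a, b) : ℝ) : ℂ) = coordOfEntries a b (W p) := fun a b =>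
    coordOfEntries_re_of_hermitian a b fun i j => by simpa using (hW p).apply i j
  simp only [h]
  exact sum_coordOfEntries_mul_basisEntry (W p) i j

lemma coordVec_hermMatrix (x : CoordIndex n d → ℝ) : coordVec (hermMatrix x) = x := by
  funext ⟨p, a, b⟩
  rcases lt_trichotomy a b with h | h | h
  · simp [coordVec, coordOfEntries, hermMatrix, h, h.ne, h.ne', h.not_gt]
  · subst h; simp [coordVec, coordOfEntries, hermMatrix]
  · simp [coordVec, coordOfEntries, hermMatrix, h, h.ne, h.ne', h.not_gt]
    simp [Complex.div_re, Complex.normSq]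
    ring

lemma hermMatrix_add (x y : CoordIndex n d → ℝ) (p : Fin n) :
    hermMatrix (x + y) p = hermMatrix x p + hermMatrix y p := by
  ext i j
  simp [hermMatrix_apply_eq_sum, add_mul, Finset.sum_add_distrib]

lemma hermMatrix_smul (c : ℝ) (x : CoordIndex n d → ℝ) (p : Fin n) :
    hermMatrix (c • x) p = c • hermMatrix x p := by
  ext i j
  simp [hermMatrix_apply_eq_sum, Finset.mul_sum, mul_assoc]

lemma hermMatrix_zero (p : Fin n) : hermMatrix (0 : CoordIndex n d → ℝ) p = 0 := by
  ext i j
  simp [hermMatrix_apply_eq_sum]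

lemma hermMatrix_continuous (p : Fin n) :
    Continuous fun x : CoordIndex n d → ℝ => hermMatrix x p := by
  refine continuous_matrix fun i j => ?_
  simp only [hermMatrix_apply_eq_sum]
  fun_prop

@[simp] lemma simplexMatrix_castSucc (x : CoordIndex n d → ℝ) (p : Fin n) :
    simplexMatrix x p.castSucc = hermMatrix x p := by
  simp [simplexMatrix]

@[simp] lemma simplexMatrix_last (x : CoordIndex n d → ℝ) :
    simplexMatrix x (Fin.last n) = 1 - ∑ k, hermMatrix x k := by
  simp [simplexMatrix]

lemma sum_simplexMatrix (x : CoordIndex n d → ℝ) : ∑ p, simplexMatrix x p = 1 := by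
  simp [Fin.sum_univ_castSucc]

lemma simplexMatrix_isHermitian (x : CoordIndex n d → ℝ) (p : Fin (n + 1)) :
    (simplexMatrix x p).IsHermitian := by
  refine Fin.lastCases ?_ (fun p => ?_) p
  · rw [simplexMatrix_last]
    refine Matrix.isHermitian_one.sub ?_
    have : ∀ s : Finset (Fin n), (∑ k ∈ s, hermMatrix x k).IsHermitian := fun s => by
      simp only [Matrix.IsHermitian, Matrix.conjTranspose_sum]
      exact Finset.sum_congr rfl fun k _ => hermMatrix_isHermitian x k
    exact this _
  · rw [simplexMatrix_castSucc]
    exact hermMatrix_isHermitian x p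

lemma simplexMatrix_continuous (p : Fin (n + 1)) :
    Continuous fun x : CoordIndex n d → ℝ => simplexMatrix x p := by
  refine Fin.lastCases ?_ (fun p => ?_) p
  · simp only [simplexMatrix_last]
    exact continuous_const.sub (continuous_finsetSum _ fun k _ => hermMatrix_continuous k)
  · simpa using hermMatrix_continuous p

/-- Every tuple of Hermitian matrices with sum `1` comes from a point of `ℝ^{nd²}`. -/
lemma exists_simplexMatrix_eq {W : Fin (n + 1) → Matrix (Fin d) (Fin d) ℂ}
    (hW : ∀ p, (W p).IsHermitian) (hsum : ∑ p, W p = 1) :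
    ∃ x : CoordIndex n d → ℝ, ∀ p, simplexMatrix x p = W p := by
  refine ⟨coordVec fun p => W p.castSucc, fun p => ?_⟩
  refine Fin.lastCases ?_ (fun p => ?_) p
  · rw [simplexMatrix_last]
    simp only [hermMatrix_coordVec (fun p : Fin n => hW p.castSucc)]
    rw [← hsum, Fin.sum_univ_castSucc]
    abel
  · rw [simplexMatrix_castSucc, hermMatrix_coordVec fun p : Fin n => hW p.castSucc]

/-- The matrices `Z^{(p)}` depend affinely on the coordinates. -/
lemma simplexMatrix_affine (x y : CoordIndex n d → ℝ) (s t : ℝ) (hst : s + t = 1)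
    (p : Fin (n + 1)) :
    simplexMatrix (s • x + t • y) p = s • simplexMatrix x p + t • simplexMatrix y p := by
  refine Fin.lastCases ?_ (fun p => ?_) p
  · simp only [simplexMatrix_last, hermMatrix_add, hermMatrix_smul, Finset.sum_add_distrib,
      smul_sub, Finset.smul_sum]
    have : (1 : Matrix (Fin d) (Fin d) ℂ) = s • 1 + t • 1 := by rw [← add_smul, hst, one_smul]
    nth_rewrite 1 [this]
    abel
  · simp only [simplexMatrix_castSucc, hermMatrix_add, hermMatrix_smul]

/-- The linear part of `simplexMatrix`: its sum over all indices is zero. -/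
def simplexDir (y : CoordIndex n d → ℝ) : Fin (n + 1) → Matrix (Fin d) (Fin d) ℂ :=
  Fin.snoc (fun k => hermMatrix y k) (-∑ k, hermMatrix y k)

@[simp] lemma simplexDir_castSucc (x : CoordIndex n d → ℝ) (p : Fin n) :
    simplexDir x p.castSucc = hermMatrix x p := by
  simp [simplexDir]

@[simp] lemma simplexDir_last (x : CoordIndex n d → ℝ) :
    simplexDir x (Fin.last n) = -∑ k, hermMatrix x k := by
  simp [simplexDir]

lemma simplexMatrix_add (x y : CoordIndex n d → ℝ) (p : Fin (n + 1)) :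
    simplexMatrix (x + y) p = simplexMatrix x p + simplexDir y p := by
  refine Fin.lastCases ?_ (fun p => ?_) p
  · simp only [simplexMatrix_last, simplexDir_last, hermMatrix_add, Finset.sum_add_distrib]
    abel
  · simp [hermMatrix_add]

lemma simplexDir_smul (c : ℝ) (y : CoordIndex n d → ℝ) (p : Fin (n + 1)) :
    simplexDir (c • y) p = c • simplexDir y p := by
  refine Fin.lastCases ?_ (fun p => ?_) p
  · simp [hermMatrix_smul, Finset.smul_sum]
  · simp [hermMatrix_smul]

/-- The derivative of the entry `(i, j)` of `Z^{(p)}` with respect to the coordinate `u`. -/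
def entryDeriv (u : CoordIndex n d) (p : Fin (n + 1)) (i j : Fin d) : ℂ :=
  (kron p u.1.castSucc - kron p (Fin.last n) : ℝ) * basisEntry u.2.1 u.2.2 i j

lemma kron_castSucc_last (p : Fin n) : kron p.castSucc (Fin.last n) = 0 := by
  simp [kron, Fin.castSucc_ne_last]

lemma simplexDir_apply_eq_sum (y : CoordIndex n d → ℝ) (p : Fin (n + 1)) (i j : Fin d) :
    simplexDir y p i j = ∑ u, (y u : ℂ) * entryDeriv u p i j := by
  simp only [Fintype.sum_prod_type, entryDeriv]
  refine Fin.lastCases ?_ (fun p => ?_) p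
  · simp [kron, Matrix.sum_apply, hermMatrix_apply_eq_sum, (Fin.castSucc_ne_last _).symm]
  · simp only [simplexDir_castSucc, hermMatrix_apply_eq_sum, kron_castSucc_last, sub_zero]
    rw [Finset.sum_eq_single p]
    · simp [kron]
    · intro q _ hq
      simp [kron, hq.symm]
    · simp

lemma hasFDerivAt_simplexMatrix (p : Fin (n + 1)) (i j : Fin d) (x : CoordIndex n d → ℝ) :
    HasFDerivAt (fun y : CoordIndex n d → ℝ => simplexMatrix y p i j)
      (∑ u, (ContinuousLinearMap.proj u : (CoordIndex n d → ℝ) →L[ℝ] ℝ).smulRight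
        (entryDeriv u p i j)) x := by
  set T := ∑ u, (ContinuousLinearMap.proj u : (CoordIndex n d → ℝ) →L[ℝ] ℝ).smulRight
        (entryDeriv u p i j) with hT
  have : (fun y : CoordIndex n d → ℝ => simplexMatrix y p i j) =
      fun y => simplexMatrix 0 p i j + T y := by
    funext y
    have := congrFun (congrFun (simplexMatrix_add 0 y p) i) j
    rw [zero_add] at this
    rw [this, Matrix.add_apply, simplexDir_apply_eq_sum]
    simp [hT]
  rw [this]
  exact T.hasFDerivAt.const_add _

lemma partialDeriv_simplexMatrix (u : CoordIndex n d) (p : Fin (n + 1)) (i j : Fin d)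
    (x : CoordIndex n d → ℝ) :
    partialDeriv u (fun y : CoordIndex n d → ℝ => simplexMatrix y p i j) x =
      entryDeriv u p i j := by
  rw [partialDeriv, (hasFDerivAt_simplexMatrix p i j x).fderiv]
  simp [Pi.single_apply]

lemma contDiff_simplexMatrix (p : Fin (n + 1)) (i j : Fin d) {m : WithTop ℕ∞} :
    ContDiff ℝ m (fun y : CoordIndex n d → ℝ => simplexMatrix y p i j) := by
  have : (fun y : CoordIndex n d → ℝ => simplexMatrix y p i j) =
      fun y => simplexMatrix 0 p i j + ∑ u, (y u : ℂ) * entryDeriv u p i j := by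
    funext y
    have := congrFun (congrFun (simplexMatrix_add 0 y p) i) j
    rw [zero_add] at this
    rw [this, Matrix.add_apply, simplexDir_apply_eq_sum]
  rw [this]
  refine contDiff_const.add (ContDiff.sum fun u _ => ContDiff.mul ?_ contDiff_const)
  exact Complex.ofRealCLM.contDiff.comp (contDiff_apply ℝ ℝ u)

end Coordinates

/-! ### The co-metric on the entries of the matrices -/

section CoMetricEntries

variable {n d : ℕ}

/-- The value of `Γ_A(Z^{(p)}_{ij}, Z^{(q)}_{kl})` with `p, q` ranging over all `n + 1` indices. -/
def fullEntry (A : Matrix (Fin (n + 1)) (Fin (n + 1)) ℝ)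
    (Z : Fin (n + 1) → Matrix (Fin d) (Fin d) ℂ)
    (p : Fin (n + 1)) (i j : Fin d) (q : Fin (n + 1)) (k l : Fin d) : ℂ :=
  (kron p q : ℂ) * ∑ s, (A s p : ℂ) * (Z s i l * Z p k j + Z s k j * Z p i l) -
    (A p q : ℂ) * (Z q i l * Z p k j + Z p i l * Z q k j)

lemma gammaEntry_eq_fullEntry (A : Matrix (Fin (n + 1)) (Fin (n + 1)) ℝ)
    (x : CoordIndex n d → ℝ) (p : Fin n) (i j : Fin d) (q : Fin n) (k l : Fin d) :
    gammaEntry A x p i j q k l =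
      fullEntry A (simplexMatrix x) p.castSucc i j q.castSucc k l := by
  simp only [gammaEntry, fullEntry, kron, Fin.castSucc_inj]
  split_ifs <;> simp

variable {A : Matrix (Fin (n + 1)) (Fin (n + 1)) ℝ}

lemma fullEntry_comm (hA : A.IsSymm) (Z : Fin (n + 1) → Matrix (Fin d) (Fin d) ℂ)
    (p : Fin (n + 1)) (i j : Fin d) (q : Fin (n + 1)) (k l : Fin d) :
    fullEntry A Z p i j q k l = fullEntry A Z q k l p i j := by
  unfold fullEntry
  rw [hA.apply p q]
  by_cases h : p = q
  · subst h
    congr 1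
    · congr 1
      exact Finset.sum_congr rfl fun s _ => by ring
    · ring
  · simp only [kron, h, Ne.symm h, if_false]
    push_cast
    ring

lemma fullEntry_conj {Z : Fin (n + 1) → Matrix (Fin d) (Fin d) ℂ} (hZ : ∀ p, (Z p).IsHermitian)
    (p : Fin (n + 1)) (i j : Fin d) (q : Fin (n + 1)) (k l : Fin d) :
    starRingEnd ℂ (fullEntry A Z p j i q l k) = fullEntry A Z p i j q k l := by
  have h : ∀ p i j, starRingEnd ℂ (Z p i j) = Z p j i := fun p i j => by
    simpa using (hZ p).apply j i
  simp only [fullEntry, map_sub, map_mul, map_add, map_sum, h, Complex.conj_ofReal]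
  congr 1
  · congr 1
    exact Finset.sum_congr rfl fun s _ => by ring
  · ring

lemma sum_fullEntry_right (hA : A.IsSymm) (Z : Fin (n + 1) → Matrix (Fin d) (Fin d) ℂ)
    (p : Fin (n + 1)) (i j k l : Fin d) : ∑ q, fullEntry A Z p i j q k l = 0 := by
  simp only [fullEntry, Finset.sum_sub_distrib, kron]
  rw [← Finset.sum_mul]
  simp only [apply_ite (Complex.ofReal), Complex.ofReal_one, Complex.ofReal_zero,
    Finset.sum_ite_eq, Finset.mem_univ, if_true, one_mul]
  rw [sub_eq_zero]
  refine Finset.sum_congr rfl fun s _ => ?_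
  rw [hA.apply p s]
  ring

lemma sum_fullEntry_left (hA : A.IsSymm) (Z : Fin (n + 1) → Matrix (Fin d) (Fin d) ℂ)
    (i j : Fin d) (q : Fin (n + 1)) (k l : Fin d) : ∑ p, fullEntry A Z p i j q k l = 0 := by
  simp only [fun p => fullEntry_comm hA Z p i j q k l]
  exact sum_fullEntry_right hA Z q k l i j

/-- A tuple of complex matrices with sum zero is recovered from the coordinates of its first `n`
terms. -/
lemma sum_coordOfEntries_mul_entryDeriv {W : Fin (n + 1) → Fin d → Fin d → ℂ}
    (hW : ∀ i j, ∑ p, W p i j = 0) (p : Fin (n + 1)) (i j : Fin d) :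
    ∑ u : CoordIndex n d, coordOfEntries u.2.1 u.2.2 (W u.1.castSucc) * entryDeriv u p i j =
      W p i j := by
  have key : ∀ q : Fin n, ∑ v : Fin d × Fin d,
      coordOfEntries v.1 v.2 (W q.castSucc) * entryDeriv (q, v) p i j =
        (kron p q.castSucc - kron p (Fin.last n) : ℝ) * W q.castSucc i j := fun q => by
    rw [← sum_coordOfEntries_mul_basisEntry (W q.castSucc) i j, Fintype.sum_prod_type,
      Finset.mul_sum]
    refine Finset.sum_congr rfl fun a _ => ?_
    rw [Finset.mul_sum]
    refine Finset.sum_congr rfl fun b _ => ?_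
    simp only [entryDeriv]
    ring
  rw [Fintype.sum_prod_type]
  simp only [key]
  refine Fin.lastCases ?_ (fun p => ?_) p
  · have := hW i j
    rw [Fin.sum_univ_castSucc] at this
    simp only [kron, (Fin.castSucc_ne_last _).symm, if_false, if_true]
    push_cast
    rw [eq_neg_of_add_eq_zero_right this]
    simp
  · simp only [kron_castSucc_last, sub_zero]
    rw [Finset.sum_eq_single p]
    · simp [kron]
    · intro q _ hq
      simp [kron, hq.symm]
    · simp

lemma coMetric_eq (A : Matrix (Fin (n + 1)) (Fin (n + 1)) ℝ) (u v : CoordIndex n d)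
    (x : CoordIndex n d → ℝ) :
    (coMetric A u v x : ℂ) = coordOfEntries u.2.1 u.2.2 fun i j =>
      coordOfEntries v.2.1 v.2.2 fun k l =>
        fullEntry A (simplexMatrix x) u.1.castSucc i j v.1.castSucc k l := by
  simp only [coMetric, gammaEntry_eq_fullEntry]
  refine coordOfEntries_re_of_hermitian _ _ fun i j => ?_
  rw [← coordOfEntries_conj]
  simp only [fullEntry_conj (simplexMatrix_isHermitian x)]

lemma coordOfEntries_swap (a b a' b' : Fin d) (W : Fin d → Fin d → Fin d → Fin d → ℂ) :
    (coordOfEntries a b fun i j => coordOfEntries a' b' fun k l => W i j k l) =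
      coordOfEntries a' b' fun k l => coordOfEntries a b fun i j => W i j k l := by
  unfold coordOfEntries
  split_ifs <;> ring

lemma coMetric_comm (hA : A.IsSymm) (u v : CoordIndex n d) (x : CoordIndex n d → ℝ) :
    coMetric A u v x = coMetric A v u x := by
  apply Complex.ofReal_injective
  rw [coMetric_eq, coMetric_eq, coordOfEntries_swap]
  simp only [fun i j k l => fullEntry_comm hA (simplexMatrix x) u.1.castSucc i j v.1.castSucc k l]

/-- The value of `Γ_A` on an entry and a real coordinate. -/
lemma sum_coMetric_mul_entryDeriv (hA : A.IsSymm) (x : CoordIndex n d → ℝ) (u : CoordIndex n d)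
    (q : Fin (n + 1)) (k l : Fin d) :
    ∑ v, (coMetric A u v x : ℂ) * entryDeriv v q k l =
      coordOfEntries u.2.1 u.2.2 fun i j =>
        fullEntry A (simplexMatrix x) u.1.castSucc i j q k l := by
  simp only [coMetric_eq]
  simp only [fun v : CoordIndex n d => coordOfEntries_swap u.2.1 u.2.2 v.2.1 v.2.2
    fun i j k l => fullEntry A (simplexMatrix x) u.1.castSucc i j v.1.castSucc k l]
  refine sum_coordOfEntries_mul_entryDeriv (W := fun q k l => coordOfEntries u.2.1 u.2.2
    fun i j => fullEntry A (simplexMatrix x) u.1.castSucc i j q k l) (fun k l => ?_) q k l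
  rw [← coordOfEntries_sum]
  simp only [sum_fullEntry_right hA]
  simp [coordOfEntries]

lemma sum_sum_coMetric_mul_entryDeriv (hA : A.IsSymm) (x : CoordIndex n d → ℝ)
    (p : Fin (n + 1)) (i j : Fin d) (q : Fin (n + 1)) (k l : Fin d) :
    ∑ u, ∑ v, (coMetric A u v x : ℂ) * (entryDeriv u p i j * entryDeriv v q k l) =
      fullEntry A (simplexMatrix x) p i j q k l := by
  rw [← sum_coordOfEntries_mul_entryDeriv
    (W := fun p i j => fullEntry A (simplexMatrix x) p i j q k l)
    (fun i j => sum_fullEntry_left hA _ i j q k l) p i j]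
  refine Finset.sum_congr rfl fun u _ => ?_
  rw [← sum_coMetric_mul_entryDeriv hA, Finset.sum_mul]
  exact Finset.sum_congr rfl fun v _ => by ring

lemma carreDuChamp_simplexMatrix (hA : A.IsSymm) (x : CoordIndex n d → ℝ)
    (p : Fin (n + 1)) (i j : Fin d) (q : Fin (n + 1)) (k l : Fin d) :
    carreDuChamp (coMetric A) (fun y => simplexMatrix y p i j)
      (fun y => simplexMatrix y q k l) x = fullEntry A (simplexMatrix x) p i j q k l := by
  rw [← sum_sum_coMetric_mul_entryDeriv hA x]
  simp only [carreDuChamp, partialDeriv_simplexMatrix, Complex.real_smul]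

lemma sum_kron_mul {α : Type*} [Fintype α] [DecidableEq α] (s : α) (f : α → ℂ) :
    ∑ t, (kron t s : ℂ) * f t = f s := by
  simp [kron, apply_ite Complex.ofReal]

lemma fullEntry_eq_sum_gammaTensor (A : Matrix (Fin (n + 1)) (Fin (n + 1)) ℝ) (hA : A.IsSymm)
    (Z : Fin (n + 1) → Matrix (Fin d) (Fin d) ℂ) (p q : Fin (n + 1)) (i j k l : Fin d) :
    fullEntry A Z p i j q k l =
      ∑ r, ∑ s, ∑ a, ∑ b, ∑ c, ∑ e,
        (gammaTensor A p q i j k l r s a b c e : ℂ) * (Z r a b * Z s c e) := by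
  have inner : ∀ r s, ∑ a, ∑ b, ∑ c, ∑ e,
        (gammaTensor A p q i j k l r s a b c e : ℂ) * (Z r a b * Z s c e) =
      (A r s * (kron p q * kron p r - kron p r * kron q s) : ℝ) *
        (Z r k j * Z s i l + Z r i l * Z s k j) := fun r s => by
    have h1 : ∀ a b c e, (gammaTensor A p q i j k l r s a b c e : ℂ) * (Z r a b * Z s c e) =
      (A r s * (kron p q * kron p r - kron p r * kron q s) : ℝ) *
        ((kron a k : ℂ) * ((kron b j : ℂ) * ((kron c i : ℂ) * ((kron e l : ℂ) *
            (Z r a b * Z s c e)))) +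
          (kron a i : ℂ) * ((kron b l : ℂ) * ((kron c k : ℂ) * ((kron e j : ℂ) *
            (Z r a b * Z s c e))))) := fun a b c e => by
      simp only [gammaTensor]
      push_cast
      ring
    simp only [h1, ← Finset.mul_sum, Finset.sum_add_distrib, sum_kron_mul]
  simp only [inner]
  rw [Finset.sum_eq_single p]
  · simp only [fullEntry, kron, if_true, Finset.mul_sum]
    have h2 : ∀ s, ((A p s * ((if p = q then 1 else 0) * 1 - 1 * if q = s then 1 else 0) : ℝ) : ℂ) *
        (Z p k j * Z s i l + Z p i l * Z s k j) =
        (((if p = q then 1 else 0 : ℝ) : ℂ) * (A s p * (Z s i l * Z p k j + Z s k j * Z p i l))) -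
          (if q = s then A p s * (Z s i l * Z p k j + Z p i l * Z s k j) else 0) := fun s => by
      rw [hA.apply p s]
      split_ifs <;> push_cast <;> ring
    simp only [h2, Finset.sum_sub_distrib]
    simp
  · intro r _ hr
    simp [kron, hr.symm]
  · simp

end CoMetricEntries

/-! ### Geometry of the matrix simplex -/

section Geometry

variable {n d : ℕ}

/-- The value at `v` of the real quadratic form attached to the matrix `M`. -/
def quadForm (M : Matrix (Fin d) (Fin d) ℂ) (v : Fin d → ℂ) : ℝ :=
  (star v ⬝ᵥ (M.mulVec v)).re

lemma quadForm_add (M N : Matrix (Fin d) (Fin d) ℂ) (v : Fin d → ℂ) :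
    quadForm (M + N) v = quadForm M v + quadForm N v := by
  simp [quadForm, Matrix.add_mulVec]

lemma quadForm_sub (M N : Matrix (Fin d) (Fin d) ℂ) (v : Fin d → ℂ) :
    quadForm (M - N) v = quadForm M v - quadForm N v := by
  simp [quadForm, Matrix.sub_mulVec]

lemma quadForm_smul (c : ℝ) (M : Matrix (Fin d) (Fin d) ℂ) (v : Fin d → ℂ) :
    quadForm (c • M) v = c * quadForm M v := by
  simp [quadForm, Matrix.smul_mulVec]

lemma quadForm_smul_right (M : Matrix (Fin d) (Fin d) ℂ) (c : ℂ) (v : Fin d → ℂ) :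
    quadForm M (c • v) = ‖c‖ ^ 2 * quadForm M v := by
  have : star (c • v) ⬝ᵥ (M.mulVec (c • v)) = (‖c‖ ^ 2 : ℝ) * (star v ⬝ᵥ (M.mulVec v)) := by
    rw [Matrix.mulVec_smul, star_smul, smul_dotProduct, dotProduct_smul, smul_smul, smul_eq_mul]
    congr 1
    rw [← Complex.normSq_eq_norm_sq, Complex.normSq_eq_conj_mul_self]
    rfl
  rw [quadForm, this, Complex.re_ofReal_mul, quadForm]

lemma quadForm_continuous : Continuous fun q : Matrix (Fin d) (Fin d) ℂ × (Fin d → ℂ) =>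
    quadForm q.1 q.2 := by
  unfold quadForm
  refine Complex.continuous_re.comp ?_
  exact Continuous.dotProduct (continuous_star.comp continuous_snd)
    (Continuous.matrix_mulVec continuous_fst continuous_snd)

lemma posSemidef_iff_quadForm {M : Matrix (Fin d) (Fin d) ℂ} (hM : M.IsHermitian) :
    M.PosSemidef ↔ ∀ v, 0 ≤ quadForm M v := by
  rw [Matrix.posSemidef_iff_dotProduct_mulVec]
  refine ⟨fun h v => (Complex.nonneg_iff.1 (h.2 v)).1, fun h => ⟨hM, fun v => ?_⟩⟩
  exact Complex.nonneg_iff.2 ⟨h v, (hM.im_star_dotProduct_mulVec_self v).symm⟩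

lemma posDef_iff_quadForm {M : Matrix (Fin d) (Fin d) ℂ} (hM : M.IsHermitian) :
    M.PosDef ↔ ∀ v ≠ 0, 0 < quadForm M v := by
  rw [Matrix.posDef_iff_dotProduct_mulVec]
  refine ⟨fun h v hv => (Complex.pos_iff.1 (h.2 hv)).1, fun h => ⟨hM, fun v hv => ?_⟩⟩
  exact Complex.pos_iff.2 ⟨h v hv, (hM.im_star_dotProduct_mulVec_self v).symm⟩

/-- Positive definiteness is an open condition, by compactness of the unit sphere. -/
lemma eventually_posDef {X : Type*} [TopologicalSpace X] {M : X → Matrix (Fin d) (Fin d) ℂ}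
    (hM : Continuous M) (hH : ∀ x, (M x).IsHermitian) {x : X} (hx : (M x).PosDef) :
    ∀ᶠ y in 𝓝 x, (M y).PosDef := by
  have hK : IsCompact (Metric.sphere (0 : Fin d → ℂ) 1) := isCompact_sphere _ _
  have hcont : Continuous fun z : X × (Fin d → ℂ) => quadForm (M z.1) z.2 :=
    quadForm_continuous.comp ((hM.comp continuous_fst).prodMk continuous_snd)
  have := hK.eventually_forall_of_forall_eventually (x₀ := x)
    (P := fun y v => 0 < quadForm (M y) v) fun v hv => by
      refine hcont.continuousAt.eventually (lt_mem_nhds ?_)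
      refine (posDef_iff_quadForm (hH x)).1 hx v ?_
      rintro rfl
      simp at hv
  filter_upwards [this] with y hy
  refine (posDef_iff_quadForm (hH y)).2 fun v hv => ?_
  have h1 : 0 < ‖v‖ := norm_pos_iff.2 hv
  have h2 := hy (((‖v‖ : ℝ) : ℂ)⁻¹ • v) (by simp [norm_smul, h1.ne'])
  rw [quadForm_smul_right] at h2
  exact pos_of_mul_pos_right h2 (by positivity)

lemma mem_matrixSimplex_iff {x : CoordIndex n d → ℝ} :
    x ∈ matrixSimplex n d ↔ ∀ p, (simplexMatrix x p).PosSemidef := by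
  constructor
  · rintro ⟨h1, h2⟩ p
    refine Fin.lastCases ?_ (fun p => ?_) p
    · simpa using h2
    · simpa using h1 p
  · intro h
    exact ⟨fun k => by simpa using h k.castSucc, by simpa using h (Fin.last n)⟩

/-- Barycenter of the simplex: all `n + 1` matrices are equal to `(n + 1)⁻¹`. -/
lemma exists_barycenter (n d : ℕ) : ∃ x : CoordIndex n d → ℝ, ∀ p,
    simplexMatrix x p = ((n + 1 : ℝ)⁻¹) • (1 : Matrix (Fin d) (Fin d) ℂ) := by
  refine exists_simplexMatrix_eq (fun p => ?_) ?_
  · exact Matrix.isHermitian_one.smul (IsSelfAdjoint.all _)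
  · rw [Finset.sum_const, Finset.card_univ, Fintype.card_fin, ← Nat.cast_smul_eq_nsmul ℝ, smul_smul,
      Nat.cast_succ, mul_inv_cancel₀ (by positivity), one_smul]

lemma posDef_smul_real {M : Matrix (Fin d) (Fin d) ℂ} (hM : M.PosDef) {c : ℝ} (hc : 0 < c) :
    (c • M).PosDef := by
  have hH : (c • M).IsHermitian := hM.1.smul (IsSelfAdjoint.all c)
  refine (posDef_iff_quadForm hH).2 fun v hv => ?_
  rw [quadForm_smul]
  exact mul_pos hc ((posDef_iff_quadForm hM.1).1 hM v hv)

lemma posSemidef_smul_real {M : Matrix (Fin d) (Fin d) ℂ} (hM : M.PosSemidef) {c : ℝ}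
    (hc : 0 ≤ c) : (c • M).PosSemidef := by
  have hH : (c • M).IsHermitian := hM.1.smul (IsSelfAdjoint.all c)
  refine (posSemidef_iff_quadForm hH).2 fun v => ?_
  rw [quadForm_smul]
  exact mul_nonneg hc ((posSemidef_iff_quadForm hM.1).1 hM v)

lemma isOpen_setOf_posDef (n d : ℕ) :
    IsOpen {x : CoordIndex n d → ℝ | ∀ p, (simplexMatrix x p).PosDef} := by
  rw [isOpen_iff_mem_nhds]
  intro x hx
  rw [← Filter.eventually_mem_set]
  simp only [Set.mem_ofPred_eq, Filter.eventually_all]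
  exact fun p => eventually_posDef (simplexMatrix_continuous p)
    (fun y => simplexMatrix_isHermitian y p) (hx p)

lemma mem_interior_matrixSimplex_iff {x : CoordIndex n d → ℝ} :
    x ∈ interior (matrixSimplex n d) ↔ ∀ p, (simplexMatrix x p).PosDef := by
  constructor
  · intro hx p
    obtain ⟨c, hc⟩ := exists_barycenter n d
    -- move slightly away from the barycenter
    have hcont : Continuous fun t : ℝ => (1 + t) • x + (-t) • c := by fun_prop
    have hev : ∀ᶠ t in 𝓝 (0 : ℝ), (1 + t) • x + (-t) • c ∈ matrixSimplex n d := by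
      have : (fun t : ℝ => (1 + t) • x + (-t) • c) 0 ∈ interior (matrixSimplex n d) := by
        simpa using hx
      exact (hcont.continuousAt.eventually (isOpen_interior.mem_nhds this)).mono
        fun t ht => interior_subset ht
    obtain ⟨t, ht, ht0⟩ := ((hev.filter_mono nhdsWithin_le_nhds).and
      (self_mem_nhdsWithin : ∀ᶠ t in 𝓝[>] (0 : ℝ), 0 < t)).exists
    have ht0 : (0 : ℝ) < t := ht0
    have h1 := mem_matrixSimplex_iff.1 ht p
    rw [simplexMatrix_affine _ _ _ _ (by ring), hc] at h1
    refine (posDef_iff_quadForm (simplexMatrix_isHermitian x p)).2 fun v hv => ?_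
    have h2 := (posSemidef_iff_quadForm h1.1).1 h1 v
    rw [quadForm_add, quadForm_smul, quadForm_smul, quadForm_smul] at h2
    have h3 : 0 < quadForm (1 : Matrix (Fin d) (Fin d) ℂ) v :=
      (posDef_iff_quadForm Matrix.isHermitian_one).1 Matrix.PosDef.one v hv
    have h4 : 0 < t * ((n + 1 : ℝ)⁻¹ * quadForm (1 : Matrix (Fin d) (Fin d) ℂ) v) := by positivity
    have h5 : 0 < (1 + t) * quadForm (simplexMatrix x p) v := by linarith
    exact pos_of_mul_pos_right h5 (by positivity)
  · intro hx
    refine mem_interior.2 ⟨_, fun y hy => ?_, isOpen_setOf_posDef n d, hx⟩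
    exact mem_matrixSimplex_iff.2 fun p => (hy p).posSemidef

lemma convex_matrixSimplex (n d : ℕ) : Convex ℝ (matrixSimplex n d) := by
  intro x hx y hy s t hs ht hst
  rw [mem_matrixSimplex_iff] at *
  intro p
  rw [simplexMatrix_affine _ _ _ _ hst]
  exact (posSemidef_smul_real (hx p) hs).add (posSemidef_smul_real (hy p) ht)

lemma isClosed_matrixSimplex (n d : ℕ) : IsClosed (matrixSimplex n d) := by
  have : matrixSimplex n d = ⋂ p, ⋂ v, {x | 0 ≤ quadForm (simplexMatrix x p) v} := by
    ext x
    simp only [mem_matrixSimplex_iff, Set.mem_iInter, Set.mem_ofPred_eq,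
      posSemidef_iff_quadForm (simplexMatrix_isHermitian x _)]
  rw [this]
  refine isClosed_iInter fun p => isClosed_iInter fun v => isClosed_le continuous_const ?_
  exact quadForm_continuous.comp ((simplexMatrix_continuous p).prodMk continuous_const)

lemma interior_matrixSimplex_nonempty (n d : ℕ) : (interior (matrixSimplex n d)).Nonempty := by
  obtain ⟨c, hc⟩ := exists_barycenter n d
  refine ⟨c, mem_interior_matrixSimplex_iff.2 fun p => ?_⟩
  rw [hc]
  exact posDef_smul_real Matrix.PosDef.one (by positivity)

lemma isConnected_interior_matrixSimplex (n d : ℕ) :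
    IsConnected (interior (matrixSimplex n d)) :=
  ⟨interior_matrixSimplex_nonempty n d, (convex_matrixSimplex n d).interior.isPreconnected⟩

/-- Entries of a positive semidefinite matrix with diagonal at most `1` have modulus at most `1`. -/
lemma norm_apply_le_one {M : Matrix (Fin d) (Fin d) ℂ} (hM : M.PosSemidef)
    (h1 : ∀ i, (M i i).re ≤ 1) (i j : Fin d) : ‖M i j‖ ≤ 1 := by
  have hdet := (hM.submatrix ![i, j]).det_nonneg
  rw [Matrix.det_fin_two] at hdet
  simp only [Matrix.submatrix_apply, Matrix.cons_val_zero, Matrix.cons_val_one] at hdet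
  have hji : M j i = star (M i j) := (hM.1.apply j i).symm
  have hii : ∀ i, M i i = ((M i i).re : ℂ) := fun i => by
    have := hM.1.apply i i
    exact (Complex.conj_eq_iff_re.1 this).symm
  have hnn : ∀ i, 0 ≤ (M i i).re := fun i => (Complex.nonneg_iff.1 (hM.diag_nonneg (i := i))).1
  have h2 : M i j * M j i = ((‖M i j‖ ^ 2 : ℝ) : ℂ) := by
    rw [hji, ← Complex.normSq_eq_norm_sq, Complex.normSq_eq_conj_mul_self, mul_comm]
    rfl
  rw [h2, hii i, hii j, ← Complex.ofReal_mul, ← Complex.ofReal_sub] at hdet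
  have h3 : 0 ≤ (M i i).re * (M j j).re - ‖M i j‖ ^ 2 := by exact_mod_cast hdet
  have h4 : (M i i).re * (M j j).re ≤ 1 := mul_le_one₀ (h1 i) (hnn j) (h1 j)
  exact (sq_le_one_iff₀ (norm_nonneg _)).1 (by linarith)

lemma diag_simplexMatrix_le_one {x : CoordIndex n d → ℝ} (hx : x ∈ matrixSimplex n d)
    (p : Fin (n + 1)) (i : Fin d) : (simplexMatrix x p i i).re ≤ 1 := by
  have hx := mem_matrixSimplex_iff.1 hx
  have h := congrArg Complex.re (congrFun (congrFun (sum_simplexMatrix x) i) i)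
  rw [Matrix.sum_apply, Complex.re_sum, Matrix.one_apply_eq, Complex.one_re] at h
  rw [← h]
  exact Finset.single_le_sum (f := fun q => (simplexMatrix x q i i).re)
    (fun q _ => (Complex.nonneg_iff.1 ((hx q).diag_nonneg (i := i))).1) (Finset.mem_univ p)

lemma norm_simplexMatrix_apply_le_one {x : CoordIndex n d → ℝ} (hx : x ∈ matrixSimplex n d)
    (p : Fin (n + 1)) (i j : Fin d) : ‖simplexMatrix x p i j‖ ≤ 1 :=
  norm_apply_le_one (mem_matrixSimplex_iff.1 hx p) (diag_simplexMatrix_le_one hx p) i j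

/-- Real coordinates of a Hermitian matrix are bounded by its entries. -/
lemma abs_coord_le_of_norm_le {x : CoordIndex n d → ℝ} {p : Fin n} {c : ℝ}
    (h : ∀ i j, ‖hermMatrix x p i j‖ ≤ c) (i j : Fin d) : |x (p, i, j)| ≤ c := by
  rcases lt_trichotomy i j with hij | hij | hij
  · have h1 : x (p, i, j) = (hermMatrix x p i j).re := by simp [hermMatrix, hij, hij.ne]
    exact h1 ▸ (Complex.abs_re_le_norm _).trans (h i j)
  · subst hij
    have h1 : x (p, i, i) = (hermMatrix x p i i).re := by simp [hermMatrix]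
    exact h1 ▸ (Complex.abs_re_le_norm _).trans (h i i)
  · have h1 : x (p, i, j) = (hermMatrix x p j i).im := by simp [hermMatrix, hij, hij.ne]
    exact h1 ▸ (Complex.abs_im_le_norm _).trans (h j i)

lemma isBounded_matrixSimplex (n d : ℕ) : Bornology.IsBounded (matrixSimplex n d) := by
  refine (Metric.isBounded_closedBall (x := (0 : CoordIndex n d → ℝ)) (r := 1)).subset
    fun x hx => ?_
  rw [mem_closedBall_zero_iff, pi_norm_le_iff_of_nonneg zero_le_one]
  rintro ⟨p, i, j⟩
  rw [Real.norm_eq_abs]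
  refine abs_coord_le_of_norm_le (fun i j => ?_) i j
  simpa using norm_simplexMatrix_apply_le_one hx p.castSucc i j

lemma isCompact_matrixSimplex (n d : ℕ) : IsCompact (matrixSimplex n d) :=
  Metric.isCompact_of_isClosed_isBounded (isClosed_matrixSimplex n d) (isBounded_matrixSimplex n d)

lemma volume_restrict_matrixSimplex (n d : ℕ) :
    (volume : Measure (CoordIndex n d → ℝ)).restrict (matrixSimplex n d) =
      volume.restrict (interior (matrixSimplex n d)) := by
  refine (Measure.restrict_congr_set ?_).symm
  exact interior_ae_eq_of_null_frontier ((convex_matrixSimplex n d).addHaar_frontier volume)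

lemma ofReal_det_simplexMatrix_re (x : CoordIndex n d → ℝ) (p : Fin (n + 1)) :
    ((simplexMatrix x p).det.re : ℂ) = (simplexMatrix x p).det := by
  rw [← Complex.conj_eq_iff_re]
  have := congrArg Matrix.det (simplexMatrix_isHermitian x p).eq
  rw [Matrix.det_conjTranspose] at this
  exact this

lemma det_re_pos {x : CoordIndex n d → ℝ} (hx : x ∈ interior (matrixSimplex n d))
    (p : Fin (n + 1)) : 0 < (simplexMatrix x p).det.re :=
  (Complex.pos_iff.1 (mem_interior_matrixSimplex_iff.1 hx p).det_pos).1

lemma contDiff_det_simplexMatrix (p : Fin (n + 1)) {m : WithTop ℕ∞} :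
    ContDiff ℝ m (fun y : CoordIndex n d → ℝ => (simplexMatrix y p).det) := by
  simp only [Matrix.det_apply]
  refine ContDiff.sum fun σ _ => ContDiff.const_smul _ ?_
  exact contDiff_prod fun i _ => contDiff_simplexMatrix p _ _

lemma contDiff_det_re (p : Fin (n + 1)) {m : WithTop ℕ∞} :
    ContDiff ℝ m (fun y : CoordIndex n d → ℝ => (simplexMatrix y p).det.re) :=
  Complex.reCLM.contDiff.comp (contDiff_det_simplexMatrix p)

end Geometry

/-! ### The singular boundary points of a convex set -/

section ConvexSingular

variable {ι : Type*} [Fintype ι]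

/-- `x` is the nearest point of `K` to `p`, in variational form. -/
def IsNearestPoint (K : Set (ι → ℝ)) (p x : ι → ℝ) : Prop :=
  x ∈ K ∧ ∀ y ∈ K, ∑ i, (p i - x i) * (y i - x i) ≤ 0

/-- The nearest point depends on the point in a Lipschitz way. -/
lemma dist_le_of_isNearestPoint {K : Set (ι → ℝ)} {p x p' x' : ι → ℝ}
    (h : IsNearestPoint K p x) (h' : IsNearestPoint K p' x') :
    dist x x' ≤ (Fintype.card ι : ℝ) * dist p p' := by
  have h1 := h.2 x' h'.1
  have h2 := h'.2 x h.1
  have h3 : ∑ i, (x i - x' i) ^ 2 ≤ ∑ i, (p i - p' i) ^ 2 := by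
    have e : ∑ i, (p i - p' i) ^ 2 - ∑ i, (x i - x' i) ^ 2 =
        ∑ i, ((x i - x' i) - (p i - p' i)) ^ 2 -
          2 * (∑ i, (p i - x i) * (x' i - x i) + ∑ i, (p' i - x' i) * (x i - x' i)) := by
      rw [← Finset.sum_sub_distrib, ← Finset.sum_add_distrib, Finset.mul_sum,
        ← Finset.sum_sub_distrib]
      exact Finset.sum_congr rfl fun i _ => by ring
    have h4 : 0 ≤ ∑ i, ((x i - x' i) - (p i - p' i)) ^ 2 :=
      Finset.sum_nonneg fun i _ => sq_nonneg _
    linarith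
  have h4 : ∑ i, (p i - p' i) ^ 2 ≤ Fintype.card ι * dist p p' ^ 2 := by
    rw [← nsmul_eq_mul, ← Finset.card_univ]
    refine Finset.sum_le_card_nsmul _ _ _ fun i _ => ?_
    rw [← sq_abs, ← Real.dist_eq]
    exact pow_le_pow_left₀ dist_nonneg (dist_le_pi_dist p p' i) 2
  refine (dist_pi_le_iff (by positivity)).2 fun i => ?_
  rw [Real.dist_eq]
  refine abs_le_of_sq_le_sq (a := x i - x' i) ?_ (by positivity)
  have h5 : (x i - x' i) ^ 2 ≤ ∑ i, (x i - x' i) ^ 2 :=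
    Finset.single_le_sum (f := fun i => (x i - x' i) ^ 2) (fun i _ => sq_nonneg _)
      (Finset.mem_univ i)
  have h6 : (Fintype.card ι : ℝ) ≤ (Fintype.card ι : ℝ) ^ 2 := by
    exact_mod_cast Nat.le_self_pow two_ne_zero _
  have h7 : (Fintype.card ι : ℝ) * dist p p' ^ 2 ≤ (Fintype.card ι : ℝ) ^ 2 * dist p p' ^ 2 :=
    mul_le_mul_of_nonneg_right h6 (sq_nonneg _)
  rw [mul_pow]
  linarith

lemma dimH_codim_two_plane_le [DecidableEq ι] {i j : ι} (hij : i ≠ j) (a b : ℝ) :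
    dimH {p : ι → ℝ | p i = a ∧ p j = b} ≤ ((Fintype.card ι - 2 : ℕ) : ENNReal) := by
  let g : ({k : ι // k ∉ ({i, j} : Finset ι)} → ℝ) → (ι → ℝ) := fun t k =>
    if h : k ∉ ({i, j} : Finset ι) then t ⟨k, h⟩ else if k = i then a else b
  have hg : ContDiff ℝ 1 g := by
    refine contDiff_pi.2 fun k => ?_
    by_cases h : k ∉ ({i, j} : Finset ι)
    · simp only [g, dif_pos h]
      exact contDiff_apply ℝ ℝ _
    · simp only [g, dif_neg h]
      exact contDiff_const
  have hsub : {p : ι → ℝ | p i = a ∧ p j = b} ⊆ Set.range g := by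
    rintro p ⟨hi, hj⟩
    refine ⟨fun k => p k, ?_⟩
    funext k
    by_cases h : k ∉ ({i, j} : Finset ι)
    · simp only [g, dif_pos h]
    · simp only [g, dif_neg h]
      simp only [not_not, Finset.mem_insert, Finset.mem_singleton] at h
      rcases h with rfl | rfl
      · simp [hi]
      · simp [hij.symm, hj]
  refine (dimH_mono hsub).trans (hg.dimH_range_le.trans ?_)
  have hcard : Fintype.card {k : ι // k ∉ ({i, j} : Finset ι)} = Fintype.card ι - 2 := by
    rw [Fintype.card_subtype_compl]
    rw [Fintype.card_coe, Finset.card_pair hij]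
  rw [Module.finrank_fintype_fun_eq_card, hcard]

/-- The set of points of a convex set at which there are two independent supporting functionals
is negligible in codimension one: such points are nearest points to the points of countably many
affine subspaces of codimension two, namely those on which two of the coordinates are equal to given
rational numbers. -/
lemma hausdorffMeasure_eq_zero_of_two_supports {K S : Set (ι → ℝ)}
    (hS : ∀ x ∈ S, x ∈ K ∧ ∃ l₁ l₂ : (ι → ℝ) →ₗ[ℝ] ℝ,
      (∀ y ∈ K, 0 ≤ l₁ (y - x)) ∧ (∀ y ∈ K, 0 ≤ l₂ (y - x)) ∧
      (∃ y, l₁ y = 0 ∧ l₂ y ≠ 0) ∧ (∃ y, l₁ y ≠ 0 ∧ l₂ y = 0)) :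
    Measure.hausdorffMeasure ((Fintype.card ι : ℝ) - 1) S = 0 := by
  classical
  let f : (ι → ℝ) → (ι → ℝ) := fun p =>
    if h : ∃ x, IsNearestPoint K p x then h.choose else 0
  let T : Set (ι → ℝ) := {p | ∃ x, IsNearestPoint K p x}
  have hfT : ∀ p ∈ T, IsNearestPoint K p (f p) := fun p hp => by
    have hp' : ∃ x, IsNearestPoint K p x := hp
    simp only [f, dif_pos hp']
    exact hp'.choose_spec
  have hLip : LipschitzOnWith (Fintype.card ι : NNReal) f T := by
    refine LipschitzOnWith.of_dist_le_mul fun p hp p' hp' => ?_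
    simpa using dist_le_of_isNearestPoint (hfT p hp) (hfT p' hp')
  let Q : (({ij : ι × ι // ij.1 ≠ ij.2}) × ℚ × ℚ) → Set (ι → ℝ) := fun s =>
    {p | p s.1.1.1 = s.2.1 ∧ p s.1.1.2 = s.2.2}
  have hcover : S ⊆ ⋃ s, f '' (T ∩ Q s) := by
    intro x hx
    obtain ⟨hxK, l₁, l₂, h₁, h₂, ⟨y₁, hy₁, hy₁'⟩, ⟨y₂, hy₂, hy₂'⟩⟩ := hS x hx
    have hl : ∀ (l : (ι → ℝ) →ₗ[ℝ] ℝ) y, l y = ∑ i, l (Pi.single i 1) * y i := fun l y => by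
      conv_lhs => rw [pi_eq_sum_univ' y]
      simp [mul_comm, ← Pi.single_apply, Pi.single_comm]
    set c₁ : ι → ℝ := fun i => l₁ (Pi.single i 1) with hc₁
    set c₂ : ι → ℝ := fun i => l₂ (Pi.single i 1) with hc₂
    obtain ⟨i, j, hij⟩ : ∃ i j, c₁ i * c₂ j - c₁ j * c₂ i ≠ 0 := by
      by_contra! hcon
      obtain ⟨i, hi⟩ : ∃ i, c₁ i ≠ 0 := by
        by_contra! h0
        exact hy₂ (by rw [hl]; exact Finset.sum_eq_zero fun i _ => by rw [show l₁ _ = 0 from h0 i, zero_mul])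
      have : c₁ i * l₂ y₁ = c₂ i * l₁ y₁ := by
        rw [hl l₁, hl l₂, Finset.mul_sum, Finset.mul_sum]
        refine Finset.sum_congr rfl fun k _ => ?_
        have := hcon i k
        change c₁ i * (c₂ k * y₁ k) = c₂ i * (c₁ k * y₁ k)
        linear_combination y₁ k * this
      rw [hy₁, mul_zero] at this
      exact (mul_ne_zero hi hy₁') this
    have hne : i ≠ j := by
      rintro rfl
      exact hij (by ring)
    set D := c₁ i * c₂ j - c₁ j * c₂ i with hD
    -- Cramer's rule: the coefficients of `p - x` for which `p i` and `p j` are prescribed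
    let σ : ℝ × ℝ → ℝ := fun q => ((x i - q.1) * c₂ j - (x j - q.2) * c₂ i) / D
    let τ : ℝ × ℝ → ℝ := fun q => (c₁ i * (x j - q.2) - c₁ j * (x i - q.1)) / D
    have hσc : Continuous σ := by fun_prop
    have hτc : Continuous τ := by fun_prop
    let q₀ : ℝ × ℝ := (x i - c₁ i - c₂ i, x j - c₁ j - c₂ j)
    have hσ0 : σ q₀ = 1 := by
      simp only [σ, q₀]
      rw [div_eq_one_iff_eq hij, hD]
      ring
    have hτ0 : τ q₀ = 1 := by
      simp only [τ, q₀]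
      rw [div_eq_one_iff_eq hij, hD]
      ring
    have hopen : IsOpen {q : ℝ × ℝ | 0 < σ q ∧ 0 < τ q} :=
      (isOpen_lt continuous_const hσc).inter (isOpen_lt continuous_const hτc)
    obtain ⟨⟨r₁, r₂⟩, hr⟩ := (Rat.denseRange_cast.prodMap Rat.denseRange_cast).exists_mem_open
      hopen ⟨q₀, by simp [hσ0], by simp [hτ0]⟩
    obtain ⟨hσ, hτ⟩ := hr
    simp only [Prod.map_apply] at hσ hτ
    set s := σ ((r₁ : ℝ), (r₂ : ℝ)) with hs
    set t := τ ((r₁ : ℝ), (r₂ : ℝ)) with ht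
    let p : ι → ℝ := fun k => x k - s * c₁ k - t * c₂ k
    have hp : IsNearestPoint K p x := by
      refine ⟨hxK, fun y hy => ?_⟩
      have e : ∑ k, (p k - x k) * (y k - x k) = -(s * l₁ (y - x) + t * l₂ (y - x)) := by
        rw [hl l₁, hl l₂, Finset.mul_sum, Finset.mul_sum, ← Finset.sum_add_distrib,
          ← Finset.sum_neg_distrib]
        refine Finset.sum_congr rfl fun k _ => ?_
        simp only [p, Pi.sub_apply]
        change (x k - s * c₁ k - t * c₂ k - x k) * (y k - x k) =
          -(s * (c₁ k * (y k - x k)) + t * (c₂ k * (y k - x k)))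
        ring
      rw [e]
      have := mul_nonneg hσ.le (h₁ y hy)
      have := mul_nonneg hτ.le (h₂ y hy)
      linarith
    have hpi : p i = r₁ := by
      have e : s * D = (x i - r₁) * c₂ j - (x j - r₂) * c₂ i := div_mul_cancel₀ _ hij
      have e' : t * D = c₁ i * (x j - r₂) - c₁ j * (x i - r₁) := div_mul_cancel₀ _ hij
      have : (p i - r₁) * D = 0 := by
        simp only [p]
        linear_combination (-c₁ i) * e + (-c₂ i) * e' + (x i - r₁) * hD
      exact sub_eq_zero.1 ((mul_eq_zero.1 this).resolve_right hij)
    have hpj : p j = r₂ := by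
      have e : s * D = (x i - r₁) * c₂ j - (x j - r₂) * c₂ i := div_mul_cancel₀ _ hij
      have e' : t * D = c₁ i * (x j - r₂) - c₁ j * (x i - r₁) := div_mul_cancel₀ _ hij
      have : (p j - r₂) * D = 0 := by
        simp only [p]
        linear_combination (-c₁ j) * e + (-c₂ j) * e' + (x j - r₂) * hD
      exact sub_eq_zero.1 ((mul_eq_zero.1 this).resolve_right hij)
    refine Set.mem_iUnion.2 ⟨(⟨(i, j), hne⟩, r₁, r₂), p, ⟨⟨x, hp⟩, hpi, hpj⟩, ?_⟩
    have hd := dist_le_of_isNearestPoint (hfT p ⟨x, hp⟩) hp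
    rw [dist_self, mul_zero] at hd
    exact dist_le_zero.1 hd
  refine measure_mono_null hcover (measure_iUnion_null fun s => ?_)
  have hcard : 2 ≤ Fintype.card ι := by
    rw [← Finset.card_pair s.1.2]
    exact Finset.card_le_univ _
  have hdim : dimH (f '' (T ∩ Q s)) < ((Fintype.card ι - 1 : ℕ) : NNReal) := by
    refine ((hLip.mono Set.inter_subset_left).dimH_image_le.trans
      ((dimH_mono Set.inter_subset_right).trans (dimH_codim_two_plane_le s.1.2 _ _))).trans_lt ?_
    have : Fintype.card ι - 2 < Fintype.card ι - 1 := by omega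
    exact_mod_cast this
  have := hausdorffMeasure_of_dimH_lt hdim
  convert this using 2
  rw [NNReal.coe_natCast, Nat.cast_sub (by omega), Nat.cast_one]

end ConvexSingular

/-! ### The boundary of the matrix simplex -/

section Boundary

open scoped Matrix

variable {n d : ℕ}

/-- The rank one matrix `v v^*`. -/
def rankOne (v : Fin d → ℂ) : Matrix (Fin d) (Fin d) ℂ := Matrix.vecMulVec v (star v)

lemma rankOne_posSemidef (v : Fin d → ℂ) : (rankOne v).PosSemidef :=
  Matrix.posSemidef_vecMulVec_self_star v

lemma rankOne_mulVec (v w : Fin d → ℂ) : (rankOne v).mulVec w = (star v ⬝ᵥ w) • v := by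
  ext i
  simp [rankOne, Matrix.vecMulVec_mulVec, mul_comm]

lemma quadForm_rankOne (v w : Fin d → ℂ) : quadForm (rankOne v) w = ‖star v ⬝ᵥ w‖ ^ 2 := by
  have h : star w ⬝ᵥ v = star (star v ⬝ᵥ w) := by
    rw [Matrix.star_dotProduct]
  rw [quadForm, rankOne_mulVec, dotProduct_smul, h, smul_eq_mul, ← Complex.normSq_eq_norm_sq,
    ← Complex.ofReal_re (Complex.normSq _), ← Complex.mul_conj]
  rfl

lemma quadForm_one (v : Fin d → ℂ) : quadForm 1 v = (star v ⬝ᵥ v).re := by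
  simp [quadForm]

/-- If `N` is positive definite, then `N - v v^*` is positive definite as soon as its determinant is
positive: both conditions say that the Schur complement `1 - v^* N⁻¹ v` is positive. -/
lemma posDef_sub_rankOne {N : Matrix (Fin d) (Fin d) ℂ} (hN : N.PosDef) {v : Fin d → ℂ}
    (h : 0 < (N - rankOne v).det.re) : (N - rankOne v).PosDef := by
  let B : Matrix (Fin d) Unit ℂ := Matrix.replicateCol Unit v
  have hB : B * Bᴴ = rankOne v := by
    ext i j
    simp [B, rankOne, Matrix.mul_apply, Matrix.vecMulVec_apply]
  have : Invertible N := hN.isUnit.invertible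
  have : Invertible (1 : Matrix Unit Unit ℂ) := invertibleOne
  have hdet : (N - rankOne v).det = N.det * (1 - Bᴴ * N⁻¹ * B).det := by
    rw [← hB, ← Matrix.det_fromBlocks_one₂₂, Matrix.det_fromBlocks₁₁, Matrix.invOf_eq_nonsing_inv]
  have hS : (1 - Bᴴ * N⁻¹ * B).IsHermitian := by
    refine Matrix.isHermitian_one.sub ?_
    exact Matrix.isHermitian_conjTranspose_mul_mul B hN.inv.isHermitian
  have hpos : (1 - Bᴴ * N⁻¹ * B).PosSemidef := by
    set s : ℂ := (1 - Bᴴ * N⁻¹ * B : Matrix Unit Unit ℂ) () () with hs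
    have e1 : (1 - Bᴴ * N⁻¹ * B).det = s := Matrix.det_unique _
    have e2 : (s.re : ℂ) = s := Complex.conj_eq_iff_re.1 (hS.apply () ())
    have e3 : (N.det.re : ℂ) = N.det :=
      (Complex.conj_eq_iff_re.1 (Complex.conj_eq_iff_im.2 (Complex.pos_iff.1 hN.det_pos).2.symm))
    rw [hdet, e1, ← e2, ← e3, ← Complex.ofReal_mul, Complex.ofReal_re] at h
    have h1 : 0 < s.re := pos_of_mul_pos_right h (Complex.pos_iff.1 hN.det_pos).1.le
    refine Matrix.PosSemidef.of_dotProduct_mulVec_nonneg hS fun w => ?_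
    have : star w ⬝ᵥ (1 - Bᴴ * N⁻¹ * B).mulVec w = s * ((‖w ()‖ ^ 2 : ℝ) : ℂ) := by
      simp only [dotProduct, Matrix.mulVec, Finset.univ_unique, Finset.sum_singleton, ← hs,
        PUnit.default_eq_unit, Pi.star_apply]
      rw [← Complex.normSq_eq_norm_sq, Complex.normSq_eq_conj_mul_self]
      simp only [starRingEnd_apply]
      ring
    rw [this, ← e2, ← Complex.ofReal_mul]
    exact_mod_cast mul_nonneg h1.le (sq_nonneg _)
  have h2 := (Matrix.PosDef.fromBlocks₂₂ N B (D := (1 : Matrix Unit Unit ℂ))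
    Matrix.PosDef.one).1 ((Matrix.PosDef.fromBlocks₁₁ B (1 : Matrix Unit Unit ℂ) hN).2 hpos)
  rw [inv_one, Matrix.mul_one, hB] at h2
  refine h2.posDef_iff_det_ne_zero.2 fun h0 => ?_
  rw [h0] at h
  simp at h

lemma exists_smul_unit {v : Fin d → ℂ} (hv : v ≠ 0) : ∃ c : ℂ, star (c • v) ⬝ᵥ (c • v) = 1 := by
  have h1 : 0 < star v ⬝ᵥ v := Matrix.dotProduct_star_self_pos_iff.2 hv
  set r : ℝ := (star v ⬝ᵥ v).re with hr
  have h2 : star v ⬝ᵥ v = r := (Complex.conj_eq_iff_re.1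
    (Complex.conj_eq_iff_im.2 (Complex.pos_iff.1 h1).2.symm)).symm
  have hr0 : 0 < r := (Complex.pos_iff.1 h1).1
  refine ⟨(((√r)⁻¹ : ℝ) : ℂ), ?_⟩
  rw [star_smul, smul_dotProduct, dotProduct_smul, h2, smul_eq_mul, smul_eq_mul,
    Complex.star_def, Complex.conj_ofReal, ← Complex.ofReal_mul, ← Complex.ofReal_mul]
  norm_cast
  rw [← mul_assoc, ← mul_inv, Real.mul_self_sqrt hr0.le, inv_mul_cancel₀ hr0.ne']

lemma exists_mulVec_eq_zero_of_not_posDef {M : Matrix (Fin d) (Fin d) ℂ} (hM : M.PosSemidef)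
    (h : ¬ M.PosDef) : ∃ v, star v ⬝ᵥ v = 1 ∧ M.mulVec v = 0 := by
  rw [hM.posDef_iff_det_ne_zero, not_not] at h
  obtain ⟨v, hv, hv0⟩ := Matrix.exists_mulVec_eq_zero_iff.2 h
  obtain ⟨c, hc⟩ := exists_smul_unit hv
  exact ⟨c • v, hc, by rw [Matrix.mulVec_smul, hv0, smul_zero]⟩

/-- Along `v v^*`, where `v` is a unit vector in the kernel of `M`, the determinant is linear. -/
lemma det_add_smul_rankOne {M : Matrix (Fin d) (Fin d) ℂ} {v : Fin d → ℂ}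
    (hv : star v ⬝ᵥ v = 1) (hMv : M.mulVec v = 0) (t : ℂ) :
    (M + t • rankOne v).det = t * (M + rankOne v).det := by
  have h1 : M * rankOne v = 0 := by
    rw [rankOne, Matrix.mul_vecMulVec, hMv, Matrix.zero_vecMulVec]
  have h2 : rankOne v * rankOne v = rankOne v := by
    rw [rankOne, Matrix.vecMulVec_mul_vecMulVec, hv, one_smul]
  have h3 : M + t • rankOne v = (M + rankOne v) * (1 + (t - 1) • rankOne v) := by
    rw [mul_add, mul_one, mul_smul_comm, add_mul, h1, h2, zero_add, sub_smul, one_smul]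
    abel
  have h4 : (1 + (t - 1) • rankOne v).det = t := by
    have : (t - 1) • rankOne v =
        Matrix.replicateCol Unit ((t - 1) • v) * Matrix.replicateRow Unit (star v) := by
      ext i j
      simp [rankOne, Matrix.mul_apply, Matrix.vecMulVec_apply, mul_assoc]
    rw [this, Matrix.det_one_add_replicateCol_mul_replicateRow, dotProduct_smul, hv]
    simp
  rw [h3, Matrix.det_mul, h4, mul_comm]

lemma exists_simplexDir_eq {W : Fin (n + 1) → Matrix (Fin d) (Fin d) ℂ}
    (hW : ∀ p, (W p).IsHermitian) (hsum : ∑ p, W p = 0) :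
    ∃ y : CoordIndex n d → ℝ, ∀ p, simplexDir y p = W p := by
  refine ⟨coordVec fun p => W p.castSucc, fun p => ?_⟩
  refine Fin.lastCases ?_ (fun p => ?_) p
  · rw [simplexDir_last]
    simp only [hermMatrix_coordVec (fun p : Fin n => hW p.castSucc)]
    rw [Fin.sum_univ_castSucc] at hsum
    exact (eq_neg_of_add_eq_zero_right hsum).symm
  · rw [simplexDir_castSucc, hermMatrix_coordVec fun p : Fin n => hW p.castSucc]

/-- If two entries of a tuple are prescribed and the others vanish, the sum is the sum of both. -/
lemma sum_ite_ite {α : Type*} [AddCommMonoid α] {p q : Fin (n + 1)} (hpq : p ≠ q) (a b : α) :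
    ∑ s, (if s = p then a else if s = q then b else 0) = a + b := by
  have : ∀ s, (if s = p then a else if s = q then b else 0) =
      (if s = p then a else 0) + (if s = q then b else 0) := fun s => by
    by_cases h : s = p
    · subst h; simp [hpq]
    · simp [h]
  simp [this, Finset.sum_add_distrib]

/-- The determinant `det Z^{(p)}` as a real function of the coordinates. -/
def detFun (n d : ℕ) (p : Fin (n + 1)) (x : CoordIndex n d → ℝ) : ℝ := (simplexMatrix x p).det.re

/-- A boundary point at which a single `Z^{(p)}` is singular, with one dimensional kernel spanned by
`v`, is a regular point for `det Z^{(p)}`. -/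
lemma mem_regularBoundary {x : CoordIndex n d → ℝ} {p q : Fin (n + 1)} (hpq : p ≠ q)
    {v : Fin d → ℂ} (hv : star v ⬝ᵥ v = 1) (hpv : (simplexMatrix x p).mulVec v = 0)
    (hp : (simplexMatrix x p + rankOne v).PosDef)
    (hother : ∀ r, r ≠ p → (simplexMatrix x r).PosDef) :
    x ∈ regularBoundary (interior (matrixSimplex n d)) (detFun n d p) := by
  have hv0 : v ≠ 0 := by rintro rfl; simp at hv
  have h0 : detFun n d p x = 0 := by
    rw [detFun, Matrix.exists_mulVec_eq_zero_iff.1 ⟨v, hv0, hpv⟩, Complex.zero_re]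
  refine ⟨h0, fun hder => ?_, ?_⟩
  · obtain ⟨y, hy⟩ := exists_simplexDir_eq (n := n)
      (W := fun s => if s = p then rankOne v else if s = q then -rankOne v else 0)
      (fun s => by
        split_ifs
        exacts [(rankOne_posSemidef v).1, (rankOne_posSemidef v).1.neg, Matrix.isHermitian_zero])
      (by rw [sum_ite_ite hpq, add_neg_cancel])
    have hline : ∀ t : ℝ, detFun n d p (x + t • y) = t * (simplexMatrix x p + rankOne v).det.re := by
      intro t
      rw [detFun, simplexMatrix_add, simplexDir_smul, hy, if_pos rfl, ← Complex.re_ofReal_mul,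
        ← det_add_smul_rankOne hv hpv]
      rfl
    have hd1 : HasDerivAt (fun t : ℝ => detFun n d p (x + t • y)) 0 0 := by
      have hf : HasFDerivAt (detFun n d p) (fderiv ℝ (detFun n d p) x) (x + (0 : ℝ) • y) := by
        rw [zero_smul, add_zero]
        exact ((contDiff_det_re p (m := 1)).differentiable one_ne_zero x).hasFDerivAt
      have hl : HasDerivAt (fun t : ℝ => x + t • y) y 0 := by
        simpa using ((hasDerivAt_id (0 : ℝ)).smul_const y).const_add x
      have := hf.comp_hasDerivAt (0 : ℝ) hl
      rwa [hder] at this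
    have hd2 : HasDerivAt (fun t : ℝ => detFun n d p (x + t • y))
        ((simplexMatrix x p + rankOne v).det.re) 0 := by
      simp only [hline]
      simpa using (hasDerivAt_id (0 : ℝ)).mul_const (simplexMatrix x p + rankOne v).det.re
    exact (Complex.pos_iff.1 hp.det_pos).1.ne (hd1.unique hd2)
  · have e1 : ∀ᶠ y in 𝓝 x, (simplexMatrix y p + rankOne v).PosDef :=
      eventually_posDef ((simplexMatrix_continuous p).add continuous_const)
        (fun y => (simplexMatrix_isHermitian y p).add (rankOne_posSemidef v).1) hp
    have e2 : ∀ᶠ y in 𝓝 x, ∀ r, r ≠ p → (simplexMatrix y r).PosDef := by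
      rw [Filter.eventually_all]
      intro r
      by_cases hr : r = p
      · exact Filter.Eventually.of_forall fun y h => absurd hr h
      · exact (eventually_posDef (simplexMatrix_continuous r)
          (fun y => simplexMatrix_isHermitian y r) (hother r hr)).mono fun y h _ => h
    filter_upwards [e1, e2] with y h1 h2
    refine ⟨fun h => det_re_pos h p, fun h => mem_interior_matrixSimplex_iff.2 fun r => ?_⟩
    by_cases hr : r = p
    · subst hr
      have := posDef_sub_rankOne h1 (v := v)
      rw [add_sub_cancel_right] at this
      exact this h
    · exact h2 r hr

lemma regularBoundary_subset_frontier {ι : Type*} [Fintype ι] [DecidableEq ι] {Ω : Set (ι → ℝ)}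
    (hΩ : IsOpen Ω) {φ : (ι → ℝ) → ℝ} (hφ : ContDiff ℝ 1 φ) :
    regularBoundary Ω φ ⊆ frontier Ω := by
  rintro x ⟨h0, hder, hev⟩
  rw [hΩ.frontier_eq]
  refine ⟨?_, fun hx => ?_⟩
  · obtain ⟨y, hy⟩ : ∃ y, fderiv ℝ φ x y ≠ 0 := by
      by_contra! h
      exact hder (by ext y; simp [h y])
    obtain ⟨z, hz⟩ : ∃ z, 0 < fderiv ℝ φ x z := by
      rcases lt_or_gt_of_ne hy with h | h
      · exact ⟨-y, by simpa using h⟩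
      · exact ⟨y, h⟩
    have hl : HasDerivAt (fun t : ℝ => x + t • z) z 0 := by
      simpa using ((hasDerivAt_id (0 : ℝ)).smul_const z).const_add x
    have hf : HasFDerivAt φ (fderiv ℝ φ x) (x + (0 : ℝ) • z) := by
      rw [zero_smul, add_zero]
      exact (hφ.differentiable one_ne_zero x).hasFDerivAt
    have hd := hf.comp_hasDerivAt (0 : ℝ) hl
    have hpos : ∀ᶠ t in 𝓝[>] (0 : ℝ), 0 < φ (x + t • z) := by
      have := (hasDerivAt_iff_tendsto_slope.1 hd).eventually (lt_mem_nhds hz)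
      have h2 := this.filter_mono (nhdsWithin_mono (0 : ℝ) (fun t (ht : 0 < t) => ht.ne'))
      filter_upwards [h2, self_mem_nhdsWithin] with t ht ht0
      have ht0 : (0 : ℝ) < t := ht0
      simp only [slope_def_field, Function.comp_apply, zero_smul, add_zero, h0, sub_zero] at ht
      exact (div_pos_iff_of_pos_right ht0).1 ht
    have htend : Filter.Tendsto (fun t : ℝ => x + t • z) (𝓝[>] 0) (𝓝 x) := by
      have : Filter.Tendsto (fun t : ℝ => x + t • z) (𝓝 0) (𝓝 (x + (0 : ℝ) • z)) :=
        (by fun_prop : Continuous fun t : ℝ => x + t • z).tendsto 0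
      rw [zero_smul, add_zero] at this
      exact this.mono_left nhdsWithin_le_nhds
    refine mem_closure_of_tendsto htend ?_
    filter_upwards [hpos, htend.eventually hev] with t h1 h2
    exact h2.2 h1
  · have := hev.self_of_nhds.1 hx
    exact this.ne' h0

lemma mem_frontier_iff {x : CoordIndex n d → ℝ} :
    x ∈ frontier (interior (matrixSimplex n d)) ↔
      x ∈ matrixSimplex n d ∧ ∃ p, ¬ (simplexMatrix x p).PosDef := by
  rw [isOpen_interior.frontier_eq,
    (convex_matrixSimplex n d).closure_interior_eq_closure_of_nonempty_interior
      (interior_matrixSimplex_nonempty n d), (isClosed_matrixSimplex n d).closure_eq,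
    Set.mem_sdiff, mem_interior_matrixSimplex_iff, not_forall]

/-- A singular `Z^{(p)}` forces the existence of a second index. -/
lemma exists_ne_of_not_posDef {x : CoordIndex n d → ℝ} {p : Fin (n + 1)}
    (h : ¬ (simplexMatrix x p).PosDef) : ∃ q, p ≠ q := by
  by_contra! hcon
  refine h ?_
  have h1 := sum_simplexMatrix x
  rw [Fintype.sum_eq_single p fun q hq => absurd (hcon q).symm hq] at h1
  rw [h1]
  exact Matrix.PosDef.one

/-- Adding `v v^*` makes a matrix with kernel spanned by `v` positive definite. -/
lemma posDef_add_rankOne_of_kernel {M : Matrix (Fin d) (Fin d) ℂ} (hM : M.PosSemidef)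
    {v : Fin d → ℂ} (h : ∀ w, M.mulVec w = 0 → star v ⬝ᵥ w = 0 → w = 0) :
    (M + rankOne v).PosDef := by
  have hps := hM.add (rankOne_posSemidef v)
  refine (posDef_iff_quadForm hps.1).2 fun w hw => ?_
  have h1 := (posSemidef_iff_quadForm hM.1).1 hM w
  rw [quadForm_add, quadForm_rankOne]
  rcases h1.lt_or_eq with h2 | h2
  · positivity
  · have h3 : star w ⬝ᵥ M.mulVec w = 0 :=
      Complex.ext h2.symm (hM.1.im_star_dotProduct_mulVec_self w)
    have h4 := (hM.dotProduct_mulVec_zero_iff w).1 h3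
    have h5 : 0 < ‖star v ⬝ᵥ w‖ := norm_pos_iff.2 fun h0 => hw (h w h4 h0)
    rw [← h2, zero_add]
    positivity

/-- Regular points are dense in the boundary. -/
lemma frontier_subset_closure_regular :
    frontier (interior (matrixSimplex n d)) ⊆
      closure (⋃ p, regularBoundary (interior (matrixSimplex n d)) (detFun n d p)) := by
  intro x hx
  obtain ⟨hxΔ, p, hp⟩ := mem_frontier_iff.1 hx
  have hxΔ := mem_matrixSimplex_iff.1 hxΔ
  obtain ⟨q, hpq⟩ := exists_ne_of_not_posDef hp
  obtain ⟨v, hv, hpv⟩ := exists_mulVec_eq_zero_of_not_posDef (hxΔ p) hp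
  set c : ℝ := (n + 1 : ℝ)⁻¹ with hc
  have hc0 : 0 < c := by positivity
  have hc1 : c ≤ 1 := inv_le_one_of_one_le₀ (by linarith [n.cast_nonneg (α := ℝ)])
  -- only the matrix of index `p` is singular at `y`, and its kernel is spanned by `v`
  obtain ⟨y, hy⟩ := exists_simplexMatrix_eq (n := n)
    (W := fun s => c • (1 : Matrix (Fin d) (Fin d) ℂ) +
      if s = p then -(c • rankOne v) else if s = q then c • rankOne v else 0)
    (fun s => by
      have h1 : (c • rankOne v).IsHermitian := (rankOne_posSemidef v).1.smul (IsSelfAdjoint.all c)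
      refine (Matrix.isHermitian_one.smul (IsSelfAdjoint.all c)).add ?_
      split_ifs
      exacts [h1.neg, h1, Matrix.isHermitian_zero])
    (by
      rw [Finset.sum_add_distrib, sum_ite_ite hpq, neg_add_cancel, add_zero, Finset.sum_const,
        Finset.card_univ, Fintype.card_fin, ← Nat.cast_smul_eq_nsmul ℝ, smul_smul, Nat.cast_succ,
        hc, mul_inv_cancel₀ (by positivity), one_smul])
  have htend : Filter.Tendsto (fun t : ℝ => (1 - t) • x + t • y) (𝓝[>] 0) (𝓝 x) := by
    have : Filter.Tendsto (fun t : ℝ => (1 - t) • x + t • y) (𝓝 0)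
        (𝓝 ((1 - (0 : ℝ)) • x + (0 : ℝ) • y)) :=
      (by fun_prop : Continuous fun t : ℝ => (1 - t) • x + t • y).tendsto 0
    rw [zero_smul, add_zero, sub_zero, one_smul] at this
    exact this.mono_left nhdsWithin_le_nhds
  refine mem_closure_of_tendsto htend ?_
  have hsmall : ∀ᶠ t in 𝓝[>] (0 : ℝ), t < 1 := nhdsWithin_le_nhds (gt_mem_nhds one_pos)
  filter_upwards [self_mem_nhdsWithin, hsmall] with t ht0 ht1
  have ht0 : (0 : ℝ) < t := ht0
  have hone : ∀ w : Fin d → ℂ, w ≠ 0 → 0 < quadForm 1 w := fun w hw =>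
    (posDef_iff_quadForm Matrix.isHermitian_one).1 Matrix.PosDef.one w hw
  refine Set.mem_iUnion.2 ⟨p, mem_regularBoundary hpq hv ?_ ?_ fun r hr => ?_⟩
  · rw [simplexMatrix_affine _ _ _ _ (by ring), hy, if_pos rfl, Matrix.add_mulVec,
      Matrix.smul_mulVec, Matrix.smul_mulVec, hpv, Matrix.add_mulVec, Matrix.neg_mulVec,
      Matrix.smul_mulVec, Matrix.smul_mulVec, rankOne_mulVec, hv, Matrix.one_mulVec]
    simp
  · refine (posDef_iff_quadForm ((simplexMatrix_isHermitian _ p).add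
      (rankOne_posSemidef v).1)).2 fun w hw => ?_
    have h1 := (posSemidef_iff_quadForm (hxΔ p).1).1 (hxΔ p) w
    have h2 := hone w hw
    rw [simplexMatrix_affine _ _ _ _ (by ring), hy, if_pos rfl, ← sub_eq_add_neg, quadForm_add,
      quadForm_add, quadForm_smul, quadForm_smul, quadForm_sub, quadForm_smul, quadForm_smul,
      quadForm_rankOne]
    have h3 : 0 ≤ ‖star v ⬝ᵥ w‖ ^ 2 := by positivity
    have h4 : t * c ≤ 1 := mul_le_one₀ ht1.le hc0.le hc1
    have h5 : 0 ≤ (1 - t * c) * ‖star v ⬝ᵥ w‖ ^ 2 := mul_nonneg (by linarith) h3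
    have h6 : 0 ≤ (1 - t) * quadForm (simplexMatrix x p) w := mul_nonneg (by linarith) h1
    have h7 : 0 < t * (c * quadForm 1 w) := by positivity
    nlinarith
  · rw [simplexMatrix_affine _ _ _ _ (by ring), hy, if_neg hr]
    refine Matrix.PosDef.posSemidef_add (posSemidef_smul_real (hxΔ r) (by linarith))
      (posDef_smul_real ?_ ht0)
    refine (posDef_smul_real Matrix.PosDef.one hc0).add_posSemidef ?_
    split_ifs
    · exact posSemidef_smul_real (rankOne_posSemidef v) hc0.le
    · exact Matrix.PosSemidef.zero

lemma simplexDir_add (x y : CoordIndex n d → ℝ) (p : Fin (n + 1)) :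
    simplexDir (x + y) p = simplexDir x p + simplexDir y p := by
  refine Fin.lastCases ?_ (fun p => ?_) p
  · simp only [simplexDir_last, hermMatrix_add, Finset.sum_add_distrib, neg_add]
  · simp [hermMatrix_add]

/-- The linear part of the affine functional `x ↦ v^* Z^{(p)} v`. -/
def dirForm (p : Fin (n + 1)) (v : Fin d → ℂ) : (CoordIndex n d → ℝ) →ₗ[ℝ] ℝ where
  toFun y := quadForm (simplexDir y p) v
  map_add' x y := by rw [simplexDir_add, quadForm_add]
  map_smul' c y := by rw [simplexDir_smul, quadForm_smul]; rfl

lemma dirForm_sub (p : Fin (n + 1)) (v : Fin d → ℂ) (x y : CoordIndex n d → ℝ) :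
    dirForm p v (y - x) = quadForm (simplexMatrix y p) v - quadForm (simplexMatrix x p) v := by
  have := simplexMatrix_add x (y - x) p
  rw [add_sub_cancel] at this
  rw [this, quadForm_add]
  simp [dirForm]

lemma quadForm_eq_zero_of_mulVec {M : Matrix (Fin d) (Fin d) ℂ} {v : Fin d → ℂ}
    (h : M.mulVec v = 0) : quadForm M v = 0 := by
  simp [quadForm, h]

/-- A point at which `v^* Z^{(p)} v` vanishes while `w^* Z^{(q)} w` does not. -/
lemma exists_dirForm_separating {x : CoordIndex n d → ℝ} {p q r : Fin (n + 1)} (hpr : p ≠ r)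
    {v w : Fin d → ℂ} (hv : star v ⬝ᵥ v = 1) (hw : star w ⬝ᵥ w = 1)
    (hpv : (simplexMatrix x p).mulVec v = 0) (hqw : (simplexMatrix x q).mulVec w = 0)
    (h : (q = p ∧ star v ⬝ᵥ w = 0) ∨ q = r) :
    ∃ y, dirForm p v y = 0 ∧ dirForm q w y ≠ 0 := by
  have hH : ((2 : ℝ)⁻¹ • (1 - rankOne v)).IsHermitian :=
    (Matrix.isHermitian_one.sub (rankOne_posSemidef v).1).smul (IsSelfAdjoint.all _)
  obtain ⟨y, hy⟩ := exists_simplexMatrix_eq (n := n)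
    (W := fun s => if s = p then (2 : ℝ)⁻¹ • (1 - rankOne v) else
      if s = r then 1 - (2 : ℝ)⁻¹ • (1 - rankOne v) else 0)
    (fun s => by
      split_ifs
      exacts [hH, Matrix.isHermitian_one.sub hH, Matrix.isHermitian_zero])
    (by rw [sum_ite_ite hpr, add_sub_cancel])
  have hnn : 0 ≤ ‖star v ⬝ᵥ w‖ ^ 2 := by positivity
  refine ⟨y - x, ?_, ?_⟩
  · rw [dirForm_sub, quadForm_eq_zero_of_mulVec hpv, hy, if_pos rfl, quadForm_smul, quadForm_sub,
      quadForm_one, quadForm_rankOne, hv]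
    simp
  · rw [dirForm_sub, quadForm_eq_zero_of_mulVec hqw, hy]
    rcases h with ⟨rfl, hvw⟩ | rfl
    · rw [if_pos rfl, quadForm_smul, quadForm_sub, quadForm_one, quadForm_rankOne, hw, hvw]
      simp
    · rw [if_neg hpr.symm, if_pos rfl, quadForm_sub, quadForm_smul, quadForm_sub, quadForm_one,
        quadForm_rankOne, hw]
      simp only [Complex.one_re, sub_zero]
      nlinarith

/-- At a boundary point which is not regular, either two of the matrices are singular or one has a
kernel of dimension at least two. In both cases there are two functionals `x ↦ v^* Z^{(p)} v` with
independent linear parts which vanish at the point and are nonnegative on the simplex. -/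
lemma hausdorffMeasure_singular_boundary (n d : ℕ) :
    Measure.hausdorffMeasure ((Fintype.card (CoordIndex n d) : ℝ) - 1)
      (frontier (interior (matrixSimplex n d)) \
        ⋃ p, regularBoundary (interior (matrixSimplex n d)) (detFun n d p)) = 0 := by
  refine hausdorffMeasure_eq_zero_of_two_supports (K := matrixSimplex n d) ?_
  rintro x ⟨hx, hreg⟩
  obtain ⟨hxΔ, p, hp⟩ := mem_frontier_iff.1 hx
  refine ⟨hxΔ, ?_⟩
  have hxΔ := mem_matrixSimplex_iff.1 hxΔ
  have hsupp : ∀ q (w : Fin d → ℂ), (simplexMatrix x q).mulVec w = 0 →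
      ∀ y ∈ matrixSimplex n d, 0 ≤ dirForm q w (y - x) := fun q w hw y hy => by
    rw [dirForm_sub, quadForm_eq_zero_of_mulVec hw, sub_zero]
    have := mem_matrixSimplex_iff.1 hy q
    exact (posSemidef_iff_quadForm this.1).1 this w
  obtain ⟨v, hv, hpv⟩ := exists_mulVec_eq_zero_of_not_posDef (hxΔ p) hp
  obtain ⟨r, hpr⟩ := exists_ne_of_not_posDef hp
  by_cases hother : ∀ q, q ≠ p → (simplexMatrix x q).PosDef
  · -- the kernel of `Z^{(p)}` has dimension at least two
    obtain ⟨w, hw0, hw1, hw2⟩ : ∃ w, (simplexMatrix x p).mulVec w = 0 ∧ star v ⬝ᵥ w = 0 ∧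
        w ≠ 0 := by
      by_contra! hcon
      refine hreg (Set.mem_iUnion.2 ⟨p, mem_regularBoundary hpr hv hpv ?_ hother⟩)
      exact posDef_add_rankOne_of_kernel (hxΔ p) hcon
    obtain ⟨w, hw, hw0, hw1⟩ : ∃ w, star w ⬝ᵥ w = 1 ∧ (simplexMatrix x p).mulVec w = 0 ∧
        star v ⬝ᵥ w = 0 := by
      obtain ⟨c, hc⟩ := exists_smul_unit hw2
      exact ⟨c • w, hc, by rw [Matrix.mulVec_smul, hw0, smul_zero],
        by rw [dotProduct_smul, hw1, smul_zero]⟩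
    refine ⟨dirForm p v, dirForm p w, hsupp p v hpv, hsupp p w hw0,
      exists_dirForm_separating hpr hv hw hpv hw0 (Or.inl ⟨rfl, hw1⟩), ?_⟩
    obtain ⟨y, h1, h2⟩ := exists_dirForm_separating hpr hw hv hw0 hpv (Or.inl ⟨rfl, by
      rw [Matrix.star_dotProduct, hw1, star_zero]⟩)
    exact ⟨y, h2, h1⟩
  · -- a second matrix is singular
    push Not at hother
    obtain ⟨q, hqp, hq⟩ := hother
    obtain ⟨w, hw, hqw⟩ := exists_mulVec_eq_zero_of_not_posDef (hxΔ q) hq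
    refine ⟨dirForm p v, dirForm q w, hsupp p v hpv, hsupp q w hqw,
      exists_dirForm_separating hqp.symm hv hw hpv hqw (Or.inr rfl), ?_⟩
    obtain ⟨y, h1, h2⟩ := exists_dirForm_separating hqp hw hv hqw hpv (Or.inr rfl)
    exact ⟨y, h2, h1⟩

lemma hasPiecewiseC1Boundary_interior_matrixSimplex (n d : ℕ) :
    HasPiecewiseC1Boundary (interior (matrixSimplex n d)) := by
  refine ⟨n + 1, detFun n d, fun p => contDiff_det_re p, ?_,
    hausdorffMeasure_singular_boundary n d⟩
  refine Set.Subset.antisymm frontier_subset_closure_regular ?_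
  refine closure_minimal (Set.iUnion_subset fun p => ?_) isClosed_frontier
  exact regularBoundary_subset_frontier isOpen_interior (contDiff_det_re p)

end Boundary

/-! ### Ellipticity -/

section Ellipticity

open scoped Matrix MatrixOrder

variable {n d : ℕ} {A : Matrix (Fin (n + 1)) (Fin (n + 1)) ℝ}

/-- Contraction of the co-metric with a tuple of matrices `H`, as a sum of squares weighted by the
entries of `A`. -/
lemma sum_mul_fullEntry_eq_trace (hA : A.IsSymm) (Z H : Fin (n + 1) → Matrix (Fin d) (Fin d) ℂ) :
    ∑ p, ∑ q, ∑ i, ∑ j, ∑ k, ∑ l, H p j i * H q l k * fullEntry A Z p i j q k l =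
      ∑ p, ∑ q, (A p q : ℂ) * (Z q * (H p - H q) * Z p * (H p - H q)).trace := by
  have tr : ∀ K L M N : Matrix (Fin d) (Fin d) ℂ,
      (K * L * M * N).trace = ∑ i, ∑ j, ∑ k, ∑ l, K i l * L l k * M k j * N j i := by
    intro K L M N
    simp only [Matrix.trace, Matrix.diag_apply, Matrix.mul_apply, Finset.sum_mul]
  have cyc : ∀ K L M N : Matrix (Fin d) (Fin d) ℂ,
      (K * L * M * N).trace = (M * N * K * L).trace := by
    intro K L M N
    rw [Matrix.mul_assoc (K * L), Matrix.trace_mul_comm, ← Matrix.mul_assoc]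
  have h1 : ∀ p q, ∑ i, ∑ j, ∑ k, ∑ l, H p j i * H q l k * fullEntry A Z p i j q k l =
      (kron p q : ℂ) * ∑ s, (A s p : ℂ) *
        ((Z s * H q * Z p * H p).trace + (Z p * H q * Z s * H p).trace) -
      (A p q : ℂ) * ((Z q * H q * Z p * H p).trace + (Z p * H q * Z q * H p).trace) := by
    intro p q
    simp only [tr, Finset.mul_sum, ← Finset.sum_add_distrib]
    simp only [Finset.sum_comm (s := (Finset.univ : Finset (Fin (n + 1))))]
    simp only [← Finset.sum_sub_distrib]
    refine Finset.sum_congr rfl fun i _ => Finset.sum_congr rfl fun j _ =>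
      Finset.sum_congr rfl fun k _ => Finset.sum_congr rfl fun l _ => ?_
    rw [fullEntry, mul_sub, Finset.mul_sum, Finset.mul_sum]
    congr 1
    · exact Finset.sum_congr rfl fun s _ => by ring
    · ring
  have h2 : ∀ p q, (A p q : ℂ) * (Z q * (H p - H q) * Z p * (H p - H q)).trace =
      (A p q : ℂ) * (Z q * H p * Z p * H p).trace + (A p q : ℂ) * (Z p * H q * Z q * H q).trace -
      (A p q : ℂ) * ((Z q * H q * Z p * H p).trace + (Z p * H q * Z q * H p).trace) := by
    intro p q
    rw [cyc (Z p) (H q) (Z q) (H q), cyc (Z p) (H q) (Z q) (H p)]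
    simp only [Matrix.mul_sub, Matrix.sub_mul, Matrix.trace_sub]
    ring
  simp only [h1, h2, Finset.sum_sub_distrib, Finset.sum_add_distrib]
  congr 1
  have h3 : ∀ p, ∑ q, (kron p q : ℂ) * ∑ s, (A s p : ℂ) *
        ((Z s * H q * Z p * H p).trace + (Z p * H q * Z s * H p).trace) =
      ∑ s, (A s p : ℂ) * ((Z s * H p * Z p * H p).trace + (Z p * H p * Z s * H p).trace) := by
    intro p
    have : ∀ q, kron p q = kron q p := fun q => by simp only [kron, eq_comm]
    simp only [this]
    exact sum_kron_mul p _
  simp only [h3]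
  simp only [mul_add, Finset.sum_add_distrib]
  congr 1
  · exact Finset.sum_congr rfl fun p _ => Finset.sum_congr rfl fun s _ => by rw [hA.apply]
  · rw [Finset.sum_comm]
    exact Finset.sum_congr rfl fun p _ => Finset.sum_congr rfl fun s _ => by rw [cyc]

/-- The Hermitian matrices representing the linear form with coefficients `ξ`, completed by `0` at
the last index: `∑ u, ξ u * x u = ∑ p, trace (Z^{(p)} * formMatrix ξ p)`. -/
def formMatrix (ξ : CoordIndex n d → ℝ) : Fin (n + 1) → Matrix (Fin d) (Fin d) ℂ :=
  Fin.snoc (fun p => Matrix.of fun j i => ∑ a, ∑ b, (ξ (p, a, b) : ℂ) * coordCoeff a b i j) 0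

lemma formMatrix_castSucc (ξ : CoordIndex n d → ℝ) (p : Fin n) (j i : Fin d) :
    formMatrix ξ p.castSucc j i = ∑ a, ∑ b, (ξ (p, a, b) : ℂ) * coordCoeff a b i j := by
  simp [formMatrix]

lemma formMatrix_last (ξ : CoordIndex n d → ℝ) : formMatrix ξ (Fin.last n) = 0 := by
  simp [formMatrix]

lemma coordCoeff_conj (a b i j : Fin d) : starRingEnd ℂ (coordCoeff a b i j) = coordCoeff a b j i := by
  unfold coordCoeff
  rw [← coordOfEntries_conj]
  congr 1
  funext k l
  simp only [and_comm]
  split_ifs <;> simp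

lemma formMatrix_isHermitian (ξ : CoordIndex n d → ℝ) (p : Fin (n + 1)) :
    (formMatrix ξ p).IsHermitian := by
  refine Fin.lastCases ?_ (fun p => ?_) p
  · rw [formMatrix_last]; exact Matrix.isHermitian_zero
  · ext i j
    rw [Matrix.conjTranspose_apply, formMatrix_castSucc, formMatrix_castSucc, Complex.star_def]
    simp only [map_sum, map_mul, Complex.conj_ofReal, coordCoeff_conj]

lemma sum_comm_pairs {α β M : Type*} [Fintype α] [Fintype β] [AddCommMonoid M]
    (f : α → α → β → β → M) :
    ∑ i, ∑ j, ∑ a, ∑ b, f i j a b = ∑ a, ∑ b, ∑ i, ∑ j, f i j a b := by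
  have h := Finset.sum_comm (s := (Finset.univ : Finset (α × α)))
    (t := (Finset.univ : Finset (β × β))) (f := fun x y => f x.1 x.2 y.1 y.2)
  simpa only [Fintype.sum_prod_type] using h

lemma sum_mul_formMatrix (ξ : CoordIndex n d → ℝ) (p : Fin n) (W : Fin d → Fin d → ℂ) :
    ∑ i, ∑ j, formMatrix ξ p.castSucc j i * W i j =
      ∑ a, ∑ b, (ξ (p, a, b) : ℂ) * coordOfEntries a b W := by
  simp only [formMatrix_castSucc, coordOfEntries_eq_sum, Finset.mul_sum, Finset.sum_mul]
  rw [sum_comm_pairs]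
  simp only [mul_assoc]

lemma eq_zero_of_formMatrix_eq_zero {ξ : CoordIndex n d → ℝ} (h : ∀ p, formMatrix ξ p = 0) :
    ξ = 0 := by
  have key : ∀ p : Fin n, ∑ a, ∑ b, ξ (p, a, b) ^ 2 = 0 := fun p => by
    have h1 := sum_mul_formMatrix ξ p (hermMatrix ξ p)
    have h2 : ∀ a b, coordOfEntries a b (hermMatrix ξ p) = (ξ (p, a, b) : ℂ) := fun a b => by
      have h3 := coordOfEntries_re_of_hermitian a b (W := fun i j => hermMatrix ξ p i j)
        fun i j => by simpa using (hermMatrix_isHermitian ξ p).apply i j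
      exact h3.symm.trans (congrArg _ (congrFun (coordVec_hermMatrix ξ) (p, a, b)))
    simp only [h, h2, Matrix.zero_apply, zero_mul, Finset.sum_const_zero] at h1
    have h3 : ((∑ a, ∑ b, ξ (p, a, b) ^ 2 : ℝ) : ℂ) = 0 := by
      push_cast
      rw [h1]
      simp only [sq]
    exact_mod_cast h3
  funext ⟨p, a, b⟩
  have h1 := (Finset.sum_eq_zero_iff_of_nonneg fun a _ =>
    Finset.sum_nonneg fun b _ => sq_nonneg (ξ (p, a, b))).1 (key p) a (Finset.mem_univ a)
  have h2 := (Finset.sum_eq_zero_iff_of_nonneg fun b _ => sq_nonneg (ξ (p, a, b))).1 h1 b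
    (Finset.mem_univ b)
  simpa using h2

/-- The quadratic form of the co-metric on cotangent vectors. -/
lemma sum_coMetric_eq_trace (hA : A.IsSymm) (x ξ : CoordIndex n d → ℝ) :
    ((∑ u, ∑ v, coMetric A u v x * ξ u * ξ v : ℝ) : ℂ) =
      ∑ p, ∑ q, (A p q : ℂ) * (simplexMatrix x q * (formMatrix ξ p - formMatrix ξ q) *
        simplexMatrix x p * (formMatrix ξ p - formMatrix ξ q)).trace := by
  rw [← sum_mul_fullEntry_eq_trace hA]
  have hq : ∀ p i j, ∑ q, ∑ k, ∑ l, formMatrix ξ q l k * fullEntry A (simplexMatrix x) p i j q k l =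
      ∑ v : CoordIndex n d, (ξ v : ℂ) * coordOfEntries v.2.1 v.2.2 fun k l =>
        fullEntry A (simplexMatrix x) p i j v.1.castSucc k l := by
    intro p i j
    rw [Fin.sum_univ_castSucc]
    simp only [formMatrix_last, Matrix.zero_apply, zero_mul, Finset.sum_const_zero, add_zero,
      Fintype.sum_prod_type]
    exact Finset.sum_congr rfl fun q _ => sum_mul_formMatrix ξ q _
  have h1 : ∀ p, ∑ q, ∑ i, ∑ j, ∑ k, ∑ l, formMatrix ξ p j i * formMatrix ξ q l k *
      fullEntry A (simplexMatrix x) p i j q k l =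
      ∑ i, ∑ j, formMatrix ξ p j i * ∑ v : CoordIndex n d, (ξ v : ℂ) *
        coordOfEntries v.2.1 v.2.2 fun k l =>
          fullEntry A (simplexMatrix x) p i j v.1.castSucc k l := by
    intro p
    rw [Finset.sum_comm]
    refine Finset.sum_congr rfl fun i _ => ?_
    rw [Finset.sum_comm]
    refine Finset.sum_congr rfl fun j _ => ?_
    rw [← hq]
    simp only [Finset.mul_sum, mul_assoc]
  simp only [h1]
  rw [Fin.sum_univ_castSucc]
  simp only [formMatrix_last, Matrix.zero_apply, zero_mul, Finset.sum_const_zero, add_zero]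
  have h2 : ∀ p : Fin n, ∑ i, ∑ j, formMatrix ξ p.castSucc j i * ∑ v : CoordIndex n d, (ξ v : ℂ) *
        coordOfEntries v.2.1 v.2.2 (fun k l =>
          fullEntry A (simplexMatrix x) p.castSucc i j v.1.castSucc k l) =
      ∑ a, ∑ b, (ξ (p, a, b) : ℂ) * ∑ v : CoordIndex n d, (ξ v : ℂ) *
        (coMetric A (p, a, b) v x : ℂ) := by
    intro p
    rw [sum_mul_formMatrix ξ p fun i j => ∑ v : CoordIndex n d, (ξ v : ℂ) *
        coordOfEntries v.2.1 v.2.2 (fun k l =>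
          fullEntry A (simplexMatrix x) p.castSucc i j v.1.castSucc k l)]
    refine Finset.sum_congr rfl fun a _ => Finset.sum_congr rfl fun b _ => ?_
    congr 1
    rw [coordOfEntries_sum]
    refine Finset.sum_congr rfl fun v _ => ?_
    rw [coordOfEntries_mul, coMetric_eq]
  simp only [h2]
  push_cast
  rw [Fintype.sum_prod_type]
  simp only [Fintype.sum_prod_type (f := fun v : Fin d × Fin d => _), Finset.mul_sum]
  refine Finset.sum_congr rfl fun p _ => ?_
  refine Finset.sum_congr rfl fun a _ => Finset.sum_congr rfl fun b _ => ?_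
  refine Finset.sum_congr rfl fun v _ => ?_
  ring

lemma exists_eq_conjTranspose_mul_self {M : Matrix (Fin d) (Fin d) ℂ} (hM : M.PosDef) :
    ∃ B : Matrix (Fin d) (Fin d) ℂ, IsUnit B ∧ M = Bᴴ * B := by
  obtain ⟨B, hB⟩ := CStarAlgebra.nonneg_iff_eq_star_mul_self.mp hM.posSemidef.nonneg
  refine ⟨B, ?_, hB⟩
  have := hM.isUnit
  rw [hB, Matrix.isUnit_iff_isUnit_det, Matrix.det_mul] at this
  exact (Matrix.isUnit_iff_isUnit_det B).2 (isUnit_of_mul_isUnit_right this)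

/-- With `N = Bᴴ B` and `M = Cᴴ C` this is the square of the Frobenius norm of `C K Bᴴ`. -/
lemma trace_mul_nonneg {M N K : Matrix (Fin d) (Fin d) ℂ} (hM : M.PosDef) (hN : N.PosDef)
    (hK : K.IsHermitian) :
    0 ≤ (N * K * M * K).trace ∧ ((N * K * M * K).trace = 0 → K = 0) := by
  obtain ⟨B, hB, rfl⟩ := exists_eq_conjTranspose_mul_self hN
  obtain ⟨C, hC, rfl⟩ := exists_eq_conjTranspose_mul_self hM
  have e : (Bᴴ * B * K * (Cᴴ * C) * K).trace = ((C * K * Bᴴ)ᴴ * (C * K * Bᴴ)).trace := by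
    rw [Matrix.conjTranspose_mul, Matrix.conjTranspose_mul, Matrix.conjTranspose_conjTranspose,
      hK.eq]
    simp only [Matrix.mul_assoc]
    rw [Matrix.trace_mul_comm]
    simp only [Matrix.mul_assoc]
  rw [e]
  refine ⟨(Matrix.posSemidef_conjTranspose_mul_self _).trace_nonneg, fun h => ?_⟩
  rw [Matrix.trace_conjTranspose_mul_self_eq_zero_iff] at h
  have hB' : IsUnit Bᴴ := by
    rw [Matrix.isUnit_iff_isUnit_det, Matrix.det_conjTranspose]
    exact ((Matrix.isUnit_iff_isUnit_det B).1 hB).star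
  have h1 : C * K = 0 := (hB'.mul_left_eq_zero).1 h
  exact (hC.mul_right_eq_zero).1 h1

lemma isEllipticOn_of_irreducible (hA : A.IsSymm) (hpos : ∀ p q, p ≠ q → 0 ≤ A p q)
    (hirr : IsIrreducibleMatrix A) :
    IsEllipticOn (interior (matrixSimplex n d)) (coMetric A) := by
  intro x hx
  have hx := mem_interior_matrixSimplex_iff.1 hx
  refine Matrix.PosDef.of_dotProduct_mulVec_pos ?_ fun ξ hξ => ?_
  · ext u v
    simp [coMetric_comm hA u v]
  have hK : ∀ p q, (formMatrix ξ p - formMatrix ξ q).IsHermitian := fun p q =>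
    (formMatrix_isHermitian ξ p).sub (formMatrix_isHermitian ξ q)
  let T : Fin (n + 1) → Fin (n + 1) → ℂ := fun p q => (simplexMatrix x q *
    (formMatrix ξ p - formMatrix ξ q) * simplexMatrix x p * (formMatrix ξ p - formMatrix ξ q)).trace
  have hT : ∀ p q, 0 ≤ T p q ∧ (T p q = 0 → formMatrix ξ p = formMatrix ξ q) := fun p q =>
    ⟨(trace_mul_nonneg (hx p) (hx q) (hK p q)).1, fun h =>
      sub_eq_zero.1 ((trace_mul_nonneg (hx p) (hx q) (hK p q)).2 h)⟩
  have hTpp : ∀ p, T p p = 0 := fun p => by simp [T]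
  have hterm : ∀ p q, 0 ≤ A p q * (T p q).re := fun p q => by
    by_cases h : p = q
    · subst h; simp [hTpp]
    · exact mul_nonneg (hpos p q h) (Complex.nonneg_iff.1 (hT p q).1).1
  have hsum : ∑ u, ∑ v, coMetric A u v x * ξ u * ξ v = ∑ p, ∑ q, A p q * (T p q).re := by
    have := congrArg Complex.re (sum_coMetric_eq_trace hA x ξ)
    rw [Complex.ofReal_re] at this
    rw [this]
    simp [T, Complex.re_sum]
  have e : star ξ ⬝ᵥ (Matrix.of fun i j => coMetric A i j x) *ᵥ ξ =
      ∑ u, ∑ v, coMetric A u v x * ξ u * ξ v := by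
    simp only [dotProduct, Matrix.mulVec, Finset.mul_sum, Pi.star_apply, star_trivial,
      Matrix.of_apply]
    exact Finset.sum_congr rfl fun u _ => Finset.sum_congr rfl fun v _ => by ring
  rw [e, hsum]
  refine lt_of_le_of_ne (Finset.sum_nonneg fun p _ => Finset.sum_nonneg fun q _ => hterm p q) ?_
  intro h0
  refine hξ (eq_zero_of_formMatrix_eq_zero fun p => ?_)
  have hz : ∀ p q, A p q * (T p q).re = 0 := fun p q => by
    have h1 := (Finset.sum_eq_zero_iff_of_nonneg fun p _ =>
      Finset.sum_nonneg fun q _ => hterm p q).1 h0.symm p (Finset.mem_univ p)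
    exact (Finset.sum_eq_zero_iff_of_nonneg fun q _ => hterm p q).1 h1 q (Finset.mem_univ q)
  have hstep : ∀ p q, A p q ≠ 0 → formMatrix ξ p = formMatrix ξ q := fun p q h => by
    refine (hT p q).2 (Complex.ext ((mul_eq_zero.1 (hz p q)).resolve_left h) ?_)
    exact (Complex.nonneg_iff.1 (hT p q).1).2.symm
  by_cases hp : p = Fin.last n
  · rw [hp, formMatrix_last]
  · rw [← formMatrix_last ξ]
    have : ∀ q, Relation.TransGen (fun r s => A r s ≠ 0) p q → formMatrix ξ p = formMatrix ξ q := by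
      intro q hq
      induction hq with
      | single h => exact hstep _ _ h
      | tail _ h ih => exact ih.trans (hstep _ _ h)
    exact this _ (hirr p _ hp)

/-- At the points where all matrices are scalar, ellipticity reduces to the positivity of a graph
Laplacian with weights `A p q * z p * z q`. -/
lemma sum_pos_of_isEllipticOn (hd : 1 ≤ d) (hA : A.IsSymm)
    (hell : IsEllipticOn (interior (matrixSimplex n d)) (coMetric A)) {h z : Fin (n + 1) → ℝ}
    (hz : ∀ p, 0 < z p) (hh : ∃ p, h p ≠ h (Fin.last n)) :
    0 < ∑ p, ∑ q, A p q * ((h p - h q) ^ 2 * (z p * z q)) := by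
  set S := ∑ p, z p with hS
  have hS0 : 0 < S := Finset.sum_pos (fun p _ => hz p) Finset.univ_nonempty
  obtain ⟨x, hx⟩ := exists_simplexMatrix_eq (n := n)
    (W := fun p => (S⁻¹ * z p) • (1 : Matrix (Fin d) (Fin d) ℂ))
    (fun p => Matrix.isHermitian_one.smul (IsSelfAdjoint.all _))
    (by rw [← Finset.sum_smul, ← Finset.mul_sum, inv_mul_cancel₀ hS0.ne', one_smul])
  have hxi : x ∈ interior (matrixSimplex n d) := mem_interior_matrixSimplex_iff.2 fun p => by
    rw [hx]
    exact posDef_smul_real Matrix.PosDef.one (mul_pos (inv_pos.2 hS0) (hz p))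
  let ξ : CoordIndex n d → ℝ := fun u =>
    if u.2.1 = u.2.2 then h u.1.castSucc - h (Fin.last n) else 0
  have hξ : ξ ≠ 0 := by
    obtain ⟨p, hp⟩ := hh
    obtain ⟨p, rfl⟩ := Fin.exists_castSucc_eq.2 (show p ≠ Fin.last n from fun h0 => hp (by rw [h0]))
    intro h0
    have := congrFun h0 (p, ⟨0, hd⟩, ⟨0, hd⟩)
    simp only [ξ, if_true, Pi.zero_apply] at this
    exact hp (sub_eq_zero.1 this)
  have hform : ∀ p, formMatrix ξ p = (h p - h (Fin.last n)) • (1 : Matrix (Fin d) (Fin d) ℂ) := by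
    intro p
    refine Fin.lastCases ?_ (fun p => ?_) p
    · rw [formMatrix_last, sub_self, zero_smul]
    · ext j i
      rw [formMatrix_castSucc]
      have : ∀ a b, (ξ (p, a, b) : ℂ) * coordCoeff a b i j =
          if b = a then ((h p.castSucc - h (Fin.last n) : ℝ) : ℂ) *
            (if a = i ∧ a = j then 1 else 0) else 0 := by
        intro a b
        by_cases hab : a = b
        · subst hab
          simp [ξ, coordCoeff, coordOfEntries]
        · simp [ξ, hab, Ne.symm hab]
      simp only [this, Finset.sum_ite_eq', Finset.mem_univ, if_true, ← Finset.mul_sum, ite_and]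
      simp [Matrix.one_apply, eq_comm]
  have hpos := (hell x hxi).dotProduct_mulVec_pos hξ
  have e : star ξ ⬝ᵥ (Matrix.of fun i j => coMetric A i j x) *ᵥ ξ =
      ∑ u, ∑ v, coMetric A u v x * ξ u * ξ v := by
    simp only [dotProduct, Matrix.mulVec, Finset.mul_sum, Pi.star_apply, star_trivial,
      Matrix.of_apply]
    exact Finset.sum_congr rfl fun u _ => Finset.sum_congr rfl fun v _ => by ring
  rw [e] at hpos
  have hsum := sum_coMetric_eq_trace hA x ξ
  have hval : ((∑ u, ∑ v, coMetric A u v x * ξ u * ξ v : ℝ) : ℂ) =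
      ((d * S⁻¹ ^ 2 * ∑ p, ∑ q, A p q * ((h p - h q) ^ 2 * (z p * z q)) : ℝ) : ℂ) := by
    rw [hsum]
    push_cast
    simp only [Finset.mul_sum]
    refine Finset.sum_congr rfl fun p _ => Finset.sum_congr rfl fun q _ => ?_
    rw [hx, hx, hform, hform, ← sub_smul]
    simp only [Matrix.smul_mul, Matrix.mul_smul, Matrix.mul_one, Matrix.trace_smul,
      Matrix.trace_one, Fintype.card_fin, Complex.real_smul]
    push_cast
    ring
  rw [Complex.ofReal_inj.1 hval] at hpos
  refine pos_of_mul_pos_right hpos (by positivity)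

lemma nonneg_of_isEllipticOn (hd : 1 ≤ d) (hA : A.IsSymm)
    (hell : IsEllipticOn (interior (matrixSimplex n d)) (coMetric A)) {p q : Fin (n + 1)}
    (hpq : p ≠ q) : 0 ≤ A p q := by
  let h : Fin (n + 1) → ℝ := fun r => if r = p then 1 else 0
  have hh : ∃ r, h r ≠ h (Fin.last n) := by
    by_cases hp : p = Fin.last n
    · exact ⟨q, by simp [h, hpq.symm, hp.symm]⟩
    · exact ⟨p, by simp [h, Ne.symm hp]⟩
  -- concentrate the mass of the barycentric coordinates on `p` and `q`
  let z : ℝ → Fin (n + 1) → ℝ := fun ε r => if r = p ∨ r = q then 1 else ε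
  let F : ℝ → ℝ := fun ε => ∑ r, ∑ s, A r s * ((h r - h s) ^ 2 * (z ε r * z ε s))
  have hF : Continuous F := by
    have : ∀ r, Continuous fun ε => z ε r := fun r => by
      by_cases hr : r = p ∨ r = q
      · simp only [z, if_pos hr]; exact continuous_const
      · simp only [z, if_neg hr]; exact continuous_id
    fun_prop
  have hF0 : 0 ≤ F 0 := by
    refine ge_of_tendsto ((hF.tendsto 0).mono_left (nhdsWithin_le_nhds (s := Set.Ioi 0))) ?_
    filter_upwards [self_mem_nhdsWithin] with ε hε
    refine (sum_pos_of_isEllipticOn hd hA hell (fun r => ?_) hh).le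
    simp only [z]
    split_ifs
    exacts [one_pos, hε]
  have hterm : ∀ r s, A r s * ((h r - h s) ^ 2 * (z 0 r * z 0 s)) =
      (if r = p then if s = q then A r s else 0 else 0) +
        (if r = q then if s = p then A r s else 0 else 0) := by
    intro r s
    by_cases h1 : r = p
    · subst h1
      by_cases h2 : s = q
      · subst h2; simp [h, z, hpq, hpq.symm]
      · by_cases h3 : s = r
        · subst h3; simp [h2, hpq]
        · simp [h, z, h2, h3, hpq]
    · by_cases h2 : r = q
      · subst h2
        by_cases h3 : s = p
        · subst h3; simp [h, z, h1]
        · simp [h, z, h1, h3]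
      · simp [z, h1, h2]
  have hval : F 0 = 2 * A p q := by
    simp only [F, hterm, Finset.sum_add_distrib]
    simp
    rw [hA.apply]
    ring
  linarith

lemma irreducible_of_isEllipticOn (hd : 1 ≤ d) (hA : A.IsSymm)
    (hell : IsEllipticOn (interior (matrixSimplex n d)) (coMetric A)) : IsIrreducibleMatrix A := by
  classical
  intro p q hpq
  by_contra hcon
  -- the indicator of the connected component of `p` is annihilated by the co-metric
  let R : Fin (n + 1) → Prop := fun r => r = p ∨ Relation.TransGen (fun r s => A r s ≠ 0) p r
  let h : Fin (n + 1) → ℝ := fun r => if R r then 1 else 0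
  have hRp : R p := Or.inl rfl
  have hRq : ¬ R q := by
    rintro (h1 | h1)
    exacts [hpq h1.symm, hcon h1]
  have hstep : ∀ r s, A r s ≠ 0 → R r → R s := by
    rintro r s hrs (rfl | hr)
    · exact Or.inr (Relation.TransGen.single hrs)
    · exact Or.inr (hr.tail hrs)
  have hh : ∃ r, h r ≠ h (Fin.last n) := by
    by_cases hl : R (Fin.last n)
    · exact ⟨q, by simp [h, hRq, hl]⟩
    · exact ⟨p, by simp [h, hRp, hl]⟩
  refine (sum_pos_of_isEllipticOn hd hA hell (z := fun _ => 1) (fun _ => one_pos) hh).ne' ?_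
  refine Finset.sum_eq_zero fun r _ => Finset.sum_eq_zero fun s _ => ?_
  by_cases hrs : A r s = 0
  · rw [hrs, zero_mul]
  · have : R r ↔ R s := ⟨hstep r s hrs, hstep s r (by rwa [hA.apply])⟩
    simp [h, this]

lemma isEllipticOn_iff (hd : 1 ≤ d) (hA : A.IsSymm) :
    IsEllipticOn (interior (matrixSimplex n d)) (coMetric A) ↔
      (∀ p q, p ≠ q → 0 ≤ A p q) ∧ IsIrreducibleMatrix A :=
  ⟨fun h => ⟨fun _ _ hpq => nonneg_of_isEllipticOn hd hA h hpq,
    irreducible_of_isEllipticOn hd hA h⟩, fun h => isEllipticOn_of_irreducible hA h.1 h.2⟩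

end Ellipticity

/-! ### Polynomial functions -/

section PolynomialFunctions

variable {ι : Type*} [Fintype ι] [DecidableEq ι]

lemma totalDegree_pderiv_le {σ : Type*} {i : σ} {P : MvPolynomial σ ℝ} {m : ℕ}
    (hP : P.totalDegree ≤ m + 1) : (MvPolynomial.pderiv i P).totalDegree ≤ m := by
  classical
  refine Finset.sup_le fun s hs => ?_
  have h1 : MvPolynomial.coeff (s + Finsupp.single i 1) P ≠ 0 := fun h0 => by
    rw [MvPolynomial.mem_support_iff, MvPolynomial.coeff_pderiv, h0] at hs
    simp at hs
  have h2 := (MvPolynomial.le_totalDegree (MvPolynomial.mem_support_iff.2 h1)).trans hP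
  rw [Finsupp.sum_add_index' (by simp) (by simp), Finsupp.sum_single_index rfl] at h2
  omega

lemma pderiv_eq_zero_of_totalDegree {σ : Type*} {i : σ} {P : MvPolynomial σ ℝ}
    (hP : P.totalDegree = 0) : MvPolynomial.pderiv i P = 0 := by
  rw [MvPolynomial.totalDegree_eq_zero_iff_eq_C.1 hP, MvPolynomial.pderiv_C]

lemma contDiff_eval (P : MvPolynomial ι ℝ) {m : WithTop ℕ∞} :
    ContDiff ℝ m fun x : ι → ℝ => MvPolynomial.eval x P := by
  induction P using MvPolynomial.induction_on with
  | C a => simpa using contDiff_const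
  | add P Q hP hQ => simpa using hP.add hQ
  | mul_X P i hP => simpa using hP.mul (contDiff_apply ℝ ℝ i)

lemma partialDeriv_eval (i : ι) (P : MvPolynomial ι ℝ) (x : ι → ℝ) :
    partialDeriv i (fun y : ι → ℝ => MvPolynomial.eval y P) x =
      MvPolynomial.eval x (MvPolynomial.pderiv i P) := by
  have hdiff : ∀ P : MvPolynomial ι ℝ, DifferentiableAt ℝ (fun y : ι → ℝ => MvPolynomial.eval y P) x :=
    fun P => (contDiff_eval P (m := 1)).differentiable one_ne_zero x
  unfold partialDeriv
  induction P using MvPolynomial.induction_on with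
  | C a => simp
  | add P Q hP hQ =>
    simp only [map_add, ← hP, ← hQ]
    rw [fderiv_fun_add (hdiff P) (hdiff Q)]
    rfl
  | mul_X P j hP =>
    have hj : HasFDerivAt (fun y : ι → ℝ => y j) (ContinuousLinearMap.proj (R := ℝ) j) x :=
      hasFDerivAt_apply j x
    simp only [map_mul, MvPolynomial.eval_X]
    rw [fderiv_fun_mul (hdiff P) hj.differentiableAt, hj.fderiv, MvPolynomial.pderiv_mul]
    by_cases hij : j = i
    · subst hij
      simp [hP]
      ring
    · simp [hP, MvPolynomial.pderiv_X, Pi.single_apply, hij, Ne.symm hij]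
      ring

/-- `f` is a real polynomial function of degree at most `m`. -/
def IsPolyFun (m : ℕ) (f : (ι → ℝ) → ℝ) : Prop :=
  ∃ P : MvPolynomial ι ℝ, P.totalDegree ≤ m ∧ ∀ x, f x = MvPolynomial.eval x P

/-- `f` is a complex valued polynomial function of degree at most `m` of real variables. -/
def IsPolyFunC (m : ℕ) (f : (ι → ℝ) → ℂ) : Prop :=
  IsPolyFun m (fun x => (f x).re) ∧ IsPolyFun m (fun x => (f x).im)

lemma IsPolyFun.const (m : ℕ) (c : ℝ) : IsPolyFun m fun _ : ι → ℝ => c :=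
  ⟨MvPolynomial.C c, by simp, by simp⟩

lemma IsPolyFun.coord {m : ℕ} (hm : 1 ≤ m) (i : ι) : IsPolyFun m fun x : ι → ℝ => x i :=
  ⟨MvPolynomial.X i, by simpa using hm, by simp⟩

lemma IsPolyFun.add {m : ℕ} {f g : (ι → ℝ) → ℝ} (hf : IsPolyFun m f) (hg : IsPolyFun m g) :
    IsPolyFun m fun x => f x + g x := by
  obtain ⟨P, hP, hP'⟩ := hf
  obtain ⟨Q, hQ, hQ'⟩ := hg
  exact ⟨P + Q, (MvPolynomial.totalDegree_add P Q).trans (max_le hP hQ), by simp [hP', hQ']⟩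

lemma IsPolyFun.mul {m k : ℕ} {f g : (ι → ℝ) → ℝ} (hf : IsPolyFun m f) (hg : IsPolyFun k g) :
    IsPolyFun (m + k) fun x => f x * g x := by
  obtain ⟨P, hP, hP'⟩ := hf
  obtain ⟨Q, hQ, hQ'⟩ := hg
  exact ⟨P * Q, (MvPolynomial.totalDegree_mul P Q).trans (add_le_add hP hQ), by simp [hP', hQ']⟩

lemma IsPolyFun.const_mul {m : ℕ} (c : ℝ) {f : (ι → ℝ) → ℝ} (hf : IsPolyFun m f) :
    IsPolyFun m fun x => c * f x := by
  have := (IsPolyFun.const (ι := ι) 0 c).mul hf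
  rwa [zero_add] at this

lemma IsPolyFun.sum {α : Type*} {m : ℕ} (s : Finset α) {f : α → (ι → ℝ) → ℝ}
    (hf : ∀ t, IsPolyFun m (f t)) : IsPolyFun m fun x => ∑ t ∈ s, f t x := by
  classical
  induction s using Finset.induction_on with
  | empty => simpa using IsPolyFun.const m 0
  | insert t s ht ih =>
    simp only [Finset.sum_insert ht]
    exact (hf t).add ih

lemma IsPolyFun.contDiff {m : ℕ} {f : (ι → ℝ) → ℝ} (hf : IsPolyFun m f) {k : WithTop ℕ∞} :
    ContDiff ℝ k f := by
  obtain ⟨P, -, hP⟩ := hf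
  rw [funext hP]
  exact contDiff_eval P

lemma IsPolyFunC.const (m : ℕ) (c : ℂ) : IsPolyFunC m fun _ : ι → ℝ => c :=
  ⟨IsPolyFun.const m _, IsPolyFun.const m _⟩

lemma IsPolyFunC.ofReal {m : ℕ} {f : (ι → ℝ) → ℝ} (hf : IsPolyFun m f) :
    IsPolyFunC m fun x => (f x : ℂ) :=
  ⟨by simpa using hf, by simpa using IsPolyFun.const m 0⟩

lemma IsPolyFunC.add {m : ℕ} {f g : (ι → ℝ) → ℂ} (hf : IsPolyFunC m f) (hg : IsPolyFunC m g) :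
    IsPolyFunC m fun x => f x + g x :=
  ⟨by simpa using hf.1.add hg.1, by simpa using hf.2.add hg.2⟩

lemma IsPolyFunC.mul {m k : ℕ} {f g : (ι → ℝ) → ℂ} (hf : IsPolyFunC m f) (hg : IsPolyFunC k g) :
    IsPolyFunC (m + k) fun x => f x * g x := by
  refine ⟨?_, ?_⟩
  · have h := (hf.1.mul hg.1).add ((hf.2.mul hg.2).const_mul (-1))
    simpa [← sub_eq_add_neg] using h
  · simpa using (hf.1.mul hg.2).add (hf.2.mul hg.1)

lemma IsPolyFunC.const_mul {m : ℕ} (c : ℂ) {f : (ι → ℝ) → ℂ} (hf : IsPolyFunC m f) :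
    IsPolyFunC m fun x => c * f x := by
  have := (IsPolyFunC.const (ι := ι) 0 c).mul hf
  rwa [zero_add] at this

lemma IsPolyFunC.sub {m : ℕ} {f g : (ι → ℝ) → ℂ} (hf : IsPolyFunC m f) (hg : IsPolyFunC m g) :
    IsPolyFunC m fun x => f x - g x := by
  simpa [sub_eq_add_neg] using hf.add (hg.const_mul (-1))

lemma IsPolyFunC.sum {α : Type*} {m : ℕ} (s : Finset α) {f : α → (ι → ℝ) → ℂ}
    (hf : ∀ t, IsPolyFunC m (f t)) : IsPolyFunC m fun x => ∑ t ∈ s, f t x :=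
  ⟨by simpa using IsPolyFun.sum s fun t => (hf t).1, by simpa using IsPolyFun.sum s fun t => (hf t).2⟩

variable {n d : ℕ}

lemma isPolyFunC_simplexMatrix (p : Fin (n + 1)) (i j : Fin d) :
    IsPolyFunC 1 fun x : CoordIndex n d → ℝ => simplexMatrix x p i j := by
  have : (fun y : CoordIndex n d → ℝ => simplexMatrix y p i j) =
      fun y => simplexMatrix 0 p i j + ∑ u, entryDeriv u p i j * (y u : ℂ) := by
    funext y
    have := congrFun (congrFun (simplexMatrix_add 0 y p) i) j
    rw [zero_add] at this
    rw [this, Matrix.add_apply, simplexDir_apply_eq_sum]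
    simp only [mul_comm]
  rw [this]
  exact (IsPolyFunC.const 1 _).add (IsPolyFunC.sum _ fun u =>
    (IsPolyFunC.ofReal (IsPolyFun.coord le_rfl u)).const_mul _)

lemma IsPolyFunC.coordOfEntries {m : ℕ} {W : (ι → ℝ) → Fin d → Fin d → ℂ}
    (hW : ∀ i j, IsPolyFunC m fun x => W x i j) (a b : Fin d) :
    IsPolyFunC m fun x => coordOfEntries a b (W x) := by
  simp only [coordOfEntries_eq_sum]
  exact IsPolyFunC.sum _ fun k => IsPolyFunC.sum _ fun l => (hW k l).const_mul _

lemma isPolyFunC_fullEntry (A : Matrix (Fin (n + 1)) (Fin (n + 1)) ℝ)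
    (p : Fin (n + 1)) (i j : Fin d) (q : Fin (n + 1)) (k l : Fin d) :
    IsPolyFunC 2 fun x : CoordIndex n d → ℝ => fullEntry A (simplexMatrix x) p i j q k l := by
  have h : ∀ r s i j k l, IsPolyFunC 2 fun x : CoordIndex n d → ℝ =>
      simplexMatrix x r i j * simplexMatrix x s k l := fun r s i j k l =>
    (isPolyFunC_simplexMatrix r i j).mul (isPolyFunC_simplexMatrix s k l)
  exact ((IsPolyFunC.sum _ fun s => ((h _ _ _ _ _ _).add (h _ _ _ _ _ _)).const_mul _).const_mul
    _).sub (((h _ _ _ _ _ _).add (h _ _ _ _ _ _)).const_mul _)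

lemma isPolyFun_coMetric (A : Matrix (Fin (n + 1)) (Fin (n + 1)) ℝ) (u v : CoordIndex n d) :
    IsPolyFun 2 (coMetric A u v) := by
  have h : IsPolyFunC 2 fun x : CoordIndex n d → ℝ => ((coMetric A u v x : ℝ) : ℂ) := by
    simp only [coMetric_eq]
    exact IsPolyFunC.coordOfEntries (fun i j =>
      IsPolyFunC.coordOfEntries (fun k l => isPolyFunC_fullEntry A _ i j _ k l) _ _) _ _
  simpa using h.1

end PolynomialFunctions

/-! ### Divergence of the co-metric and its action on determinants -/

section Divergence

variable {n d : ℕ} {A : Matrix (Fin (n + 1)) (Fin (n + 1)) ℝ}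

lemma partialDeriv_eq_of_hasDerivAt {ι : Type*} [Fintype ι] [DecidableEq ι] {f : (ι → ℝ) → ℝ}
    {i : ι} {x : ι → ℝ} {c : ℝ} (hf : DifferentiableAt ℝ f x)
    (h : HasDerivAt (fun t : ℝ => f (x + t • Pi.single i 1)) c 0) : partialDeriv i f x = c := by
  have hl : HasDerivAt (fun t : ℝ => x + t • (Pi.single i 1 : ι → ℝ)) (Pi.single i 1) 0 := by
    simpa using ((hasDerivAt_id (0 : ℝ)).smul_const (Pi.single i 1 : ι → ℝ)).const_add x
  have hf' : HasFDerivAt f (fderiv ℝ f x) (x + (0 : ℝ) • (Pi.single i 1 : ι → ℝ)) := by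
    rw [zero_smul, add_zero]
    exact hf.hasFDerivAt
  exact (hf'.comp_hasDerivAt (0 : ℝ) hl).unique h

lemma hasDerivAt_of_ofReal {f : ℝ → ℝ} {c : ℝ} {t : ℝ}
    (h : HasDerivAt (fun s => (f s : ℂ)) (c : ℂ) t) : HasDerivAt f c t := by
  have := Complex.reCLM.hasFDerivAt.comp_hasDerivAt t h
  simpa [Function.comp_def] using this

lemma simplexDir_single (u : CoordIndex n d) (p : Fin (n + 1)) (i j : Fin d) :
    simplexDir (Pi.single u 1) p i j = entryDeriv u p i j := by
  rw [simplexDir_apply_eq_sum, Finset.sum_eq_single u]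
  · simp
  · intro v _ hv
    simp [Pi.single_apply, hv]
  · simp

lemma simplexMatrix_add_smul_single (x : CoordIndex n d → ℝ) (t : ℝ) (u : CoordIndex n d)
    (p : Fin (n + 1)) (i j : Fin d) :
    simplexMatrix (x + t • Pi.single u 1) p i j =
      simplexMatrix x p i j + t * entryDeriv u p i j := by
  rw [simplexMatrix_add, simplexDir_smul, Matrix.add_apply, Matrix.smul_apply, simplexDir_single]
  simp

/-- Jacobi's formula for the derivative of the determinant. -/
lemma partialDeriv_detFun {x : CoordIndex n d → ℝ} (hx : x ∈ interior (matrixSimplex n d))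
    (u : CoordIndex n d) (q : Fin (n + 1)) :
    ((partialDeriv u (detFun n d q) x : ℝ) : ℂ) =
      ∑ k, ∑ l, (simplexMatrix x q).adjugate l k * entryDeriv u q k l := by
  set Z := simplexMatrix x q with hZ
  set E := simplexDir (Pi.single u 1) q with hE
  have hunit : IsUnit Z.det :=
    (Matrix.isUnit_iff_isUnit_det _).1 (mem_interior_matrixSimplex_iff.1 hx q).isUnit
  have hline : ∀ t : ℝ, ((detFun n d q (x + t • Pi.single u 1) : ℝ) : ℂ) =
      Z.det + (Z.adjugate * E).trace * t +
        Z.det * (Matrix.det (1 + (Polynomial.X : Polynomial ℂ) •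
          (Z⁻¹ * E).map Polynomial.C)).divX.divX.eval (t : ℂ) * t ^ 2 := by
    intro t
    rw [detFun, ofReal_det_simplexMatrix_re, simplexMatrix_add, simplexDir_smul, ← hZ, ← hE]
    have h1 : Z + t • E = Z * (1 + (t : ℂ) • (Z⁻¹ * E)) := by
      rw [Matrix.mul_add, Matrix.mul_one, Matrix.mul_smul, ← Matrix.mul_assoc,
        Matrix.mul_nonsing_inv _ hunit, Matrix.one_mul]
      rfl
    have h2 : (Z.adjugate * E).trace = Z.det * (Z⁻¹ * E).trace := by
      rw [Matrix.inv_def, Matrix.smul_mul, Matrix.trace_smul, smul_eq_mul, ← mul_assoc,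
        Ring.mul_inverse_cancel _ hunit, one_mul]
    rw [h1, Matrix.det_mul, Matrix.det_one_add_smul, h2]
    ring
  have htr : (Z.adjugate * E).trace = ∑ k, ∑ l, Z.adjugate l k * entryDeriv u q k l := by
    simp only [Matrix.trace, Matrix.diag_apply, Matrix.mul_apply, hE, simplexDir_single]
    rw [Finset.sum_comm]
  rw [← htr]
  have hder : HasDerivAt (fun t : ℝ => ((detFun n d q (x + t • Pi.single u 1) : ℝ) : ℂ))
      ((Z.adjugate * E).trace) 0 := by
    simp only [hline]
    have ht : HasDerivAt (fun t : ℝ => (t : ℂ)) 1 0 := Complex.ofRealCLM.hasDerivAt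
    set Q := (Matrix.det (1 + (Polynomial.X : Polynomial ℂ) •
          (Z⁻¹ * E).map Polynomial.C)).divX.divX
    have hQ : HasDerivAt (fun t : ℝ => Q.eval (t : ℂ)) (Q.derivative.eval ((0 : ℝ) : ℂ) * 1) 0 :=
      (Q.hasDerivAt ((0 : ℝ) : ℂ)).comp (0 : ℝ) ht
    have := ((ht.const_mul ((Z.adjugate * E).trace)).const_add Z.det).add
      ((hQ.const_mul Z.det).mul (ht.pow 2))
    exact this.congr_deriv (by simp)
  have hreal : (((Z.adjugate * E).trace).re : ℂ) = (Z.adjugate * E).trace := by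
    have h1 := Complex.imCLM.hasFDerivAt.comp_hasDerivAt (0 : ℝ) hder
    have h2 : HasDerivAt (Complex.imCLM ∘ fun t : ℝ =>
        ((detFun n d q (x + t • Pi.single u 1) : ℝ) : ℂ)) 0 0 := by
      simpa [Function.comp_def] using hasDerivAt_const (0 : ℝ) (0 : ℝ)
    have h3 : ((Z.adjugate * E).trace).im = 0 := h1.unique h2
    exact Complex.ext (by simp) (by simp [h3])
  rw [← hreal] at hder ⊢
  congr 1
  exact partialDeriv_eq_of_hasDerivAt ((contDiff_det_re q (m := 1)).differentiable one_ne_zero x)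
    (hasDerivAt_of_ofReal hder)

/-- Half of `Γ_A(log det Z^{(q)}, Z^{(p)}_{ij})`. -/
def logDetEntry (A : Matrix (Fin (n + 1)) (Fin (n + 1)) ℝ)
    (Z : Fin (n + 1) → Matrix (Fin d) (Fin d) ℂ) (q p : Fin (n + 1)) (i j : Fin d) : ℂ :=
  (kron p q : ℂ) * ∑ s, (A s p : ℂ) * Z s i j - (A p q : ℂ) * Z p i j

/-- By Jacobi's formula the adjugate represents the differential of `det Z^{(q)}`; the factor
`Z^{(q)}` in each term of `Γ_A` cancels it up to the determinant. -/
lemma sum_adjugate_mul_fullEntry (Z : Fin (n + 1) → Matrix (Fin d) (Fin d) ℂ)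
    (q p : Fin (n + 1)) (i j : Fin d) :
    ∑ k, ∑ l, (Z q).adjugate l k * fullEntry A Z p i j q k l =
      (Z q).det * (2 * logDetEntry A Z q p i j) := by
  have h1 : ∀ M N : Matrix (Fin d) (Fin d) ℂ,
      ∑ k, ∑ l, (Z q).adjugate l k * (M i l * N k j) = (M * (Z q).adjugate * N) i j := by
    intro M N
    simp only [Matrix.mul_apply, Finset.sum_mul]
    exact Finset.sum_congr rfl fun k _ => Finset.sum_congr rfl fun l _ => by ring
  have h2 : ∀ M : Matrix (Fin d) (Fin d) ℂ, (M * (Z q).adjugate * Z q) i j =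
      (Z q).det * M i j := fun M => by
    rw [Matrix.mul_assoc, Matrix.adjugate_mul, Matrix.mul_smul, Matrix.mul_one, Matrix.smul_apply,
      smul_eq_mul]
  have h3 : ∀ M : Matrix (Fin d) (Fin d) ℂ, (Z q * (Z q).adjugate * M) i j =
      (Z q).det * M i j := fun M => by
    rw [Matrix.mul_adjugate, Matrix.smul_mul, Matrix.one_mul, Matrix.smul_apply, smul_eq_mul]
  have h4 : ∀ k l, (Z q).adjugate l k * fullEntry A Z p i j q k l =
      (kron p q : ℂ) * ∑ s, (A s p : ℂ) * ((Z q).adjugate l k * (Z s i l * Z p k j) +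
        (Z q).adjugate l k * (Z p i l * Z s k j)) -
      (A p q : ℂ) * ((Z q).adjugate l k * (Z q i l * Z p k j) +
        (Z q).adjugate l k * (Z p i l * Z q k j)) := by
    intro k l
    rw [fullEntry, mul_sub, mul_left_comm, Finset.mul_sum]
    congr 1
    · congr 1
      exact Finset.sum_congr rfl fun s _ => by ring
    · ring
  simp only [h4, Finset.sum_sub_distrib, ← Finset.mul_sum]
  simp only [Finset.sum_comm (t := (Finset.univ : Finset (Fin (n + 1)))), ← Finset.mul_sum,
    Finset.sum_add_distrib, h1, h2, h3]
  by_cases hpq : p = q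
  · subst hpq
    simp only [h2, h3, logDetEntry, kron, if_true]
    simp only [← two_mul, Finset.mul_sum, mul_sub]
    congr 1
    · refine Finset.sum_congr rfl fun s _ => by ring
    · ring
  · simp only [logDetEntry, kron, if_neg hpq]
    push_cast
    ring

lemma logDetEntry_conj {Z : Fin (n + 1) → Matrix (Fin d) (Fin d) ℂ} (hZ : ∀ p, (Z p).IsHermitian)
    (q p : Fin (n + 1)) (i j : Fin d) :
    starRingEnd ℂ (logDetEntry A Z q p j i) = logDetEntry A Z q p i j := by
  have h : ∀ p i j, starRingEnd ℂ (Z p i j) = Z p j i := fun p i j => by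
    simpa using (hZ p).apply j i
  simp only [logDetEntry, map_sub, map_mul, map_sum, h, Complex.conj_ofReal]

/-- Half of `Γ_A(log det Z^{(q)}, ·)` in the real coordinates. -/
def logDetField (A : Matrix (Fin (n + 1)) (Fin (n + 1)) ℝ) (q : Fin (n + 1)) (v : CoordIndex n d)
    (x : CoordIndex n d → ℝ) : ℝ :=
  (coordOfEntries v.2.1 v.2.2 fun i j => logDetEntry A (simplexMatrix x) q v.1.castSucc i j).re

lemma logDetField_eq (q : Fin (n + 1)) (v : CoordIndex n d) (x : CoordIndex n d → ℝ) :
    (logDetField A q v x : ℂ) = coordOfEntries v.2.1 v.2.2 fun i j =>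
      logDetEntry A (simplexMatrix x) q v.1.castSucc i j :=
  coordOfEntries_re_of_hermitian _ _ fun _ _ => logDetEntry_conj (simplexMatrix_isHermitian x) ..

/-- The boundary equation: `Γ_A(det Z^{(q)}, ·)` is divisible by `det Z^{(q)}`. -/
lemma sum_coMetric_mul_partialDeriv_detFun (hA : A.IsSymm) {x : CoordIndex n d → ℝ}
    (hx : x ∈ interior (matrixSimplex n d)) (q : Fin (n + 1)) (v : CoordIndex n d) :
    ∑ u, coMetric A u v x * partialDeriv u (detFun n d q) x =
      detFun n d q x * (2 * logDetField A q v x) := by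
  apply Complex.ofReal_injective
  push_cast
  simp only [partialDeriv_detFun hx, logDetField_eq]
  have h1 : ∀ u, (coMetric A u v x : ℂ) *
      ∑ k, ∑ l, (simplexMatrix x q).adjugate l k * entryDeriv u q k l =
      ∑ k, ∑ l, (simplexMatrix x q).adjugate l k * ((coMetric A v u x : ℂ) *
        entryDeriv u q k l) := by
    intro u
    rw [coMetric_comm hA u v]
    simp only [Finset.mul_sum]
    exact Finset.sum_congr rfl fun k _ => Finset.sum_congr rfl fun l _ => by ring
  simp only [h1]
  rw [Finset.sum_comm]
  trans ∑ k, ∑ l, (simplexMatrix x q).adjugate l k *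
    ∑ u, (coMetric A v u x : ℂ) * entryDeriv u q k l
  · refine Finset.sum_congr rfl fun k _ => ?_
    rw [Finset.sum_comm]
    simp only [Finset.mul_sum]
  simp only [sum_coMetric_mul_entryDeriv hA, ← coordOfEntries_mul, ← coordOfEntries_sum,
    sum_adjugate_mul_fullEntry]
  rw [detFun, ofReal_det_simplexMatrix_re]

/-- The polarization of the quadratic expression `fullEntry A Z`, at `(Z, W)`. -/
def polarEntry (A : Matrix (Fin (n + 1)) (Fin (n + 1)) ℝ)
    (Z W : Fin (n + 1) → Matrix (Fin d) (Fin d) ℂ)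
    (p : Fin (n + 1)) (i j : Fin d) (q : Fin (n + 1)) (k l : Fin d) : ℂ :=
  (kron p q : ℂ) * ∑ s, (A s p : ℂ) * (Z s i l * W p k j + W s i l * Z p k j +
      Z s k j * W p i l + W s k j * Z p i l) -
    (A p q : ℂ) * (Z q i l * W p k j + W q i l * Z p k j + Z p i l * W q k j + W p i l * Z q k j)

lemma fullEntry_add_mul (Z : Fin (n + 1) → Matrix (Fin d) (Fin d) ℂ)
    (Z' : Fin (n + 1) → Matrix (Fin d) (Fin d) ℂ) (E : Fin (n + 1) → Matrix (Fin d) (Fin d) ℂ) (t : ℂ)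
    (hZ' : ∀ p i j, Z' p i j = Z p i j + t * E p i j)
    (p : Fin (n + 1)) (i j : Fin d) (q : Fin (n + 1)) (k l : Fin d) :
    fullEntry A Z' p i j q k l =
      fullEntry A Z p i j q k l + t * polarEntry A Z E p i j q k l +
        t ^ 2 * fullEntry A E p i j q k l := by
  have h : ∀ s, (A s p : ℂ) * (Z' s i l * Z' p k j + Z' s k j * Z' p i l) =
      (A s p : ℂ) * (Z s i l * Z p k j + Z s k j * Z p i l) +
      t * ((A s p : ℂ) * (Z s i l * E p k j + E s i l * Z p k j +
      Z s k j * E p i l + E s k j * Z p i l)) +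
      t ^ 2 * ((A s p : ℂ) * (E s i l * E p k j + E s k j * E p i l)) := fun s => by
    simp only [hZ']; ring
  simp only [fullEntry, polarEntry, h, Finset.sum_add_distrib, ← Finset.mul_sum]
  simp only [hZ']
  ring

lemma sum_polarEntry_left (Z W : Fin (n + 1) → Matrix (Fin d) (Fin d) ℂ)
    (i j : Fin d) (q : Fin (n + 1)) (k l : Fin d) : ∑ p, polarEntry A Z W p i j q k l = 0 := by
  simp only [polarEntry, Finset.sum_sub_distrib]
  rw [sum_kron_mul q fun p => ∑ s, (A s p : ℂ) * (Z s i l * W p k j + W s i l * Z p k j +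
      Z s k j * W p i l + W s k j * Z p i l), sub_eq_zero]
  refine Finset.sum_congr rfl fun s _ => by ring

lemma polarEntry_sum {α : Type*} [Fintype α] (Z : Fin (n + 1) → Matrix (Fin d) (Fin d) ℂ)
    (c : α → ℂ) (W : α → Fin (n + 1) → Matrix (Fin d) (Fin d) ℂ)
    {W' : Fin (n + 1) → Matrix (Fin d) (Fin d) ℂ} (hW' : ∀ s a b, W' s a b = ∑ t, c t * W t s a b)
    (p : Fin (n + 1)) (i j : Fin d) (q : Fin (n + 1)) (k l : Fin d) :
    polarEntry A Z W' p i j q k l =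
      ∑ t, c t * polarEntry A Z (W t) p i j q k l := by
  have h : ∀ z w x y : ℂ, ∀ f g h' k' : α → ℂ, z * ∑ t, c t * f t + (∑ t, c t * g t) * w +
      x * ∑ t, c t * h' t + (∑ t, c t * k' t) * y =
      ∑ t, c t * (z * f t + g t * w + x * h' t + k' t * y) := by
    intro z w x y f g h' k'
    simp only [mul_add, Finset.sum_add_distrib, Finset.mul_sum, Finset.sum_mul]
    congr 1
    · congr 1
      · congr 1
        · exact Finset.sum_congr rfl fun t _ => by ring
        · exact Finset.sum_congr rfl fun t _ => by ring
      · exact Finset.sum_congr rfl fun t _ => by ring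
    · exact Finset.sum_congr rfl fun t _ => by ring
  simp only [polarEntry, hW', h, mul_sub, Finset.sum_sub_distrib]
  congr 1
  · simp only [Finset.mul_sum]
    rw [Finset.sum_comm]
    exact Finset.sum_congr rfl fun t _ => Finset.sum_congr rfl fun s _ => by ring
  · rw [Finset.mul_sum]
    exact Finset.sum_congr rfl fun t _ => by ring

/-- The elementary tuple with entry `1` at `(r, i, j)`. -/
def unitEntry (r : Fin (n + 1)) (i j : Fin d) : Fin (n + 1) → Matrix (Fin d) (Fin d) ℂ :=
  fun s => Matrix.of fun a b => (kron s r : ℂ) * ((kron a i : ℂ) * (kron b j : ℂ))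

lemma sum_polarEntry_unitEntry (hA : A.IsSymm) (Z : Fin (n + 1) → Matrix (Fin d) (Fin d) ℂ)
    (q : Fin (n + 1)) (k l : Fin d) :
    ∑ r, ∑ i, ∑ j, polarEntry A Z (unitEntry r i j) r i j q k l =
      ∑ r, 2 * d * logDetEntry A Z r q k l := by
  have kc : ∀ {α : Type} [DecidableEq α] (a b : α), kron a b = kron b a := fun a b => by
    simp only [kron, eq_comm]
  have kk : ∀ {α : Type} [DecidableEq α] (a : α), kron a a = 1 := fun a => by simp [kron]
  have h1 : ∀ r, ∑ i, ∑ j, polarEntry A Z (unitEntry r i j) r i j q k l =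
      2 * d * ((kron r q : ℂ) * ∑ s, (A s r : ℂ) * (Z s k l + kron s r * Z r k l) -
        (A r q : ℂ) * (Z q k l + kron r q * Z r k l)) := by
    intro r
    let F : Fin d → Fin d → ℂ := fun i j => (kron r q : ℂ) *
      ∑ s, (A s r : ℂ) * (Z s i j + kron s r * Z r i j) -
        (A r q : ℂ) * (Z q i j + kron r q * Z r i j)
    have h2 : ∀ i j, polarEntry A Z (unitEntry r i j) r i j q k l =
        (kron i k : ℂ) * F i l + (kron j l : ℂ) * F k j := by
      intro i j
      have h3 : ∀ s, (A s r : ℂ) * (Z s i l * unitEntry r i j r k j +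
          unitEntry r i j s i l * Z r k j + Z s k j * unitEntry r i j r i l +
          unitEntry r i j s k j * Z r i l) =
          (kron i k : ℂ) * ((A s r : ℂ) * (Z s i l + kron s r * Z r i l)) +
          (kron j l : ℂ) * ((A s r : ℂ) * (Z s k j + kron s r * Z r k j)) := by
        intro s
        simp only [unitEntry, Matrix.of_apply, kk, kc k i, kc l j]
        push_cast
        ring
      simp only [polarEntry, h3, Finset.sum_add_distrib, ← Finset.mul_sum, F]
      simp only [unitEntry, Matrix.of_apply, kk, kc k i, kc l j, kc q r]
      push_cast
      ring
    simp only [h2, Finset.sum_add_distrib]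
    rw [Finset.sum_comm]
    simp only [sum_kron_mul k fun i => F i l, sum_kron_mul l fun j => F k j, Finset.sum_const,
      Finset.card_univ, Fintype.card_fin, nsmul_eq_mul, F]
    ring
  simp only [h1, ← Finset.mul_sum]
  congr 1
  simp only [logDetEntry, Finset.sum_sub_distrib]
  rw [sum_kron_mul q fun r => ∑ s, (A s r : ℂ) * (Z s k l + kron s r * Z r k l)]
  simp only [kc q]
  rw [sum_kron_mul q fun _ => ∑ s, (A s q : ℂ) * Z s k l]
  simp only [mul_add, Finset.sum_add_distrib, mul_left_comm _ (kron _ _ : ℂ)]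
  rw [sum_kron_mul q fun s => (A s q : ℂ) * Z q k l,
    sum_kron_mul q fun s => (A s q : ℂ) * Z s k l, add_sub_add_right_eq_sub]
  congr 1
  exact Finset.sum_congr rfl fun s _ => by rw [hA.apply]

lemma sum_coordOfEntries_polarEntry (hA : A.IsSymm) (Z : Fin (n + 1) → Matrix (Fin d) (Fin d) ℂ)
    (q : Fin (n + 1)) (k l : Fin d) :
    ∑ u : CoordIndex n d, coordOfEntries u.2.1 u.2.2 (fun i j =>
      polarEntry A Z (simplexDir (Pi.single u 1)) u.1.castSucc i j q k l) =
      ∑ r, 2 * d * logDetEntry A Z r q k l := by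
  rw [← sum_polarEntry_unitEntry hA, Fin.sum_univ_castSucc]
  have h1 : ∀ r : Fin n, ∑ v : Fin d × Fin d, coordOfEntries v.1 v.2 (fun i j =>
      polarEntry A Z (simplexDir (Pi.single (r, v) 1)) r.castSucc i j q k l) =
      ∑ i, ∑ j, (polarEntry A Z (unitEntry r.castSucc i j) r.castSucc i j q k l -
        polarEntry A Z (unitEntry (Fin.last n) i j) r.castSucc i j q k l) := by
    intro r
    have h2 : ∀ i j, ∑ v : Fin d × Fin d, coordCoeff v.1 v.2 i j *
        polarEntry A Z (simplexDir (Pi.single (r, v) 1)) r.castSucc i j q k l =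
        polarEntry A Z (unitEntry r.castSucc i j) r.castSucc i j q k l -
        polarEntry A Z (unitEntry (Fin.last n) i j) r.castSucc i j q k l := by
      intro i j
      have h4 : ∀ s a b, unitEntry r.castSucc i j s a b - unitEntry (Fin.last n) i j s a b =
          ∑ v : Fin d × Fin d, coordCoeff v.1 v.2 i j * simplexDir (Pi.single (r, v) 1) s a b := by
        intro s a b
        have h5 := sum_coordCoeff_mul_basisEntry i j a b
        simp only [simplexDir_single, entryDeriv, mul_left_comm (coordCoeff _ _ _ _)]
        rw [← Finset.mul_sum, Fintype.sum_prod_type, h5]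
        simp only [unitEntry, kron, ite_and, Matrix.of_apply]
        push_cast
        split_ifs <;> simp
      have h3 := polarEntry_sum (A := A) Z ![1, -1]
        ![unitEntry r.castSucc i j, unitEntry (Fin.last n) i j]
        (W' := fun s => unitEntry r.castSucc i j s - unitEntry (Fin.last n) i j s)
        (fun s a b => by simp [sub_eq_add_neg]) r.castSucc i j q k l
      rw [← polarEntry_sum Z _ _ (W' := fun s => unitEntry r.castSucc i j s -
        unitEntry (Fin.last n) i j s) h4, h3]
      simp [sub_eq_add_neg]
    simp only [coordOfEntries_eq_sum]
    rw [Finset.sum_comm]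
    refine Finset.sum_congr rfl fun i _ => ?_
    rw [Finset.sum_comm]
    exact Finset.sum_congr rfl fun j _ => h2 i j
  rw [Fintype.sum_prod_type]
  simp only [h1, Finset.sum_sub_distrib]
  have h5 : ∑ r : Fin n, ∑ i, ∑ j,
      polarEntry A Z (unitEntry (Fin.last n) i j) r.castSucc i j q k l =
      - ∑ i, ∑ j, polarEntry A Z (unitEntry (Fin.last n) i j) (Fin.last n) i j q k l := by
    rw [Finset.sum_comm, ← Finset.sum_neg_distrib]
    refine Finset.sum_congr rfl fun i _ => ?_
    rw [Finset.sum_comm, ← Finset.sum_neg_distrib]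
    refine Finset.sum_congr rfl fun j _ => ?_
    have := sum_polarEntry_left (A := A) Z (unitEntry (Fin.last n) i j) i j q k l
    rw [Fin.sum_univ_castSucc] at this
    exact eq_neg_of_add_eq_zero_left this
  rw [h5, sub_neg_eq_add]

/-- The divergence of the rows of the co-metric. -/
lemma sum_partialDeriv_coMetric (hA : A.IsSymm) (x : CoordIndex n d → ℝ) (v : CoordIndex n d) :
    ∑ u, partialDeriv u (coMetric A u v) x = ∑ q, 2 * d * logDetField A q v x := by
  have hder : ∀ u, ((partialDeriv u (coMetric A u v) x : ℝ) : ℂ) =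
      coordOfEntries u.2.1 u.2.2 fun i j => coordOfEntries v.2.1 v.2.2 fun k l =>
        polarEntry A (simplexMatrix x) (simplexDir (Pi.single u 1)) u.1.castSucc i j v.1.castSucc k l := by
    intro u
    set c := coordOfEntries u.2.1 u.2.2 fun i j => coordOfEntries v.2.1 v.2.2 fun k l =>
        polarEntry A (simplexMatrix x) (simplexDir (Pi.single u 1)) u.1.castSucc i j v.1.castSucc k l with hc
    set c₂ := coordOfEntries u.2.1 u.2.2 fun i j => coordOfEntries v.2.1 v.2.2 fun k l =>
        fullEntry A (simplexDir (Pi.single u 1)) u.1.castSucc i j v.1.castSucc k l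
    have hline : ∀ t : ℝ, ((coMetric A u v (x + t • Pi.single u 1) : ℝ) : ℂ) =
        (coMetric A u v x : ℂ) + t * c + t ^ 2 * c₂ := by
      intro t
      rw [coMetric_eq, coMetric_eq]
      simp only [fullEntry_add_mul (A := A) (simplexMatrix x)
        (simplexMatrix (x + t • Pi.single u 1)) (simplexDir (Pi.single u 1)) (t : ℂ)
        (fun p i j => by rw [simplexMatrix_add_smul_single, simplexDir_single]), coordOfEntries_add,
        coordOfEntries_mul]
      rfl
    have ht : HasDerivAt (fun t : ℝ => (t : ℂ)) 1 0 := Complex.ofRealCLM.hasDerivAt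
    have hd : HasDerivAt (fun t : ℝ => ((coMetric A u v (x + t • Pi.single u 1) : ℝ) : ℂ)) c 0 := by
      simp only [hline]
      have := ((ht.mul_const c).const_add (coMetric A u v x : ℂ)).add ((ht.pow 2).mul_const c₂)
      exact this.congr_deriv (by simp)
    have hreal : (c.re : ℂ) = c := by
      have h1 := Complex.imCLM.hasFDerivAt.comp_hasDerivAt (0 : ℝ) hd
      have h2 : HasDerivAt (Complex.imCLM ∘ fun t : ℝ =>
          ((coMetric A u v (x + t • Pi.single u 1) : ℝ) : ℂ)) 0 0 := by
        simpa [Function.comp_def] using hasDerivAt_const (0 : ℝ) (0 : ℝ)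
      have h3 : c.im = 0 := h1.unique h2
      exact Complex.ext (by simp) (by simp [h3])
    rw [← hreal] at hd ⊢
    congr 1
    exact partialDeriv_eq_of_hasDerivAt
      (((isPolyFun_coMetric A u v).contDiff (k := 1)).differentiable one_ne_zero x)
      (hasDerivAt_of_ofReal hd)
  apply Complex.ofReal_injective
  push_cast
  simp only [hder, logDetField_eq]
  simp only [fun u : CoordIndex n d => coordOfEntries_swap u.2.1 u.2.2 v.2.1 v.2.2 fun i j k l =>
    polarEntry A (simplexMatrix x) (simplexDir (Pi.single u 1)) u.1.castSucc i j v.1.castSucc k l]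
  simp only [← coordOfEntries_mul, ← coordOfEntries_sum, sum_coordOfEntries_polarEntry hA]

end Divergence

/-! ### Finiteness of the Dirichlet integral -/

section Finiteness

open scoped Matrix

variable {n d : ℕ}

/-- The leading `r × r` block of `M`, completed by an identity block. -/
def leadMat (r : ℕ) (M : Matrix (Fin d) (Fin d) ℂ) : Matrix (Fin d) (Fin d) ℂ :=
  Matrix.of fun i j => if i.val < r ∧ j.val < r then M i j else (1 : Matrix (Fin d) (Fin d) ℂ) i j

lemma leadMat_zero (M : Matrix (Fin d) (Fin d) ℂ) : leadMat 0 M = 1 := by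
  ext i j; simp [leadMat]

lemma leadMat_self (M : Matrix (Fin d) (Fin d) ℂ) : leadMat d M = M := by
  ext i j; simp [leadMat]

lemma leadMat_congr {r : ℕ} {M N : Matrix (Fin d) (Fin d) ℂ}
    (h : ∀ i j : Fin d, i.val < r → j.val < r → M i j = N i j) : leadMat r M = leadMat r N := by
  ext i j
  simp only [leadMat, Matrix.of_apply]
  split_ifs with hij
  · exact h i j hij.1 hij.2
  · rfl

lemma leadMat_isHermitian {M : Matrix (Fin d) (Fin d) ℂ} (hM : M.IsHermitian) (r : ℕ) :
    (leadMat r M).IsHermitian := by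
  ext i j
  simp only [leadMat, Matrix.conjTranspose_apply, Matrix.of_apply, and_comm (a := j.val < r)]
  split_ifs
  · exact hM.apply i j
  · exact Matrix.isHermitian_one.apply i j

lemma leadMat_posDef {M : Matrix (Fin d) (Fin d) ℂ} (hM : M.PosDef) (r : ℕ) :
    (leadMat r M).PosDef := by
  have hH := leadMat_isHermitian hM.1 r
  refine (posDef_iff_quadForm hH).2 fun v hv => ?_
  let w : Fin d → ℂ := fun i => if i.val < r then v i else 0
  have h1 : quadForm (leadMat r M) v = quadForm M w + ∑ i, if i.val < r then 0 else ‖v i‖ ^ 2 := by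
    have h2 : star v ⬝ᵥ (leadMat r M).mulVec v = star w ⬝ᵥ M.mulVec w +
        ∑ i, (if i.val < r then 0 else ((‖v i‖ ^ 2 : ℝ) : ℂ)) := by
      simp only [dotProduct, Matrix.mulVec, ← Finset.sum_add_distrib]
      refine Finset.sum_congr rfl fun i _ => ?_
      by_cases hi : i.val < r
      · simp only [hi, if_true, add_zero, w, Pi.star_apply]
        congr 1
        refine Finset.sum_congr rfl fun j _ => ?_
        by_cases hj : j.val < r
        · simp [leadMat, hi, hj]
        · have : i ≠ j := fun h => hj (h ▸ hi)
          simp [leadMat, hj, Matrix.one_apply, this]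
      · simp only [hi, if_false, w, Pi.star_apply, star_zero, zero_mul, zero_add]
        rw [Finset.sum_eq_single i]
        · rw [← Complex.normSq_eq_norm_sq, Complex.normSq_eq_conj_mul_self]
          simp [leadMat, hi]
        · intro j _ hj
          simp [leadMat, hi, Matrix.one_apply, hj.symm]
        · simp
    rw [quadForm, h2, Complex.add_re, quadForm, Complex.re_sum]
    congr 1
    refine Finset.sum_congr rfl fun i _ => ?_
    split_ifs
    · rfl
    · exact Complex.ofReal_re _
  have h3 : ∀ i : Fin d, 0 ≤ (if i.val < r then 0 else ‖v i‖ ^ 2 : ℝ) := fun i => by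
    split_ifs <;> positivity
  rw [h1]
  by_cases hw : w = 0
  · obtain ⟨i, hi⟩ := Function.ne_iff.1 hv
    have hir : ¬ i.val < r := fun h => hi (by simpa [w, h] using congrFun hw i)
    refine add_pos_of_nonneg_of_pos ((posSemidef_iff_quadForm hM.1).1 hM.posSemidef w) ?_
    refine Finset.sum_pos' (fun i _ => h3 i) ⟨i, Finset.mem_univ i, ?_⟩
    rw [if_neg hir]
    have := norm_pos_iff.2 hi
    positivity
  · exact add_pos_of_pos_of_nonneg ((posDef_iff_quadForm hM.1).1 hM w hw)
      (Finset.sum_nonneg fun i _ => h3 i)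

/-- If the row `r` of `B` is a basis vector, the column `r` does not matter for the determinant. -/
lemma det_updateCol_of_row {B : Matrix (Fin d) (Fin d) ℂ} {r : Fin d}
    (hB : B.updateRow r (Pi.single r 1) = B) : (B.updateCol r (Pi.single r 1)).det = B.det := by
  have h1 : B.adjugate r r = B.det := by rw [Matrix.adjugate_apply, hB]
  have h2 := congrFun (congrFun (Matrix.adjugate_transpose B) r) r
  rw [Matrix.transpose_apply, h1, Matrix.adjugate_apply, Matrix.updateRow_transpose,
    Matrix.det_transpose] at h2
  exact h2.symm

/-- The leading minor of order `r + 1` is an affine function of the diagonal entry `(r, r)`, with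
slope the leading minor of order `r`. -/
lemma det_leadMat_succ (M : Matrix (Fin d) (Fin d) ℂ) (r : Fin d) :
    (leadMat (r + 1) M).det = M r r * (leadMat r M).det +
      ((leadMat (r + 1) M).updateRow r
        fun j => if j = r then 0 else leadMat (r + 1) M r j).det := by
  set L := leadMat (r + 1) M with hL
  have h1 : L = L.updateRow r ((M r r • (Pi.single r 1 : Fin d → ℂ)) +
      fun j => if j = r then 0 else L r j) := by
    ext i j
    by_cases hi : i = r
    · subst hi
      rw [Matrix.updateRow_self]
      by_cases hj : j = i
      · subst hj
        simp [hL, leadMat]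
      · simp [hj]
    · rw [Matrix.updateRow_ne hi]
  conv_lhs => rw [h1, Matrix.det_updateRow_add, Matrix.det_updateRow_smul]
  congr 2
  rw [← det_updateCol_of_row (r := r) (by simp)]
  congr 1
  ext i j
  by_cases hj : j = r
  · subst hj
    rw [Matrix.updateCol_self]
    simp [leadMat, Matrix.one_apply, Pi.single_apply]
  · rw [Matrix.updateCol_ne hj]
    by_cases hi : i = r
    · subst hi
      rw [Matrix.updateRow_self]
      simp [leadMat, Matrix.one_apply, Pi.single_apply, hj, Ne.symm hj]
    · rw [Matrix.updateRow_ne hi]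
      have h2 : ∀ k : Fin d, k ≠ r → (k.val < r.val + 1 ↔ k.val < r.val) := fun k hk => by
        have := Fin.val_ne_of_ne hk
        omega
      simp only [hL, leadMat, Matrix.of_apply, h2 i hi, h2 j hj]

lemma hermMatrix_update_diag (y : CoordIndex n d → ℝ) (k : Fin n) (r : Fin d) (t : ℝ) :
    hermMatrix (Function.update y (k, r, r) t) k r r = t := by
  simp [hermMatrix]

lemma hermMatrix_update_diag_of_ne (y : CoordIndex n d → ℝ) (k : Fin n) (r : Fin d) (t : ℝ)
    {l : Fin n} {i j : Fin d} (h : (l, i, j) ≠ (k, r, r)) :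
    hermMatrix (Function.update y (k, r, r) t) l i j = hermMatrix y l i j := by
  simp only [hermMatrix, Matrix.of_apply]
  by_cases hij : i = j
  · subst hij
    simp [Function.update_of_ne h]
  · have h1 : (l, i, j) ≠ (k, r, r) := h
    have h2 : (l, j, i) ≠ (k, r, r) := by
      intro h3
      simp only [Prod.mk.injEq] at h3
      exact hij (h3.2.2.trans h3.2.1.symm)
    simp [hij, Function.update_of_ne h1, Function.update_of_ne h2]

/-- A one dimensional singularity of order `b - 1 > -1` is integrable, with a bound which is
homogeneous in the slope. -/
lemma exists_lintegral_affine_rpow_le {b : ℝ} (hb : 0 < b) (hb1 : b ≤ 1) :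
    ∃ C : ENNReal, C ≠ ⊤ ∧ ∀ m c : ℝ, 0 < m →
      ∫⁻ t, (if 0 < t * m + c then ENNReal.ofReal ((t * m + c) ^ (b - 1)) else 0)
        ∂(volume.restrict (Set.Icc (-1 : ℝ) 1)) ≤ C * ENNReal.ofReal (m ^ (b - 1)) := by
  let φ : ℝ → ENNReal := (Set.Ioo (0 : ℝ) 1).indicator fun u => ENNReal.ofReal (u ^ (b - 1))
  have hφ : ∫⁻ u, φ u ≠ ⊤ := by
    have h1 : IntegrableOn (fun u : ℝ => u ^ (b - 1)) (Set.Ioo 0 1) :=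
      (intervalIntegral.integrableOn_Ioo_rpow_iff one_pos).2 (by linarith)
    rw [lintegral_indicator measurableSet_Ioo]
    exact h1.lintegral_lt_top.ne
  refine ⟨(∫⁻ u, φ u) + volume (Set.Icc (-1 : ℝ) 1), ?_, fun m c hm => ?_⟩
  · exact ENNReal.add_ne_top.2 ⟨hφ, measure_Icc_lt_top.ne⟩
  have h1 : ∀ t : ℝ, (if 0 < t * m + c then ENNReal.ofReal ((t * m + c) ^ (b - 1)) else 0) ≤
      (φ (t + c / m) + 1) * ENNReal.ofReal (m ^ (b - 1)) := fun t => by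
    split_ifs with h
    · have hu : t * m + c = m * (t + c / m) := by field_simp
      have hu0 : 0 < t + c / m := by
        rw [hu] at h
        exact pos_of_mul_pos_right h hm.le
      rw [hu, Real.mul_rpow hm.le hu0.le, ENNReal.ofReal_mul (by positivity), mul_comm]
      gcongr
      by_cases hlt : t + c / m < 1
      · have : φ (t + c / m) = ENNReal.ofReal ((t + c / m) ^ (b - 1)) :=
          Set.indicator_of_mem (Set.mem_Ioo.2 ⟨hu0, hlt⟩) _
        rw [this]
        exact le_self_add
      · refine le_trans ?_ le_add_self
        rw [ENNReal.ofReal_le_one]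
        exact Real.rpow_le_one_of_one_le_of_nonpos (not_lt.1 hlt) (by linarith)
    · exact zero_le
  refine (lintegral_mono h1).trans ?_
  rw [lintegral_mul_const' _ _ ENNReal.ofReal_ne_top]
  gcongr
  rw [lintegral_add_right _ measurable_const]
  refine add_le_add ?_ ?_
  · refine (setLIntegral_le_lintegral _ _).trans ?_
    rw [lintegral_add_right_eq_self φ (c / m)]
  · simp

/-- The power `b - 1` of the leading minor of order `r` of `M`, set to `0` unless the leading minors
up to order `r` are positive. -/
def minorPow (r : ℕ) (b : ℝ) (M : Matrix (Fin d) (Fin d) ℂ) : ENNReal :=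
  open Classical in
  if ∀ s ≤ r, 0 < (leadMat s M).det.re then ENNReal.ofReal ((leadMat r M).det.re ^ (b - 1)) else 0

lemma minorPow_ne_top (r : ℕ) (b : ℝ) (M : Matrix (Fin d) (Fin d) ℂ) : minorPow r b M ≠ ⊤ := by
  unfold minorPow
  split_ifs
  · exact ENNReal.ofReal_ne_top
  · exact ENNReal.zero_ne_top

lemma minorPow_zero (b : ℝ) (M : Matrix (Fin d) (Fin d) ℂ) : minorPow 0 b M = 1 := by
  simp [minorPow, leadMat_zero]

lemma minorPow_of_posDef {M : Matrix (Fin d) (Fin d) ℂ} (hM : M.PosDef) (b : ℝ) :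
    minorPow d b M = ENNReal.ofReal (M.det.re ^ (b - 1)) := by
  rw [minorPow, if_pos, leadMat_self]
  intro s _
  exact (Complex.pos_iff.1 (leadMat_posDef hM s).det_pos).1

lemma measurable_minorPow (r : ℕ) (b : ℝ) (k : Fin n) :
    Measurable fun y : CoordIndex n d → ℝ => minorPow r b (hermMatrix y k) := by
  have h1 : ∀ s, Continuous fun y : CoordIndex n d → ℝ =>
      (leadMat s (hermMatrix y k)).det.re := fun s => by
    refine Complex.continuous_re.comp (Continuous.matrix_det ?_)
    refine continuous_matrix fun i j => ?_
    simp only [leadMat, Matrix.of_apply]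
    split_ifs
    · exact (hermMatrix_continuous k).matrix_elem i j
    · exact continuous_const
  unfold minorPow
  refine Measurable.ite ?_ ?_ measurable_const
  · simp only [Set.ofPred_forall]
    exact MeasurableSet.iInter fun s => MeasurableSet.iInter fun _ =>
      (isOpen_lt continuous_const (h1 s)).measurableSet
  · exact ((h1 r).measurable.pow_const _).ennreal_ofReal

lemma leadMat_update_diag {s : ℕ} (y : CoordIndex n d → ℝ) (k : Fin n) {r : Fin d} (hs : s ≤ r)
    (t : ℝ) :
    leadMat s (hermMatrix (Function.update y (k, r, r) t) k) = leadMat s (hermMatrix y k) := by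
  refine leadMat_congr fun i j hi _ => hermMatrix_update_diag_of_ne y k r t ?_
  simp only [ne_eq, Prod.mk.injEq, true_and, not_and]
  intro h
  subst h
  exact absurd hi (by omega)

/-- Integrating out the diagonal entry `(r, r)` lowers the order of the minor by one. -/
lemma exists_lintegral_minorPow_update_le {b : ℝ} (hb : 0 < b) (hb1 : b ≤ 1) :
    ∃ C : ENNReal, C ≠ ⊤ ∧ ∀ (y : CoordIndex n d → ℝ) (k : Fin n) (r : Fin d),
      ∫⁻ t, minorPow (r + 1) b (hermMatrix (Function.update y (k, r, r) t) k)
        ∂(volume.restrict (Set.Icc (-1 : ℝ) 1)) ≤ C * minorPow r b (hermMatrix y k) := by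
  obtain ⟨C, hC, h⟩ := exists_lintegral_affine_rpow_le hb hb1
  refine ⟨C, hC, fun y k r => ?_⟩
  by_cases hy : ∀ s ≤ r.val, 0 < (leadMat s (hermMatrix y k)).det.re
  · set m := (leadMat r (hermMatrix y k)).det.re with hm
    let c : ℝ := ((leadMat (r + 1) (hermMatrix y k)).updateRow r
        fun j => if j = r then 0 else leadMat (r + 1) (hermMatrix y k) r j).det.re
    have h1 : ∀ t, (leadMat (r + 1) (hermMatrix (Function.update y (k, r, r) t) k)).det.re =
        t * m + c := fun t => by
      rw [det_leadMat_succ, Complex.add_re, hermMatrix_update_diag, Complex.re_ofReal_mul,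
        leadMat_update_diag y k le_rfl]
      congr 3
      ext i j
      · by_cases hi : i = r
        · subst hi
          rw [Matrix.updateRow_self, Matrix.updateRow_self]
          by_cases hj : j = i
          · rw [if_pos hj, if_pos hj]
          · simp only [hj, if_false, leadMat, Matrix.of_apply]
            rw [hermMatrix_update_diag_of_ne _ _ _ _ (by simp [hj])]
        · simp only [Matrix.updateRow_ne hi, leadMat, Matrix.of_apply]
          rw [hermMatrix_update_diag_of_ne _ _ _ _ (by simp [hi])]
    have h2 : ∀ t, minorPow (r + 1) b (hermMatrix (Function.update y (k, r, r) t) k) =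
        if 0 < t * m + c then ENNReal.ofReal ((t * m + c) ^ (b - 1)) else 0 := fun t => by
      unfold minorPow
      rw [h1]
      refine if_congr ⟨fun h3 => ?_, fun h3 s hs => ?_⟩ rfl rfl
      · simpa only [h1] using h3 (r + 1) le_rfl
      · rcases Nat.le_or_eq_of_le_succ hs with h4 | rfl
        · rw [leadMat_update_diag y k h4]
          exact hy s h4
        · rwa [h1]
    simp only [h2]
    rw [minorPow, if_pos hy]
    exact h m c (hy r le_rfl)
  · have h2 : ∀ t, minorPow (r + 1) b (hermMatrix (Function.update y (k, r, r) t) k) = 0 :=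
      fun t => by
      rw [minorPow, if_neg]
      intro h3
      refine hy fun s hs => ?_
      rw [← leadMat_update_diag y k hs t]
      exact h3 s (by omega)
    simp [h2]

/-- The uniform measure on the cube of all coordinates of modulus at most one. -/
def cubeMeasure (n d : ℕ) : Measure (CoordIndex n d → ℝ) :=
  Measure.pi fun _ => volume.restrict (Set.Icc (-1) 1)

lemma cubeMeasure_eq : cubeMeasure n d =
    volume.restrict (Set.univ.pi fun _ : CoordIndex n d => Set.Icc (-1 : ℝ) 1) := by
  rw [cubeMeasure, volume_pi, Measure.restrict_pi_pi]

lemma measurable_prod_minorPow (R : Fin n → ℕ) (b : Fin n → ℝ) :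
    Measurable fun y : CoordIndex n d → ℝ => ∏ k, minorPow (R k) (b k) (hermMatrix y k) :=
  Finset.measurable_prod _ fun k _ =>
    measurable_minorPow (R k) (b k) k

/-- The diagonal entries are integrated out one after the other. -/
lemma lintegral_prod_minorPow_lt_top {b : Fin n → ℝ} (hb : ∀ k, 0 < b k) (hb1 : ∀ k, b k ≤ 1)
    (R : Fin n → ℕ) (hR : ∀ k, R k ≤ d) :
    ∫⁻ y, ∏ k, minorPow (R k) (b k) (hermMatrix y k) ∂(cubeMeasure n d) < ⊤ := by
  obtain ⟨N, hN⟩ : ∃ N, N = ∑ k, R k := ⟨_, rfl⟩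
  induction N generalizing R with
  | zero =>
    have h0 : ∀ k, R k = 0 := fun k => by
      have := (Finset.sum_eq_zero_iff.1 hN.symm) k (Finset.mem_univ k)
      exact this
    simp only [h0, minorPow_zero, Finset.prod_const_one, lintegral_one]
    rw [cubeMeasure]
    exact measure_lt_top _ _
  | succ N ih =>
    obtain ⟨k, -, hk⟩ : ∃ k ∈ Finset.univ, R k ≠ 0 :=
      Finset.exists_ne_zero_of_sum_ne_zero (by omega)
    obtain ⟨ρ, hρ⟩ := Nat.exists_eq_succ_of_ne_zero hk
    have hρd : ρ < d := by have := hR k; omega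
    let r : Fin d := ⟨ρ, hρd⟩
    let R' := Function.update R k ρ
    obtain ⟨C, hC, h⟩ := exists_lintegral_minorPow_update_le (n := n) (d := d) (hb k) (hb1 k)
    have hne : ∀ l ∈ Finset.univ.erase k, R' l = R l := fun l hl =>
      Function.update_of_ne (Finset.ne_of_mem_erase hl) _ _
    have hR' : ∀ l, R' l ≤ R l := fun l => by
      by_cases hl : l = k
      · subst hl
        simp [R', hρ]
      · exact (hne l (by simp [hl])).le
    have h1 : ∫⁻ y, ∏ l, minorPow (R l) (b l) (hermMatrix y l) ∂(cubeMeasure n d) ≤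
        ∫⁻ y, C * ∏ l, minorPow (R' l) (b l) (hermMatrix y l) ∂(cubeMeasure n d) := by
      refine lintegral_le_of_lmarginal_le {(k, r, r)} (measurable_prod_minorPow R b)
        ((measurable_prod_minorPow R' b).const_mul C) fun y => ?_
      rw [lmarginal_singleton, lmarginal_singleton]
      have h2 : ∀ t, ∀ l ∈ Finset.univ.erase k,
          hermMatrix (Function.update y (k, r, r) t) l = hermMatrix y l := fun t l hl => by
        ext i j
        exact hermMatrix_update_diag_of_ne y k r t (by simp [Finset.ne_of_mem_erase hl])
      have h3 : ∀ t, ∏ l, minorPow (R l) (b l) (hermMatrix (Function.update y (k, r, r) t) l) =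
          minorPow (r + 1) (b k) (hermMatrix (Function.update y (k, r, r) t) k) *
            ∏ l ∈ Finset.univ.erase k, minorPow (R l) (b l) (hermMatrix y l) := fun t => by
        rw [← Finset.mul_prod_erase _ _ (Finset.mem_univ k), hρ]
        congr 1
        exact Finset.prod_congr rfl fun l hl => by rw [h2 t l hl]
      have h4 : ∀ t, C * ∏ l, minorPow (R' l) (b l) (hermMatrix (Function.update y (k, r, r) t) l) =
          C * minorPow r (b k) (hermMatrix y k) *
            ∏ l ∈ Finset.univ.erase k, minorPow (R l) (b l) (hermMatrix y l) := fun t => by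
        rw [← Finset.mul_prod_erase _ _ (Finset.mem_univ k), mul_assoc]
        congr 2
        · rw [show R' k = r by simp [R', r], minorPow, minorPow]
          simp +contextual only [leadMat_update_diag y k le_rfl]
          refine if_congr (forall_congr' fun s => forall_congr' fun hs => ?_) rfl rfl
          rw [leadMat_update_diag y k hs]
        · exact Finset.prod_congr rfl fun l hl => by rw [h2 t l hl, hne l hl]
      simp only [h3, h4]
      rw [lintegral_mul_const' _ _ (ENNReal.prod_ne_top fun l _ => minorPow_ne_top _ _ _),
        lintegral_const]
      calc _ ≤ C * minorPow r (b k) (hermMatrix y k) *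
            ∏ l ∈ Finset.univ.erase k, minorPow (R l) (b l) (hermMatrix y l) := by
            gcongr
            exact h y k r
        _ ≤ _ := by
            refine le_mul_of_one_le_right zero_le ?_
            simp only [Measure.restrict_apply_univ, Real.volume_Icc]
            rw [ENNReal.one_le_ofReal]
            norm_num
    refine h1.trans_lt ?_
    rw [lintegral_const_mul' _ _ hC]
    refine ENNReal.mul_lt_top hC.lt_top (ih R' (fun l => (hR' l).trans (hR l)) ?_)
    have h5 : R k + ∑ l ∈ Finset.univ.erase k, R l = ∑ l, R l :=
      Finset.add_sum_erase Finset.univ R (Finset.mem_univ k)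
    have h6 : R' k + ∑ l ∈ Finset.univ.erase k, R' l = ∑ l, R' l :=
      Finset.add_sum_erase Finset.univ R' (Finset.mem_univ k)
    have h7 : ∑ l ∈ Finset.univ.erase k, R' l = ∑ l ∈ Finset.univ.erase k, R l :=
      Finset.sum_congr rfl hne
    have h8 : R' k = ρ := by simp [R']
    omega

/-- The density of the sum of two independent variables with finite densities is almost everywhere
finite. -/
lemma ae_lintegral_mul_sub_lt_top {ι κ : Type*} [Fintype ι] [Fintype κ]
    {F : (ι → ℝ) → ENNReal} {G : (κ → ℝ) → ENNReal} {σ : (ι → ℝ) → (κ → ℝ)}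
    (hF : Measurable F) (hG : Measurable G) (hσ : Measurable σ)
    (hF' : ∫⁻ y, F y < ⊤) (hG' : ∫⁻ w, G w < ⊤) :
    ∀ᵐ s, ∫⁻ y, F y * G (s - σ y) < ⊤ := by
  have hm : Measurable fun q : (κ → ℝ) × (ι → ℝ) => F q.2 * G (q.1 - σ q.2) :=
    (hF.comp measurable_snd).mul (hG.comp (measurable_fst.sub (hσ.comp measurable_snd)))
  refine ae_lt_top hm.lintegral_prod_right' (ne_of_lt ?_)
  rw [lintegral_lintegral_swap hm.aemeasurable]
  have h1 : ∀ y, ∫⁻ s, F y * G (s - σ y) = F y * ∫⁻ w, G w := fun y => by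
    rw [lintegral_const_mul (F y) (f := fun s => G (s - σ y)) (hG.comp (measurable_id.sub_const _)),
      lintegral_sub_right_eq_self G (σ y)]
  simp only [h1]
  rw [lintegral_mul_const _ hF]
  exact ENNReal.mul_lt_top hF' hG'

/-- The sum of the matrices of a tuple, in coordinates. -/
def sumCoord (y : CoordIndex n d → ℝ) : CoordIndex 1 d → ℝ := fun u => ∑ k, y (k, u.2)

lemma hermMatrix_sumCoord (y : CoordIndex n d → ℝ) (p : Fin 1) :
    hermMatrix (sumCoord y) p = ∑ k, hermMatrix y k := by
  ext i j
  simp only [hermMatrix_apply_eq_sum, Matrix.sum_apply, sumCoord, Complex.ofReal_sum,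
    Finset.sum_mul]
  rw [Finset.sum_comm (s := (Finset.univ : Finset (Fin n)))]
  refine Finset.sum_congr rfl fun a _ => ?_
  rw [Finset.sum_comm]

lemma hermMatrix_sub (x y : CoordIndex n d → ℝ) (p : Fin n) :
    hermMatrix (x - y) p = hermMatrix x p - hermMatrix y p := by
  rw [eq_sub_iff_add_eq, ← hermMatrix_add, sub_add_cancel]

lemma isHermitian_conj_hermMatrix (B : Matrix (Fin d) (Fin d) ℂ) (x : CoordIndex n d → ℝ)
    (p : Fin n) : (Bᴴ * hermMatrix x p * B).IsHermitian :=
  Matrix.isHermitian_conjTranspose_mul_mul B (hermMatrix_isHermitian x p)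

/-- The congruence `Z ↦ Bᴴ Z B` on tuples of Hermitian matrices, in coordinates. -/
def conjCoord (n : ℕ) (B : Matrix (Fin d) (Fin d) ℂ) :
    (CoordIndex n d → ℝ) →ₗ[ℝ] (CoordIndex n d → ℝ) where
  toFun x := coordVec fun k => Bᴴ * hermMatrix x k * B
  map_add' x y := by
    rw [← coordVec_hermMatrix (coordVec _ + coordVec _)]
    congr 1
    funext k
    rw [hermMatrix_add, hermMatrix_add, hermMatrix_coordVec (isHermitian_conj_hermMatrix B x),
      hermMatrix_coordVec (isHermitian_conj_hermMatrix B y), mul_add, add_mul]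
  map_smul' c x := by
    rw [← coordVec_hermMatrix (RingHom.id ℝ c • coordVec _)]
    congr 1
    funext k
    rw [RingHom.id_apply, hermMatrix_smul, hermMatrix_smul,
      hermMatrix_coordVec (isHermitian_conj_hermMatrix B x), mul_smul_comm, smul_mul_assoc]

lemma hermMatrix_conjCoord (B : Matrix (Fin d) (Fin d) ℂ) (x : CoordIndex n d → ℝ) (p : Fin n) :
    hermMatrix (conjCoord n B x) p = Bᴴ * hermMatrix x p * B :=
  hermMatrix_coordVec (isHermitian_conj_hermMatrix B x) p

lemma det_conjCoord_ne_zero (n : ℕ) {B : Matrix (Fin d) (Fin d) ℂ} (hB : IsUnit B) :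
    LinearMap.det (conjCoord n B) ≠ 0 := by
  intro h
  refine (LinearMap.bot_lt_ker_of_det_eq_zero h).ne (LinearMap.ker_eq_bot'.2 fun x hx => ?_).symm
  rw [← coordVec_hermMatrix x, ← coordVec_hermMatrix (0 : CoordIndex n d → ℝ)]
  congr 1
  funext k
  have h1 := hermMatrix_conjCoord B x k
  rw [hx, hermMatrix_zero] at h1
  have h2 : IsUnit Bᴴ := by
    have := hB.star
    exact this
  rw [hermMatrix_zero]
  exact h2.mul_right_eq_zero.1 (hB.mul_left_eq_zero.1 h1.symm)

/-- The function `∏ minorPow` restricted to the unit cube. -/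
def cubeFun (d : ℕ) (b : Fin n → ℝ) : (CoordIndex n d → ℝ) → ENNReal :=
  (Set.univ.pi fun _ : CoordIndex n d => Set.Icc (-1 : ℝ) 1).indicator
    fun y => ∏ k, minorPow d (b k) (hermMatrix y k)

lemma measurable_cubeFun (b : Fin n → ℝ) : Measurable (cubeFun d b) :=
  (measurable_prod_minorPow (fun _ => d) b).indicator
    (MeasurableSet.univ_pi fun _ => measurableSet_Icc)

lemma lintegral_cubeFun_lt_top {b : Fin n → ℝ} (hb : ∀ k, 0 < b k) (hb1 : ∀ k, b k ≤ 1) :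
    ∫⁻ y, cubeFun d b y < ⊤ := by
  unfold cubeFun
  rw [lintegral_indicator (MeasurableSet.univ_pi fun _ => measurableSet_Icc), ← cubeMeasure_eq]
  exact lintegral_prod_minorPow_lt_top hb hb1 (fun _ => d) fun _ => le_rfl

lemma cubeFun_of_posDef {b : Fin n → ℝ} {y : CoordIndex n d → ℝ}
    (hy : ∀ k, (hermMatrix y k).PosDef) (h1 : ∀ k i, (hermMatrix y k i i).re ≤ 1) :
    cubeFun d b y = ∏ k, ENNReal.ofReal ((hermMatrix y k).det.re ^ (b k - 1)) := by
  unfold cubeFun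
  rw [Set.indicator_of_mem]
  · exact Finset.prod_congr rfl fun k _ => minorPow_of_posDef (hy k) _
  · rintro ⟨k, i, j⟩ -
    exact abs_le.1 (abs_coord_le_of_norm_le (norm_apply_le_one (hy k).posSemidef (h1 k)) i j)

/-- Finiteness of the Dirichlet integral for parameters at most one: the sum of `n + 1` independent
matrices with densities `det ^ (b p - 1)` on a cube has an almost everywhere finite density, and a
congruence turns its value at a positive definite matrix `S` into the Dirichlet integral. -/
lemma lintegral_prod_det_lt_top_of_le_one {b : Fin (n + 1) → ℝ} (hb : ∀ k, 0 < b k)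
    (hb1 : ∀ k, b k ≤ 1) :
    ∫⁻ x in interior (matrixSimplex n d),
      ∏ p, ENNReal.ofReal ((simplexMatrix x p).det.re ^ (b p - 1)) < ⊤ := by
  -- `s` plays the role of the sum of the `n` matrices of density `F` and of the one of density `G`
  let F := cubeFun d fun k : Fin n => b k.castSucc
  let G := cubeFun d fun _ : Fin 1 => b (Fin.last n)
  have hF : Measurable F := measurable_cubeFun _
  have hG : Measurable G := measurable_cubeFun _
  have hσ : Measurable (sumCoord (n := n) (d := d)) := by
    unfold sumCoord
    fun_prop
  have hae := ae_lintegral_mul_sub_lt_top hF hG hσ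
    (lintegral_cubeFun_lt_top (fun k => hb _) fun k => hb1 _)
    (lintegral_cubeFun_lt_top (fun k => hb _) fun k => hb1 _)
  obtain ⟨s, hs, hfin⟩ : ∃ s ∈ interior (matrixSimplex 1 d),
      ∫⁻ y, F y * G (s - sumCoord y) < ⊤ := by
    by_contra! hcon
    have h1 : interior (matrixSimplex 1 d) ⊆ {s | ¬ ∫⁻ y, F y * G (s - sumCoord y) < ⊤} :=
      fun s hs => not_lt.2 (hcon s hs)
    exact (isOpen_interior.measure_pos volume (interior_matrixSimplex_nonempty 1 d)).ne'
      (measure_mono_null h1 hae)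
  have hsp := mem_interior_matrixSimplex_iff.1 hs
  have hS : (hermMatrix s 0).PosDef := by
    have := hsp (Fin.castSucc 0)
    rwa [simplexMatrix_castSucc] at this
  have hS1 : ∀ i, (hermMatrix s 0 i i).re ≤ 1 := fun i => by
    have := diag_simplexMatrix_le_one (interior_subset hs) (Fin.castSucc 0) i
    rwa [simplexMatrix_castSucc] at this
  obtain ⟨B, hB, hSB⟩ := exists_eq_conjTranspose_mul_self hS
  let c : ℝ := Complex.normSq B.det
  have hc : 0 < c := Complex.normSq_pos.2 ((Matrix.isUnit_iff_isUnit_det B).1 hB).ne_zero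
  have hdet : ∀ M : Matrix (Fin d) (Fin d) ℂ, (Bᴴ * M * B).det.re = c * M.det.re := fun M => by
    rw [Matrix.det_mul, Matrix.det_mul, Matrix.det_conjTranspose, mul_right_comm]
    have : star B.det * B.det = (c : ℂ) := (Complex.normSq_eq_conj_mul_self).symm
    rw [this, Complex.re_ofReal_mul]
  have hT := Real.map_linearMap_volume_pi_eq_smul_volume_pi (det_conjCoord_ne_zero n hB)
  have hTc : Measurable (conjCoord n B) :=
    (LinearMap.continuous_of_finiteDimensional _).measurable
  have hint : ∫⁻ x, F (conjCoord n B x) * G (s - sumCoord (conjCoord n B x)) < ⊤ := by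
    have hm : Measurable fun y => F y * G (s - sumCoord y) :=
      hF.mul (hG.comp (measurable_const.sub hσ))
    rw [← lintegral_map hm hTc, hT, lintegral_smul_measure]
    exact ENNReal.mul_lt_top ENNReal.ofReal_lt_top hfin
  -- the congruence by `B` maps the simplex `∑ Z^{(p)} = 1` to the tuples with sum `Bᴴ B`
  have hΩ : ∀ x ∈ interior (matrixSimplex n d),
      F (conjCoord n B x) * G (s - sumCoord (conjCoord n B x)) =
        (∏ p, ENNReal.ofReal (c ^ (b p - 1))) *
          ∏ p, ENNReal.ofReal ((simplexMatrix x p).det.re ^ (b p - 1)) := fun x hx => by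
    have hx' := mem_interior_matrixSimplex_iff.1 hx
    have hPD : ∀ p, (Bᴴ * simplexMatrix x p * B).PosDef := fun p =>
      (hx' p).conjTranspose_mul_mul_same (Matrix.mulVec_injective_of_isUnit hB)
    have hsum : ∑ p, Bᴴ * simplexMatrix x p * B = hermMatrix s 0 := by
      rw [← Finset.sum_mul, ← Finset.mul_sum, sum_simplexMatrix, mul_one, hSB]
    have hdiag : ∀ p i, ((Bᴴ * simplexMatrix x p * B) i i).re ≤ 1 := fun p i => by
      refine le_trans ?_ (hS1 i)
      rw [← hsum, Matrix.sum_apply, Complex.re_sum]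
      exact Finset.single_le_sum (f := fun p => ((Bᴴ * simplexMatrix x p * B) i i).re)
        (fun q _ => (Complex.nonneg_iff.1 ((hPD q).posSemidef.diag_nonneg)).1) (Finset.mem_univ p)
    have hcast : ∀ k, hermMatrix (conjCoord n B x) k = Bᴴ * simplexMatrix x k.castSucc * B :=
      fun k => by rw [hermMatrix_conjCoord, simplexMatrix_castSucc]
    have hlast : ∀ q, hermMatrix (s - sumCoord (conjCoord n B x)) q =
        Bᴴ * simplexMatrix x (Fin.last n) * B := fun q => by
      rw [hermMatrix_sub, hermMatrix_sumCoord, Subsingleton.elim q 0, ← hsum,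
        Fin.sum_univ_castSucc]
      simp only [hcast, add_sub_cancel_left]
    have h1 : F (conjCoord n B x) = _ := cubeFun_of_posDef
      (fun k => by rw [hcast]; exact hPD _) fun k i => by rw [hcast]; exact hdiag _ i
    have h2 : G (s - sumCoord (conjCoord n B x)) = _ := cubeFun_of_posDef
      (fun k => by rw [hlast]; exact hPD _) fun k i => by rw [hlast]; exact hdiag _ i
    rw [h1, h2, ← Finset.prod_mul_distrib, Fin.prod_univ_castSucc (n := n), Fin.prod_univ_one]
    have h3 : ∀ p, ENNReal.ofReal ((Bᴴ * simplexMatrix x p * B).det.re ^ (b p - 1)) =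
        ENNReal.ofReal (c ^ (b p - 1)) *
          ENNReal.ofReal ((simplexMatrix x p).det.re ^ (b p - 1)) := fun p => by
      rw [hdet, Real.mul_rpow hc.le (det_re_pos hx p).le, ENNReal.ofReal_mul (by positivity)]
    simp only [hcast, hlast, h3]
  have hK : (∏ p, ENNReal.ofReal (c ^ (b p - 1))) ≠ 0 := by
    rw [Finset.prod_ne_zero_iff]
    intro p _
    rw [ne_eq, ENNReal.ofReal_eq_zero, not_le]
    positivity
  refine ENNReal.lt_top_of_mul_ne_top_right (ne_of_lt ?_) hK
  rw [← lintegral_const_mul' _ _ (ENNReal.prod_ne_top fun p _ => ENNReal.ofReal_ne_top),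
    ← setLIntegral_congr_fun isOpen_interior.measurableSet hΩ]
  exact (setLIntegral_le_lintegral _ _).trans_lt hint

/-- The Dirichlet integral is finite. -/
lemma lintegral_dirichletDensity_lt_top {a : Fin (n + 1) → ℝ} (ha : ∀ k, 0 < a k) :
    ∫⁻ x in interior (matrixSimplex n d), ENNReal.ofReal (dirichletDensity a x) < ⊤ := by
  have h1 : ∀ p, ∃ C : ℝ, ∀ x ∈ matrixSimplex n d, (simplexMatrix x p).det.re ≤ C := fun p => by
    obtain ⟨C, hC⟩ := (isCompact_matrixSimplex n d).exists_bound_of_continuousOn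
      (contDiff_det_re (m := 0) p).continuous.continuousOn
    exact ⟨C, fun x hx => (le_abs_self _).trans (hC x hx)⟩
  choose C hC using h1
  -- only parameters below one produce singularities
  let b : Fin (n + 1) → ℝ := fun p => min (a p) 1
  have hfin := lintegral_prod_det_lt_top_of_le_one (n := n) (d := d) (b := b)
    (fun p => lt_min (ha p) one_pos) fun p => min_le_right _ _
  have h2 : ∀ x ∈ interior (matrixSimplex n d), ENNReal.ofReal (dirichletDensity a x) ≤
      (∏ p, ENNReal.ofReal (C p ^ (a p - b p))) *
        ∏ p, ENNReal.ofReal ((simplexMatrix x p).det.re ^ (b p - 1)) := fun x hx => by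
    rw [dirichletDensity, ENNReal.ofReal_prod_of_nonneg
      (fun p _ => Real.rpow_nonneg (det_re_pos hx p).le _), ← Finset.prod_mul_distrib]
    refine Finset.prod_le_prod' fun p _ => ?_
    have hp := det_re_pos hx p
    rw [← ENNReal.ofReal_mul (Real.rpow_nonneg (hp.le.trans (hC p x (interior_subset hx))) _)]
    refine ENNReal.ofReal_le_ofReal ?_
    rw [show a p - 1 = (a p - b p) + (b p - 1) by ring, Real.rpow_add hp]
    gcongr
    · exact sub_nonneg.2 (min_le_left _ _)
    · exact hC p x (interior_subset hx)
  refine (setLIntegral_mono' isOpen_interior.measurableSet h2).trans_lt ?_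
  rw [lintegral_const_mul' _ _ (ENNReal.prod_ne_top fun p _ => ENNReal.ofReal_ne_top)]
  exact ENNReal.mul_lt_top (ENNReal.prod_lt_top fun p _ => ENNReal.ofReal_lt_top) hfin

end Finiteness

/-! ### Integration by parts for reversible diffusion operators -/

section Reversible

variable {ι : Type*} [Fintype ι] [DecidableEq ι] {Ω : Set (ι → ℝ)} {g : ι → ι → (ι → ℝ) → ℝ}
  {b : ι → (ι → ℝ) → ℝ} {ρ : (ι → ℝ) → ℝ}

lemma contDiff_partialDeriv {f : (ι → ℝ) → ℝ} (hf : ContDiff ℝ ∞ f) (i : ι) :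
    ContDiff ℝ ∞ (partialDeriv i f) :=
  (hf.fderiv_right (m := ∞) le_rfl).clm_apply contDiff_const

lemma partialDeriv_mul {f h : (ι → ℝ) → ℝ} {x : ι → ℝ} (i : ι) (hf : DifferentiableAt ℝ f x)
    (hh : DifferentiableAt ℝ h x) :
    partialDeriv i (fun y => f y * h y) x =
      partialDeriv i f x * h x + f x * partialDeriv i h x := by
  unfold partialDeriv
  rw [fderiv_fun_mul hf hh]
  simp only [add_apply, smul_apply, smul_eq_mul]
  ring

lemma partialDeriv_sum {α : Type*} (s : Finset α) {f : α → (ι → ℝ) → ℝ} {x : ι → ℝ} (i : ι)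
    (hf : ∀ t ∈ s, DifferentiableAt ℝ (f t) x) :
    partialDeriv i (fun y => ∑ t ∈ s, f t y) x = ∑ t ∈ s, partialDeriv i (f t) x := by
  unfold partialDeriv
  rw [fderiv_fun_sum hf, sum_apply]

lemma partialDeriv_coord (i j : ι) (x : ι → ℝ) :
    partialDeriv i (fun y => y j) x = if i = j then 1 else 0 := by
  unfold partialDeriv
  rw [show (fun y : ι → ℝ => y j) = (ContinuousLinearMap.proj (R := ℝ) (φ := fun _ : ι => ℝ) j) from
    rfl, ContinuousLinearMap.fderiv]
  simp [Pi.single_apply, eq_comm]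

lemma contDiff_mul_of_tsupport_subset {m : WithTop ℕ∞} {f w : (ι → ℝ) → ℝ} (hΩ : IsOpen Ω)
    (hf : ContDiff ℝ m f) (hs : tsupport f ⊆ Ω) (hw : ContDiffOn ℝ m w Ω) :
    ContDiff ℝ m fun x => f x * w x := by
  refine contDiff_iff_contDiffAt.2 fun x => ?_
  by_cases hx : x ∈ Ω
  · exact hf.contDiffAt.mul (hw.contDiffAt (hΩ.mem_nhds hx))
  · refine (contDiffAt_const (c := (0 : ℝ))).congr_of_eventuallyEq ?_
    filter_upwards [notMem_tsupport_iff_eventuallyEq.1 fun h => hx (hs h)] with y hy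
    rw [hy, Pi.zero_apply, zero_mul]

lemma integral_partialDeriv_eq_zero {V : (ι → ℝ) → ℝ} (hV : ContDiff ℝ ∞ V)
    (hs : HasCompactSupport V) (i : ι) : ∫ x, partialDeriv i V x = 0 := by
  have h1 : HasCompactSupport (partialDeriv i V) := hs.fderiv_apply ℝ (Pi.single i 1)
  have h := integral_mul_fderiv_eq_neg_fderiv_mul_of_integrable (μ := (volume : Measure (ι → ℝ)))
    (f := V) (g := fun _ => (1 : ℝ)) (v := Pi.single i 1)
    (by
      simp only [mul_one]
      exact (contDiff_partialDeriv hV i).continuous.integrable_of_hasCompactSupport h1)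
    (by simp)
    (by
      simp only [mul_one]
      exact hV.continuous.integrable_of_hasCompactSupport hs)
    (fun x _ => hV.differentiable (by simp) x) (fun x _ => differentiableAt_const _)
  simpa [partialDeriv] using h

/-- A diffusion operator with smooth coefficients on a domain `Ω` which is in divergence form with
respect to the positive density `ρ`: the drift is `b = div g + g ∇ log ρ`. -/
structure IsDivergenceForm (Ω : Set (ι → ℝ)) (g : ι → ι → (ι → ℝ) → ℝ) (b : ι → (ι → ℝ) → ℝ)
    (ρ : (ι → ℝ) → ℝ) : Prop where
  isOpen : IsOpen Ω
  smooth_g : ∀ i j, ContDiff ℝ ∞ (g i j)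
  symm_g : ∀ i j, g i j = g j i
  smooth_b : ∀ i, ContDiff ℝ ∞ (b i)
  smooth_ρ : ContDiffOn ℝ ∞ ρ Ω
  pos : ∀ x ∈ Ω, 0 < ρ x
  drift : ∀ x ∈ Ω, ∀ v, ρ x * b v x =
    ∑ u, (partialDeriv u (g u v) x * ρ x + g u v x * partialDeriv u ρ x)

/-- The measure on `Ω` with density `ρ`. -/
def densityMeasure (Ω : Set (ι → ℝ)) (ρ : (ι → ℝ) → ℝ) : Measure (ι → ℝ) :=
  (volume.restrict Ω).withDensity fun x => ENNReal.ofReal (ρ x)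

lemma densityMeasure_compl (hΩ : IsOpen Ω) : densityMeasure Ω ρ Ωᶜ = 0 := by
  refine withDensity_absolutelyContinuous _ _ ?_
  rw [Measure.restrict_apply hΩ.measurableSet.compl, Set.compl_inter_self, measure_empty]

lemma ae_mem_densityMeasure (hΩ : IsOpen Ω) : ∀ᵐ x ∂(densityMeasure Ω ρ), x ∈ Ω :=
  densityMeasure_compl hΩ

lemma IsDivergenceForm.integral_eq (H : IsDivergenceForm Ω g b ρ) (w : (ι → ℝ) → ℝ) :
    ∫ x, w x ∂(densityMeasure Ω ρ) = ∫ x in Ω, ρ x * w x := by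
  have hm := H.isOpen.measurableSet
  unfold densityMeasure
  rw [integral_withDensity_eq_integral_toReal_smul₀
    ((H.smooth_ρ.continuousOn.aemeasurable hm).ennreal_ofReal)
    (Filter.Eventually.of_forall fun _ => ENNReal.ofReal_lt_top)]
  refine setIntegral_congr_fun hm fun x hx => ?_
  simp only [ENNReal.toReal_ofReal (H.pos x hx).le, smul_eq_mul]

lemma IsDivergenceForm.measure_pos (H : IsDivergenceForm Ω g b ρ) {U : Set (ι → ℝ)}
    (hU : IsOpen U) (hne : U.Nonempty) (hUΩ : U ⊆ Ω) : 0 < densityMeasure Ω ρ U := by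
  refine pos_iff_ne_zero.2 fun h0 => ?_
  have hm := H.isOpen.measurableSet
  have h1 : volume.restrict Ω ≪ densityMeasure Ω ρ := by
    refine withDensity_absolutelyContinuous'
      (H.smooth_ρ.continuousOn.aemeasurable hm).ennreal_ofReal ?_
    filter_upwards [ae_restrict_mem hm] with x hx
    simpa using H.pos x hx
  have h2 := h1 h0
  rw [Measure.restrict_apply hU.measurableSet, Set.inter_eq_left.2 hUΩ] at h2
  exact (hU.measure_pos volume hne).ne' h2

lemma contDiff_sum_mul_partialDeriv (hg : ∀ i j, ContDiff ℝ ∞ (g i j)) {h : (ι → ℝ) → ℝ}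
    (hh : ContDiff ℝ ∞ h) (u : ι) :
    ContDiff ℝ ∞ fun x => ∑ v, g u v x * partialDeriv v h x :=
  ContDiff.sum fun v _ => (hg u v).mul (contDiff_partialDeriv hh v)

/-- Integration by parts: `f` is compactly supported in `Ω`, and `h` is any smooth function. -/
lemma IsDivergenceForm.integral_add_eq_zero (H : IsDivergenceForm Ω g b ρ) {f h : (ι → ℝ) → ℝ}
    (hf : ContDiff ℝ ∞ f) (hfc : HasCompactSupport f) (hfs : tsupport f ⊆ Ω)
    (hh : ContDiff ℝ ∞ h) :
    ∫ x, (f x * diffusionOp g b h x + carreDuChamp g f h x) ∂(densityMeasure Ω ρ) = 0 := by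
  -- the vector field `f ρ g ∇h` has divergence `ρ (f L h + Γ(f, h))`
  let V : ι → (ι → ℝ) → ℝ := fun u x => f x * (ρ x * ∑ v, g u v x * partialDeriv v h x)
  have hW : ∀ u, ContDiff ℝ ∞ fun x => ∑ v, g u v x * partialDeriv v h x :=
    contDiff_sum_mul_partialDeriv H.smooth_g hh
  have hV : ∀ u, ContDiff ℝ ∞ (V u) := fun u =>
    contDiff_mul_of_tsupport_subset H.isOpen hf hfs (H.smooth_ρ.mul (hW u).contDiffOn)
  have hVc : ∀ u, HasCompactSupport (V u) := fun u => hfc.mul_right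
  have hVs : ∀ u, tsupport (V u) ⊆ Ω := fun u => (tsupport_mul_subset_left).trans hfs
  have hdiv : ∀ x ∈ Ω, ρ x * (f x * diffusionOp g b h x + carreDuChamp g f h x) =
      ∑ u, partialDeriv u (V u) x := fun x hx => by
    have dρ : DifferentiableAt ℝ ρ x :=
      (H.smooth_ρ.contDiffAt (H.isOpen.mem_nhds hx)).differentiableAt (by simp)
    have df : DifferentiableAt ℝ f x := hf.differentiable (by simp) x
    have dW : ∀ u, DifferentiableAt ℝ (fun x => ∑ v, g u v x * partialDeriv v h x) x := fun u =>
      (hW u).differentiable (by simp) x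
    have dg : ∀ u v, DifferentiableAt ℝ (g u v) x := fun u v =>
      (H.smooth_g u v).differentiable (by simp) x
    have dh : ∀ v, DifferentiableAt ℝ (partialDeriv v h) x := fun v =>
      (contDiff_partialDeriv hh v).differentiable (by simp) x
    have h1 : ∀ u, partialDeriv u (V u) x = ∑ v, (
        ρ x * (g u v x * (partialDeriv u f x * partialDeriv v h x)) +
        (f x * partialDeriv v h x * (partialDeriv u (g u v) x * ρ x + g u v x * partialDeriv u ρ x) +
        ρ x * f x * (g u v x * partialDeriv u (partialDeriv v h) x))) := fun u => by
      rw [partialDeriv_mul u df (dρ.fun_mul (dW u)), partialDeriv_mul u dρ (dW u),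
        partialDeriv_sum _ u fun v _ => (dg u v).fun_mul (dh v)]
      simp only [partialDeriv_mul u (dg u _) (dh _), Finset.mul_sum, ← Finset.sum_add_distrib]
      exact Finset.sum_congr rfl fun v _ => by ring
    have h2 : ∑ u, ∑ v, f x * partialDeriv v h x *
        (partialDeriv u (g u v) x * ρ x + g u v x * partialDeriv u ρ x) =
        ∑ v, ρ x * f x * (b v x * partialDeriv v h x) := by
      rw [Finset.sum_comm]
      refine Finset.sum_congr rfl fun v _ => ?_
      rw [← Finset.mul_sum, ← H.drift x hx v]
      ring
    simp only [h1, Finset.sum_add_distrib, h2, diffusionOp, carreDuChamp, smul_eq_mul,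
      ← Finset.mul_sum]
    ring
  rw [H.integral_eq, setIntegral_congr_fun H.isOpen.measurableSet hdiv,
    setIntegral_eq_integral_of_forall_compl_eq_zero, integral_finsetSum]
  · exact Finset.sum_eq_zero fun u _ => integral_partialDeriv_eq_zero (hV u) (hVc u) u
  · intro u _
    exact (contDiff_partialDeriv (hV u) u).continuous.integrable_of_hasCompactSupport
      ((hVc u).fderiv_apply ℝ (Pi.single u 1))
  · intro x hx
    refine Finset.sum_eq_zero fun u _ => ?_
    have h3 : V u =ᶠ[𝓝 x] fun _ => 0 :=
      notMem_tsupport_iff_eventuallyEq.1 fun h => hx (hVs u h)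
    unfold partialDeriv
    rw [h3.fderiv_eq]
    simp

lemma integrable_mul_of_tsupport_subset {μ : Measure (ι → ℝ)} [IsFiniteMeasure μ] (hΩ : IsOpen Ω)
    {f w : (ι → ℝ) → ℝ} (hf : Continuous f) (hfc : HasCompactSupport f) (hfs : tsupport f ⊆ Ω)
    (hw : ContinuousOn w Ω) : Integrable (fun x => f x * w x) μ := by
  have h1 : Continuous fun x => f x * w x :=
    (contDiff_mul_of_tsupport_subset (m := 0) hΩ (contDiff_zero.2 hf) hfs
      (contDiffOn_zero.2 hw)).continuous
  exact h1.integrable_of_hasCompactSupport hfc.mul_right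

lemma continuousOn_diffusionOp (hg : ∀ i j, ContinuousOn (g i j) Ω)
    (hb : ∀ i, ContinuousOn (b i) Ω) {h : (ι → ℝ) → ℝ} (hh : ContDiff ℝ ∞ h) :
    ContinuousOn (diffusionOp g b h) Ω := by
  unfold diffusionOp
  simp only [smul_eq_mul]
  refine ContinuousOn.add (continuousOn_finsetSum _ fun i _ => continuousOn_finsetSum _ fun j _ =>
    (hg i j).mul ?_) (continuousOn_finsetSum _ fun i _ => (hb i).mul ?_)
  · exact (contDiff_partialDeriv (contDiff_partialDeriv hh j) i).continuous.continuousOn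
  · exact (contDiff_partialDeriv hh i).continuous.continuousOn

lemma continuousOn_carreDuChamp (hg : ∀ i j, ContinuousOn (g i j) Ω) {f h : (ι → ℝ) → ℝ}
    (hf : ContDiff ℝ ∞ f) (hh : ContDiff ℝ ∞ h) : ContinuousOn (carreDuChamp g f h) Ω := by
  unfold carreDuChamp
  simp only [smul_eq_mul]
  exact continuousOn_finsetSum _ fun i _ => continuousOn_finsetSum _ fun j _ =>
    (hg i j).mul ((contDiff_partialDeriv hf i).continuous.mul
      (contDiff_partialDeriv hh j).continuous).continuousOn

lemma carreDuChamp_comm (hg : ∀ i j, g i j = g j i) (f h : (ι → ℝ) → ℝ) (x : ι → ℝ) :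
    carreDuChamp g f h x = carreDuChamp g h f x := by
  unfold carreDuChamp
  rw [Finset.sum_comm]
  refine Finset.sum_congr rfl fun i _ => Finset.sum_congr rfl fun j _ => ?_
  rw [hg j i, mul_comm]

lemma IsDivergenceForm.integral_mul_diffusionOp (H : IsDivergenceForm Ω g b ρ)
    [IsFiniteMeasure (densityMeasure Ω ρ)] {f h : (ι → ℝ) → ℝ} (hf : ContDiff ℝ ∞ f)
    (hfc : HasCompactSupport f) (hfs : tsupport f ⊆ Ω) (hh : ContDiff ℝ ∞ h) :
    ∫ x, f x * diffusionOp g b h x ∂(densityMeasure Ω ρ) =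
      -∫ x, carreDuChamp g f h x ∂(densityMeasure Ω ρ) := by
  have hgc : ∀ i j, Continuous (g i j) := fun i j => (H.smooth_g i j).continuous
  have h1 : Integrable (fun x => f x * diffusionOp g b h x) (densityMeasure Ω ρ) :=
    integrable_mul_of_tsupport_subset H.isOpen hf.continuous hfc hfs
      (continuousOn_diffusionOp (fun i j => (hgc i j).continuousOn)
        (fun i => (H.smooth_b i).continuous.continuousOn) hh)
  have h2 : Integrable (carreDuChamp g f h) (densityMeasure Ω ρ) := by
    have h3 : Continuous (carreDuChamp g f h) := continuousOn_univ.1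
      (continuousOn_carreDuChamp (fun i j => (hgc i j).continuousOn) hf hh)
    refine h3.integrable_of_hasCompactSupport ?_
    refine HasCompactSupport.intro hfc fun x hx => ?_
    have h4 : f =ᶠ[𝓝 x] fun _ => 0 := notMem_tsupport_iff_eventuallyEq.1 hx
    refine Finset.sum_eq_zero fun i _ => Finset.sum_eq_zero fun j _ => ?_
    unfold partialDeriv
    rw [h4.fderiv_eq]
    simp
  rw [eq_neg_iff_add_eq_zero, ← integral_add h1 h2]
  exact H.integral_add_eq_zero hf hfc hfs hh

lemma IsDivergenceForm.isSymmetricDiffusion (H : IsDivergenceForm Ω g b ρ)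
    [IsFiniteMeasure (densityMeasure Ω ρ)] : IsSymmetricDiffusion Ω g b (densityMeasure Ω ρ) := by
  refine ⟨fun i => (H.smooth_b i).contDiffOn, fun f h hf hfc hfs hh hhc hhs => ?_⟩
  rw [H.integral_mul_diffusionOp hf hfc hfs hh, H.integral_mul_diffusionOp hh hhc hhs hf]
  simp only [carreDuChamp_comm H.symm_g f h]

/-! ### Uniqueness of the drift -/

/-- A symmetric diffusion operator with co-metric `g` has the drift given by the divergence form.
The difference `β` of the drifts satisfies `∫ f β·∇h = ∫ h β·∇f`, and `h = x_i f` gives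
`∫ f² β_i = 0`. -/
lemma IsDivergenceForm.drift_unique (H : IsDivergenceForm Ω g b ρ)
    [IsFiniteMeasure (densityMeasure Ω ρ)] {b' : ι → (ι → ℝ) → ℝ}
    (hb' : IsSymmetricDiffusion Ω g b' (densityMeasure Ω ρ)) {x₀ : ι → ℝ} (hx₀ : x₀ ∈ Ω) (i : ι) :
    b' i x₀ = b i x₀ := by
  set μ := densityMeasure Ω ρ with hμ
  let β : ι → (ι → ℝ) → ℝ := fun i x => b' i x - b i x
  have hβc : ∀ i, ContinuousOn (β i) Ω := fun i =>
    (hb'.1 i).continuousOn.sub (H.smooth_b i).continuous.continuousOn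
  have hgc : ∀ i j, ContinuousOn (g i j) Ω := fun i j => (H.smooth_g i j).continuous.continuousOn
  have hdiff : ∀ h : (ι → ℝ) → ℝ, ∀ x, diffusionOp g b' h x - diffusionOp g b h x =
      ∑ i, β i x * partialDeriv i h x := fun h x => by
    simp only [diffusionOp, smul_eq_mul, add_sub_add_left_eq_sub, ← Finset.sum_sub_distrib, β,
      sub_mul]
  have hβgrad : ∀ h : (ι → ℝ) → ℝ, ContDiff ℝ ∞ h →
      ContinuousOn (fun x => ∑ i, β i x * partialDeriv i h x) Ω := fun h hh =>
    continuousOn_finsetSum _ fun i _ =>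
      (hβc i).mul (contDiff_partialDeriv hh i).continuous.continuousOn
  have hsymm : ∀ f h : (ι → ℝ) → ℝ, ContDiff ℝ ∞ f → HasCompactSupport f → tsupport f ⊆ Ω →
      ContDiff ℝ ∞ h → HasCompactSupport h → tsupport h ⊆ Ω →
      ∫ x, f x * ∑ i, β i x * partialDeriv i h x ∂μ =
        ∫ x, h x * ∑ i, β i x * partialDeriv i f x ∂μ := by
    intro f h hf hfc hfs hh hhc hhs
    have key : ∀ f h : (ι → ℝ) → ℝ, ContDiff ℝ ∞ f → HasCompactSupport f → tsupport f ⊆ Ω →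
        ContDiff ℝ ∞ h → ∫ x, f x * ∑ i, β i x * partialDeriv i h x ∂μ =
          ∫ x, f x * diffusionOp g b' h x ∂μ - ∫ x, f x * diffusionOp g b h x ∂μ := by
      intro f h hf hfc hfs hh
      rw [← integral_sub]
      · simp only [← hdiff, mul_sub]
      · exact integrable_mul_of_tsupport_subset H.isOpen hf.continuous hfc hfs
          (continuousOn_diffusionOp hgc (fun i => (hb'.1 i).continuousOn) hh)
      · exact integrable_mul_of_tsupport_subset H.isOpen hf.continuous hfc hfs
          (continuousOn_diffusionOp hgc (fun i => (H.smooth_b i).continuous.continuousOn) hh)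
    rw [key f h hf hfc hfs hh, key h f hh hhc hhs hf, hb'.2 f h hf hfc hfs hh hhc hhs,
      H.isSymmetricDiffusion.2 f h hf hfc hfs hh hhc hhs]
  have hsq : ∀ f : (ι → ℝ) → ℝ, ContDiff ℝ ∞ f → HasCompactSupport f → tsupport f ⊆ Ω →
      ∫ x, f x * (f x * β i x) ∂μ = 0 := by
    intro f hf hfc hfs
    let h : (ι → ℝ) → ℝ := fun x => f x * x i
    have hh : ContDiff ℝ ∞ h := hf.mul (contDiff_apply ℝ ℝ i)
    have hgrad : ∀ x, f x * ∑ j, β j x * partialDeriv j h x =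
        f x * (f x * β i x) + h x * ∑ j, β j x * partialDeriv j f x := fun x => by
      have h1 : ∀ j, partialDeriv j h x =
          partialDeriv j f x * x i + f x * if j = i then 1 else 0 := fun j => by
        rw [partialDeriv_mul j (hf.differentiable (by simp) x) (differentiableAt_apply i x),
          partialDeriv_coord]
      simp only [h1, mul_add, Finset.sum_add_distrib, mul_ite, mul_one, mul_zero,
        Finset.sum_ite_eq', Finset.mem_univ, if_true, h, Finset.mul_sum]
      rw [add_comm]
      congr 1
      · ring
      · exact Finset.sum_congr rfl fun j _ => by ring
    have h2 := hsymm f h hf hfc hfs hh hfc.mul_right (tsupport_mul_subset_left.trans hfs)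
    simp only [hgrad] at h2
    rw [integral_add] at h2
    · linarith
    · exact integrable_mul_of_tsupport_subset H.isOpen hf.continuous hfc hfs
        (hf.continuous.continuousOn.mul (hβc i))
    · exact integrable_mul_of_tsupport_subset H.isOpen hh.continuous hfc.mul_right
        (tsupport_mul_subset_left.trans hfs) (hβgrad f hf)
  by_contra hne
  have hβ0 : β i x₀ ≠ 0 := sub_ne_zero.2 hne
  -- near `x₀` the function `β i` has the sign of `β i x₀`
  have hev : ∀ᶠ x in 𝓝 x₀, x ∈ Ω ∧ 0 < β i x₀ * β i x :=
    (H.isOpen.eventually_mem hx₀).and (((hβc i).continuousAt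
      (H.isOpen.mem_nhds hx₀)).const_mul (β i x₀) |>.eventually_const_lt
        (mul_self_pos.2 hβ0))
  obtain ⟨f, hfs, hfc, hf, hf01, hfx⟩ := exists_contDiff_tsupport_subset (n := ⊤) hev
  have hfΩ : tsupport f ⊆ Ω := fun x hx => (hfs hx).1
  have hnn : 0 ≤ fun x => f x * (f x * (β i x₀ * β i x)) := fun x => by
    by_cases hx : x ∈ tsupport f
    · have := (hfs hx).2
      simp only [Pi.zero_apply]
      rw [← mul_assoc]
      exact mul_nonneg (mul_self_nonneg _) this.le
    · simp [image_eq_zero_of_notMem_tsupport hx]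
  have hint : Integrable (fun x => f x * (f x * (β i x₀ * β i x))) μ :=
    integrable_mul_of_tsupport_subset H.isOpen hf.continuous hfc hfΩ
      (hf.continuous.continuousOn.mul (continuousOn_const.mul (hβc i)))
  have hzero : ∫ x, f x * (f x * (β i x₀ * β i x)) ∂μ = 0 := by
    have h1 : ∀ x, f x * (f x * (β i x₀ * β i x)) = β i x₀ * (f x * (f x * β i x)) := fun x => by
      ring
    simp only [h1]
    rw [integral_const_mul, hsq f hf hfc hfΩ, mul_zero]
  have hpos := H.measure_pos (U := {x | 0 < f x}) (isOpen_lt continuous_const hf.continuous)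
    ⟨x₀, by simp [hfx]⟩ fun x (hx : 0 < f x) => hfΩ (subset_tsupport f hx.ne')
  refine ((integral_pos_iff_support_of_nonneg hnn hint).2 (hpos.trans_le ?_)).ne' hzero
  refine measure_mono fun x (hx : 0 < f x) => ?_
  have := (hfs (subset_tsupport f hx.ne')).2
  rw [Function.mem_support]
  positivity

end Reversible

/-! ### Symmetry up to the boundary -/

section Cutoff

variable {ι : Type*} [Fintype ι] [DecidableEq ι] {Ω K : Set (ι → ℝ)} {g : ι → ι → (ι → ℝ) → ℝ}
  {b : ι → (ι → ℝ) → ℝ} {ρ D : (ι → ℝ) → ℝ} {F : ι → (ι → ℝ) → ℝ}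

/-- A smooth step from `0` on `(-∞, 1]` to `1` on `[2, ∞)`. -/
def smoothStep (t : ℝ) : ℝ := Real.smoothTransition (t - 1)

lemma contDiff_smoothStep : ContDiff ℝ ∞ smoothStep :=
  Real.smoothTransition.contDiff.comp (contDiff_id.sub contDiff_const)

lemma smoothStep_of_le {t : ℝ} (ht : t ≤ 1) : smoothStep t = 0 :=
  Real.smoothTransition.zero_of_nonpos (by linarith)

lemma smoothStep_of_ge {t : ℝ} (ht : 2 ≤ t) : smoothStep t = 1 :=
  Real.smoothTransition.one_of_one_le (by linarith)

lemma abs_smoothStep_le_one (t : ℝ) : |smoothStep t| ≤ 1 :=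
  abs_le.2 ⟨by have := Real.smoothTransition.nonneg (t - 1); unfold smoothStep; linarith,
    Real.smoothTransition.le_one _⟩

lemma deriv_smoothStep_of_gt {t : ℝ} (ht : 2 < t) : deriv smoothStep t = 0 := by
  have h : smoothStep =ᶠ[𝓝 t] fun _ => 1 := by
    filter_upwards [lt_mem_nhds ht] with s hs using smoothStep_of_ge (le_of_lt hs)
  rw [h.deriv_eq, deriv_const]

lemma deriv_smoothStep_of_lt {t : ℝ} (ht : t < 1) : deriv smoothStep t = 0 := by
  have h : smoothStep =ᶠ[𝓝 t] fun _ => 0 := by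
    filter_upwards [gt_mem_nhds ht] with s hs using smoothStep_of_le (le_of_lt hs)
  rw [h.deriv_eq, deriv_const]

lemma exists_abs_mul_deriv_smoothStep_le : ∃ C, ∀ t, |t * deriv smoothStep t| ≤ C := by
  have h1 : Continuous fun t => t * deriv smoothStep t :=
    continuous_id.mul (contDiff_smoothStep.continuous_deriv (by simp))
  have h2 : HasCompactSupport fun t => t * deriv smoothStep t := by
    refine HasCompactSupport.intro (isCompact_Icc (a := (1 : ℝ)) (b := 2)) fun t ht => ?_
    rcases lt_or_ge t 1 with h | h
    · rw [deriv_smoothStep_of_lt h, mul_zero]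
    · rw [deriv_smoothStep_of_gt (not_le.1 fun h' => ht ⟨h, h'⟩), mul_zero]
  exact h1.bounded_above_of_compact_support h2

/-- The cutoff equal to `smoothStep (r D)` on `K` and to `0` outside `K`. -/
def cutoff (K : Set (ι → ℝ)) (D : (ι → ℝ) → ℝ) (r : ℝ) : (ι → ℝ) → ℝ :=
  K.indicator fun x => smoothStep (r * D x)

lemma cutoff_of_mem {r : ℝ} {x : ι → ℝ} (hx : x ∈ K) : cutoff K D r x = smoothStep (r * D x) :=
  Set.indicator_of_mem hx _

lemma abs_cutoff_le_one (r : ℝ) (x : ι → ℝ) : |cutoff K D r x| ≤ 1 := by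
  by_cases hx : x ∈ K
  · rw [cutoff_of_mem hx]
    exact abs_smoothStep_le_one _
  · rw [cutoff, Set.indicator_of_notMem hx]
    simp

lemma tsupport_cutoff_subset (hK : IsCompact K) (hD : Continuous D) (r : ℝ) :
    tsupport (cutoff K D r) ⊆ {x ∈ K | 1 ≤ r * D x} := by
  refine closure_minimal (fun x hx => ?_)
    (hK.isClosed.inter (isClosed_le continuous_const (continuous_const.mul hD)))
  have hxK : x ∈ K := Set.mem_of_indicator_ne_zero hx
  refine ⟨hxK, ?_⟩
  by_contra! h
  rw [Function.mem_support, cutoff_of_mem hxK, smoothStep_of_le h.le] at hx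
  exact hx rfl

lemma hasCompactSupport_cutoff (hK : IsCompact K) (hD : Continuous D) (r : ℝ) :
    HasCompactSupport (cutoff K D r) :=
  hK.of_isClosed_subset (isClosed_tsupport _)
    fun _ hx => (tsupport_cutoff_subset hK hD r hx).1

lemma cutoff_eventuallyEq (hΩ : IsOpen Ω) (hΩK : Ω ⊆ K) (r : ℝ) {x : ι → ℝ} (hx : x ∈ Ω) :
    cutoff K D r =ᶠ[𝓝 x] fun y => smoothStep (r * D y) := by
  filter_upwards [hΩ.mem_nhds hx] with y hy using cutoff_of_mem (hΩK hy)

lemma contDiff_cutoff (hΩ : IsOpen Ω) (hΩK : Ω ⊆ K) (hD : ContDiff ℝ ∞ D) {r : ℝ}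
    (hs : tsupport (cutoff K D r) ⊆ Ω) : ContDiff ℝ ∞ (cutoff K D r) := by
  refine contDiff_iff_contDiffAt.2 fun x => ?_
  by_cases hx : x ∈ Ω
  · exact (contDiff_smoothStep.comp (contDiff_const.mul hD)).contDiffAt.congr_of_eventuallyEq
      (cutoff_eventuallyEq hΩ hΩK r hx)
  · exact (contDiffAt_const (c := (0 : ℝ))).congr_of_eventuallyEq
      (notMem_tsupport_iff_eventuallyEq.1 fun h => hx (hs h))

lemma partialDeriv_cutoff (hΩ : IsOpen Ω) (hΩK : Ω ⊆ K) (hD : ContDiff ℝ ∞ D) (r : ℝ)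
    {x : ι → ℝ} (hx : x ∈ Ω) (u : ι) :
    partialDeriv u (cutoff K D r) x = deriv smoothStep (r * D x) * (r * partialDeriv u D x) := by
  have h1 : HasFDerivAt (fun y => r * D y) (r • fderiv ℝ D x) x :=
    (hD.differentiable (by simp) x).hasFDerivAt.const_mul r
  have h2 := (contDiff_smoothStep.differentiable (by simp) (r * D x)).hasDerivAt.comp_hasFDerivAt
    x h1
  unfold partialDeriv
  rw [(cutoff_eventuallyEq hΩ hΩK r hx).fderiv_eq]
  have h3 : (fun y => smoothStep (r * D y)) = smoothStep ∘ fun y => r * D y := rfl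
  rw [h3, h2.fderiv]
  simp

lemma carreDuChamp_mul_left {f c h : (ι → ℝ) → ℝ} {x : ι → ℝ} (hc : DifferentiableAt ℝ c x)
    (hf : DifferentiableAt ℝ f x) :
    carreDuChamp g (fun y => c y * f y) h x =
      c x * carreDuChamp g f h x + f x * carreDuChamp g c h x := by
  unfold carreDuChamp
  simp only [partialDeriv_mul _ hc hf, Finset.mul_sum, ← Finset.sum_add_distrib, smul_eq_mul]
  exact Finset.sum_congr rfl fun i _ => Finset.sum_congr rfl fun j _ => by ring

lemma integrable_of_continuous_of_isCompact {μ : Measure (ι → ℝ)} [IsFiniteMeasure μ]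
    (hK : IsCompact K) (hμ : ∀ᵐ x ∂μ, x ∈ K) {w : (ι → ℝ) → ℝ} (hw : Continuous w) :
    Integrable w μ := by
  obtain ⟨C, hC⟩ := hK.exists_bound_of_continuousOn hw.continuousOn
  exact Integrable.of_bound hw.aestronglyMeasurable C (hμ.mono hC)

/-- Integration by parts without support condition. The domain is `{D > 0}` within the compact set
`K`, and the boundary equation `Γ(D, ·) = D F` makes the boundary term vanish: with the cutoffs
`smoothStep (r D)` it is bounded by a multiple of `|t smoothStep' t|` at `t = r D`. -/
lemma IsDivergenceForm.integral_mul_diffusionOp_eq_neg (H : IsDivergenceForm Ω g b ρ)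
    [IsFiniteMeasure (densityMeasure Ω ρ)] (hK : IsCompact K) (hΩK : Ω ⊆ K)
    (hD : ContDiff ℝ ∞ D) (hDpos : ∀ x ∈ Ω, 0 < D x) (hDK : ∀ x ∈ K, x ∉ Ω → D x ≤ 0)
    (hF : ∀ v, Continuous (F v))
    (hDF : ∀ x ∈ Ω, ∀ v, ∑ u, g u v x * partialDeriv u D x = D x * F v x)
    {f h : (ι → ℝ) → ℝ} (hf : ContDiff ℝ ∞ f) (hh : ContDiff ℝ ∞ h) :
    ∫ x, f x * diffusionOp g b h x ∂(densityMeasure Ω ρ) =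
      -∫ x, carreDuChamp g f h x ∂(densityMeasure Ω ρ) := by
  set μ := densityMeasure Ω ρ with hμ
  have hae : ∀ᵐ x ∂μ, x ∈ Ω := ae_mem_densityMeasure H.isOpen
  have haeK : ∀ᵐ x ∂μ, x ∈ K := hae.mono fun x hx => hΩK hx
  have hcL : Continuous (diffusionOp g b h) := continuousOn_univ.1
    (continuousOn_diffusionOp (fun i j => (H.smooth_g i j).continuous.continuousOn)
      (fun i => (H.smooth_b i).continuous.continuousOn) hh)
  have hcΓ : ∀ {f : (ι → ℝ) → ℝ}, ContDiff ℝ ∞ f → Continuous (carreDuChamp g f h) := fun hf =>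
    continuousOn_univ.1 (continuousOn_carreDuChamp
      (fun i j => (H.smooth_g i j).continuous.continuousOn) hf hh)
  let S : (ι → ℝ) → ℝ := fun x => f x * diffusionOp g b h x + carreDuChamp g f h x
  let W : (ι → ℝ) → ℝ := fun x => f x * ∑ v, F v x * partialDeriv v h x
  have hSc : Continuous S := (hf.continuous.mul hcL).add (hcΓ hf)
  have hWc : Continuous W := hf.continuous.mul (continuous_finsetSum _ fun v _ =>
    (hF v).mul (contDiff_partialDeriv hh v).continuous)
  have hsupp : ∀ r, 0 < r → tsupport (cutoff K D r) ⊆ Ω := fun r hr x hx => by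
    obtain ⟨hxK, h1⟩ := tsupport_cutoff_subset hK hD.continuous r hx
    by_contra hxΩ
    have := mul_nonpos_of_nonneg_of_nonpos hr.le (hDK x hxK hxΩ)
    linarith
  let G : ℕ → (ι → ℝ) → ℝ := fun k x =>
    cutoff K D (k + 1) x * f x * diffusionOp g b h x +
      carreDuChamp g (fun y => cutoff K D (k + 1) y * f y) h x
  have hcut : ∀ k : ℕ, ContDiff ℝ ∞ (cutoff K D (k + 1)) := fun k =>
    contDiff_cutoff H.isOpen hΩK hD (hsupp _ (by positivity))
  have hG0 : ∀ k, ∫ x, G k x ∂μ = 0 := fun k =>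
    H.integral_add_eq_zero (f := fun y => cutoff K D (k + 1) y * f y) ((hcut k).mul hf)
      (hasCompactSupport_cutoff hK hD.continuous _).mul_right
      (tsupport_mul_subset_left.trans (hsupp _ (by positivity))) hh
  have hG : ∀ k, ∀ x ∈ Ω, G k x = cutoff K D (k + 1) x * S x +
      ((k + 1) * D x * deriv smoothStep ((k + 1) * D x)) * W x := fun k x hx => by
    have h1 : carreDuChamp g (cutoff K D (k + 1)) h x =
        (k + 1) * D x * deriv smoothStep ((k + 1) * D x) * ∑ v, F v x * partialDeriv v h x := by
      unfold carreDuChamp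
      rw [Finset.sum_comm, Finset.mul_sum]
      refine Finset.sum_congr rfl fun v _ => ?_
      have h2 : ∀ u, g u v x • (partialDeriv u (cutoff K D (k + 1)) x * partialDeriv v h x) =
          deriv smoothStep ((k + 1) * D x) * (k + 1) * partialDeriv v h x *
            (g u v x * partialDeriv u D x) := fun u => by
        rw [partialDeriv_cutoff H.isOpen hΩK hD _ hx, smul_eq_mul]
        ring
      simp only [h2]
      rw [← Finset.mul_sum, hDF x hx v]
      ring
    simp only [G, S, W]
    rw [carreDuChamp_mul_left ((hcut k).differentiable (by simp) x)
      (hf.differentiable (by simp) x), h1]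
    ring
  obtain ⟨C, hC⟩ := exists_abs_mul_deriv_smoothStep_le
  obtain ⟨M, hM⟩ := hK.exists_bound_of_continuousOn hSc.continuousOn
  obtain ⟨M', hM'⟩ := hK.exists_bound_of_continuousOn hWc.continuousOn
  have hlim : Filter.Tendsto (fun k => ∫ x, G k x ∂μ) Filter.atTop (𝓝 (∫ x, S x ∂μ)) := by
    refine tendsto_integral_of_dominated_convergence (fun _ => M + C * M') (fun k => ?_)
      (integrable_const _) (fun k => ?_) ?_
    · exact ((((hcut k).continuous.mul hf.continuous).mul hcL).add
        (hcΓ ((hcut k).mul hf))).aestronglyMeasurable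
    · filter_upwards [hae] with x hx
      rw [hG k x hx]
      refine (norm_add_le _ _).trans (add_le_add ?_ ?_)
      · rw [norm_mul]
        calc _ ≤ 1 * ‖S x‖ := by
              gcongr
              exact abs_cutoff_le_one _ _
          _ ≤ M := by rw [one_mul]; exact hM x (hΩK hx)
      · rw [norm_mul]
        exact mul_le_mul (hC _) (hM' x (hΩK hx)) (norm_nonneg _) ((abs_nonneg _).trans (hC 0))
    · filter_upwards [hae] with x hx
      refine tendsto_const_nhds.congr' ?_
      have h1 : ∀ᶠ k : ℕ in Filter.atTop, 2 < ((k : ℝ) + 1) * D x := by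
        have := (Filter.tendsto_atTop_add_const_right _ (1 : ℝ)
          tendsto_natCast_atTop_atTop).atTop_mul_const (hDpos x hx)
        exact this.eventually_gt_atTop 2
      filter_upwards [h1] with k hk
      rw [hG k x hx, cutoff_of_mem (hΩK hx), smoothStep_of_ge hk.le, deriv_smoothStep_of_gt hk]
      ring
  have hS0 : ∫ x, S x ∂μ = 0 := by
    simp only [hG0] at hlim
    exact tendsto_nhds_unique hlim tendsto_const_nhds
  have hfL : Integrable (fun x => f x * diffusionOp g b h x) μ :=
    integrable_of_continuous_of_isCompact hK haeK (hf.continuous.mul hcL)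
  rw [eq_neg_iff_add_eq_zero, ← integral_add hfL
    (integrable_of_continuous_of_isCompact hK haeK (hcΓ hf))]
  exact hS0

end Cutoff

/-! ### Orthonormal bases of polynomial eigenvectors -/

section Spectral

variable {ι : Type*} [Fintype ι] [DecidableEq ι] {Ω K : Set (ι → ℝ)} {μ : Measure (ι → ℝ)}

/-- The action on polynomials of the diffusion operator with polynomial coefficients `G` and `B`. -/
def polyDiffusionOp (G : ι → ι → MvPolynomial ι ℝ) (B : ι → MvPolynomial ι ℝ) :
    MvPolynomial ι ℝ →ₗ[ℝ] MvPolynomial ι ℝ where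
  toFun P := (∑ i, ∑ j, G i j * MvPolynomial.pderiv i (MvPolynomial.pderiv j P)) +
    ∑ i, B i * MvPolynomial.pderiv i P
  map_add' P Q := by
    simp only [map_add, mul_add, Finset.sum_add_distrib]
    abel
  map_smul' c P := by
    simp only [Derivation.map_smul, mul_smul_comm, ← Finset.smul_sum, ← smul_add, RingHom.id_apply]

lemma eval_polyDiffusionOp {G : ι → ι → MvPolynomial ι ℝ} {B : ι → MvPolynomial ι ℝ}
    {g : ι → ι → (ι → ℝ) → ℝ} {b : ι → (ι → ℝ) → ℝ}
    (hG : ∀ i j x, g i j x = MvPolynomial.eval x (G i j))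
    (hB : ∀ i x, b i x = MvPolynomial.eval x (B i)) (P : MvPolynomial ι ℝ) (x : ι → ℝ) :
    diffusionOp g b (fun y => MvPolynomial.eval y P) x =
      MvPolynomial.eval x (polyDiffusionOp G B P) := by
  have h1 : ∀ j, partialDeriv j (fun y => MvPolynomial.eval y P) =
      fun y => MvPolynomial.eval y (MvPolynomial.pderiv j P) := fun j =>
    funext fun y => partialDeriv_eval j P y
  simp only [diffusionOp, h1, partialDeriv_eval, polyDiffusionOp, LinearMap.coe_mk, AddHom.coe_mk,
    map_add, map_sum, map_mul, hG, hB, smul_eq_mul]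

lemma totalDegree_polyDiffusionOp_le {G : ι → ι → MvPolynomial ι ℝ} {B : ι → MvPolynomial ι ℝ}
    (hG : ∀ i j, (G i j).totalDegree ≤ 2) (hB : ∀ i, (B i).totalDegree ≤ 1) {m : ℕ}
    {P : MvPolynomial ι ℝ} (hP : P.totalDegree ≤ m) : (polyDiffusionOp G B P).totalDegree ≤ m := by
  have h1 : ∀ j (Q : MvPolynomial ι ℝ), Q.totalDegree ≤ 1 → ∀ i,
      MvPolynomial.pderiv i (MvPolynomial.pderiv j Q) = 0 := fun j Q hQ i =>
    pderiv_eq_zero_of_totalDegree (Nat.le_zero.1 (totalDegree_pderiv_le hQ))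
  refine (MvPolynomial.totalDegree_add _ _).trans (max_le ?_ ?_)
  · refine MvPolynomial.totalDegree_finsetSum_le fun i _ =>
      MvPolynomial.totalDegree_finsetSum_le fun j _ => ?_
    rcases m with _ | _ | m
    · rw [h1 j P (by omega) i, mul_zero, MvPolynomial.totalDegree_zero]
    · rw [h1 j P hP i, mul_zero, MvPolynomial.totalDegree_zero]
      exact Nat.zero_le _
    · have := totalDegree_pderiv_le (i := i) (totalDegree_pderiv_le (i := j) hP)
      have := MvPolynomial.totalDegree_mul (G i j) (MvPolynomial.pderiv i (MvPolynomial.pderiv j P))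
      have := hG i j
      omega
  · refine MvPolynomial.totalDegree_finsetSum_le fun i _ => ?_
    rcases m with _ | m
    · rw [pderiv_eq_zero_of_totalDegree (Nat.le_zero.1 hP), mul_zero, MvPolynomial.totalDegree_zero]
    · have := totalDegree_pderiv_le (i := i) hP
      have := MvPolynomial.totalDegree_mul (B i) (MvPolynomial.pderiv i P)
      have := hB i
      omega

lemma eq_zero_of_eval_eq_zero_on_isOpen (hΩ : IsOpen Ω) (hne : Ω.Nonempty) {P : MvPolynomial ι ℝ}
    (hP : ∀ x ∈ Ω, MvPolynomial.eval x P = 0) : P = 0 := by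
  obtain ⟨x, hx⟩ := hne
  obtain ⟨ε, hε, hball⟩ := Metric.isOpen_iff.1 hΩ x hx
  refine MvPolynomial.funext_set (fun i => Metric.ball (x i) ε) (fun i => ?_) fun y hy => ?_
  · rw [Real.ball_eq_Ioo]
    exact Set.Ioo_infinite (by linarith)
  · rw [map_zero]
    refine hP y (hball ?_)
    rwa [ball_pi x hε]

/-- The inner product of `L²(μ)` on the polynomials of degree at most `m`. -/
def polyInnerCore [IsFiniteMeasure μ] (hK : IsCompact K) (hμK : ∀ᵐ x ∂μ, x ∈ K) (hΩ : IsOpen Ω)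
    (hne : Ω.Nonempty) (hμΩ : ∀ U, IsOpen U → U.Nonempty → U ⊆ Ω → 0 < μ U) (m : ℕ) :
    InnerProductSpace.Core ℝ (MvPolynomial.restrictTotalDegree ι ℝ m) where
  inner P Q := ∫ x, MvPolynomial.eval x (P : MvPolynomial ι ℝ) *
    MvPolynomial.eval x (Q : MvPolynomial ι ℝ) ∂μ
  conj_inner_symm P Q := by simp [mul_comm]
  re_inner_nonneg P := integral_nonneg fun x => mul_self_nonneg _
  add_left P Q R := by
    have h : ∀ P Q : MvPolynomial ι ℝ,
        Integrable (fun x => MvPolynomial.eval x P * MvPolynomial.eval x Q) μ := fun P Q =>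
      integrable_of_continuous_of_isCompact hK hμK
        ((contDiff_eval P (m := 0)).continuous.mul (contDiff_eval Q (m := 0)).continuous)
    rw [← integral_add (h _ _) (h _ _)]
    simp [add_mul]
  smul_left P Q c := by
    rw [conj_trivial, ← integral_const_mul]
    simp [mul_assoc, MvPolynomial.smul_eval]
  definite P hP := by
    have hc : Continuous fun x : ι → ℝ => MvPolynomial.eval x (P : MvPolynomial ι ℝ) :=
      (contDiff_eval _ (m := 0)).continuous
    have h1 := (integral_eq_zero_iff_of_nonneg (fun x => mul_self_nonneg _)
      (integrable_of_continuous_of_isCompact hK hμK (hc.mul hc))).1 hP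
    refine Subtype.ext (eq_zero_of_eval_eq_zero_on_isOpen hΩ hne fun x hx => ?_)
    by_contra hne'
    refine (hμΩ (Ω ∩ {y | MvPolynomial.eval y (P : MvPolynomial ι ℝ) ≠ 0})
      (hΩ.inter (isOpen_ne_fun hc continuous_const)) ⟨x, hx, hne'⟩ Set.inter_subset_left).ne' ?_
    refine measure_mono_null (fun y hy => ?_) h1
    simpa using hy.2

/-- A diffusion operator with coefficients of degree at most two and one, symmetric on polynomials,
is diagonalized in an orthonormal basis of each space of polynomials of bounded degree. -/
lemma exists_basis_eigenvectors [IsFiniteMeasure μ] (hK : IsCompact K) (hμK : ∀ᵐ x ∂μ, x ∈ K)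
    (hΩ : IsOpen Ω) (hne : Ω.Nonempty) (hμΩ : ∀ U, IsOpen U → U.Nonempty → U ⊆ Ω → 0 < μ U)
    {g : ι → ι → (ι → ℝ) → ℝ} {b : ι → (ι → ℝ) → ℝ} (hg : ∀ i j, IsPolyFun 2 (g i j))
    (hb : ∀ i, IsPolyFun 1 (b i))
    (hsymm : ∀ P Q : MvPolynomial ι ℝ,
      ∫ x, MvPolynomial.eval x P * diffusionOp g b (fun y => MvPolynomial.eval y Q) x ∂μ =
        ∫ x, MvPolynomial.eval x Q * diffusionOp g b (fun y => MvPolynomial.eval y P) x ∂μ)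
    (m : ℕ) :
    ∃ (N : ℕ) (e : Module.Basis (Fin N) ℝ (MvPolynomial.restrictTotalDegree ι ℝ m))
      (ev : Fin N → ℝ),
      (∀ s t, ∫ x, MvPolynomial.eval x (e s : MvPolynomial ι ℝ) *
          MvPolynomial.eval x (e t : MvPolynomial ι ℝ) ∂μ = if s = t then 1 else 0) ∧
      ∀ s, ∀ x, diffusionOp g b (fun y => MvPolynomial.eval y (e s : MvPolynomial ι ℝ)) x =
          ev s * MvPolynomial.eval x (e s : MvPolynomial ι ℝ) := by
  choose G hG2 hG using hg
  choose B hB1 hB using hb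
  let core := polyInnerCore (μ := μ) hK hμK hΩ hne hμΩ m
  let _ : NormedAddCommGroup (MvPolynomial.restrictTotalDegree ι ℝ m) := core.toNormedAddCommGroup
  let _ : InnerProductSpace ℝ (MvPolynomial.restrictTotalDegree ι ℝ m) :=
    InnerProductSpace.ofCore core.toCore
  have hinner : ∀ P Q : MvPolynomial.restrictTotalDegree ι ℝ m, inner ℝ P Q =
      ∫ x, MvPolynomial.eval x (P : MvPolynomial ι ℝ) *
        MvPolynomial.eval x (Q : MvPolynomial ι ℝ) ∂μ := fun P Q => rfl
  let T : MvPolynomial.restrictTotalDegree ι ℝ m →ₗ[ℝ] MvPolynomial.restrictTotalDegree ι ℝ m :=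
    (polyDiffusionOp G B).restrict fun P hP => by
      rw [MvPolynomial.mem_restrictTotalDegree] at hP ⊢
      exact totalDegree_polyDiffusionOp_le hG2 hB1 hP
  have hT : T.IsSymmetric := fun P Q => by
    have h := hsymm P Q
    simp only [eval_polyDiffusionOp hG hB] at h
    rw [hinner, hinner]
    simp only [T, LinearMap.coe_restrict_apply]
    rw [h]
    simp only [mul_comm]
  refine ⟨_, (hT.eigenvectorBasis rfl).toBasis, hT.eigenvalues rfl, fun s t => ?_, fun s x => ?_⟩
  · have h := (orthonormal_iff_ite.1 (hT.eigenvectorBasis rfl).orthonormal) s t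
    rw [hinner] at h
    simpa using h
  · have h := congrArg (fun P : MvPolynomial.restrictTotalDegree ι ℝ m =>
      MvPolynomial.eval x (P : MvPolynomial ι ℝ)) (hT.apply_eigenvectorBasis rfl s)
    rw [eval_polyDiffusionOp hG hB, OrthonormalBasis.coe_toBasis]
    rw [Submodule.coe_smul, MvPolynomial.smul_eval] at h
    exact h

end Spectral

/-! ### The generator of the Dirichlet measure -/

section Generator

variable {n d : ℕ} {A : Matrix (Fin (n + 1)) (Fin (n + 1)) ℝ}

/-- The drift of the reversible diffusion operator `L_{A, a}` in the coordinates. -/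
def dirichletDrift (A : Matrix (Fin (n + 1)) (Fin (n + 1)) ℝ) (a : Fin (n + 1) → ℝ)
    (v : CoordIndex n d) (x : CoordIndex n d → ℝ) : ℝ :=
  ∑ q, 2 * (a q + d - 1) * logDetField A q v x

lemma isPolyFun_logDetField (q : Fin (n + 1)) (v : CoordIndex n d) :
    IsPolyFun 1 (logDetField A q v) := by
  have h : IsPolyFunC 1 fun x : CoordIndex n d → ℝ => ((logDetField A q v x : ℝ) : ℂ) := by
    simp only [logDetField_eq]
    refine IsPolyFunC.coordOfEntries (fun i j => ?_) _ _
    exact ((IsPolyFunC.sum _ fun s => (isPolyFunC_simplexMatrix s i j).const_mul _).const_mul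
      _).sub ((isPolyFunC_simplexMatrix _ i j).const_mul _)
  simpa using h.1

lemma isPolyFun_dirichletDrift (a : Fin (n + 1) → ℝ) (v : CoordIndex n d) :
    IsPolyFun 1 (dirichletDrift A a v) :=
  IsPolyFun.sum _ fun q => (isPolyFun_logDetField q v).const_mul _

lemma sum_logDetEntry (Z : Fin (n + 1) → Matrix (Fin d) (Fin d) ℂ)
    (q : Fin (n + 1)) (i j : Fin d) : ∑ p, logDetEntry A Z q p i j = 0 := by
  simp only [logDetEntry, Finset.sum_sub_distrib]
  rw [sum_kron_mul q fun p => ∑ s, (A s p : ℂ) * Z s i j, sub_self]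

lemma sum_logDetField_mul_entryDeriv (x : CoordIndex n d → ℝ)
    (q p : Fin (n + 1)) (i j : Fin d) :
    ∑ v, (logDetField A q v x : ℂ) * entryDeriv v p i j =
      logDetEntry A (simplexMatrix x) q p i j := by
  simp only [logDetField_eq]
  exact sum_coordOfEntries_mul_entryDeriv (W := fun p i j => logDetEntry A (simplexMatrix x) q p i j)
    (sum_logDetEntry _ q) p i j

/-- The value of the generator on the entries of the matrices. -/
lemma diffusionOp_hermMatrix (hA : A.IsSymm) (a : Fin (n + 1) → ℝ)
    {b : CoordIndex n d → (CoordIndex n d → ℝ) → ℝ} {x : CoordIndex n d → ℝ}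
    (hb : ∀ v, b v x = dirichletDrift A a v x) (p : Fin n) (i j : Fin d) :
    diffusionOp (coMetric A) b (fun y => hermMatrix y p i j) x =
      ∑ q, 2 * ((a p.castSucc + d - 1 : ℝ) : ℂ) * (A p.castSucc q : ℂ) * simplexMatrix x q i j -
        ∑ q, 2 * ((a q + d - 1 : ℝ) : ℂ) * (A p.castSucc q : ℂ) *
          simplexMatrix x p.castSucc i j := by
  have h0 : (fun y : CoordIndex n d → ℝ => hermMatrix y p i j) =
      fun y => simplexMatrix y p.castSucc i j := by simp
  have h1 : ∀ v, partialDeriv v (fun y : CoordIndex n d → ℝ => simplexMatrix y p.castSucc i j) =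
      fun _ => entryDeriv v p.castSucc i j := fun v =>
    funext fun y => partialDeriv_simplexMatrix v p.castSucc i j y
  have h2 : ∀ (u : CoordIndex n d) (c : ℂ), partialDeriv u (fun _ => c) x = 0 := fun u c => by
    simp [partialDeriv]
  have h3 : ∑ v, (dirichletDrift A a v x : ℂ) * entryDeriv v p.castSucc i j =
      ∑ q, 2 * ((a q + d - 1 : ℝ) : ℂ) * logDetEntry A (simplexMatrix x) q p.castSucc i j := by
    simp only [← sum_logDetField_mul_entryDeriv, Finset.mul_sum, dirichletDrift,
      Complex.ofReal_sum, Finset.sum_mul]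
    rw [Finset.sum_comm]
    refine Finset.sum_congr rfl fun q _ => Finset.sum_congr rfl fun v _ => ?_
    push_cast
    ring
  simp only [diffusionOp, h0, h1, h2, smul_zero, Finset.sum_const_zero, zero_add, hb,
    Complex.real_smul, h3, logDetEntry, mul_sub, Finset.sum_sub_distrib]
  congr 1
  · have h4 : ∀ q, 2 * ((a q + d - 1 : ℝ) : ℂ) * ((kron p.castSucc q : ℂ) *
        ∑ s, (A s p.castSucc : ℂ) * simplexMatrix x s i j) =
        if p.castSucc = q then 2 * ((a q + d - 1 : ℝ) : ℂ) *
          ∑ s, (A s p.castSucc : ℂ) * simplexMatrix x s i j else 0 := fun q => by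
      unfold kron
      split_ifs <;> simp
    rw [Finset.sum_congr rfl fun q _ => h4 q]
    simp only [Finset.sum_ite_eq, Finset.mem_univ, if_true, Finset.mul_sum]
    refine Finset.sum_congr rfl fun s _ => ?_
    rw [hA.apply]
    ring
  · exact Finset.sum_congr rfl fun q _ => by ring

lemma dirichletDensity_pos (a : Fin (n + 1) → ℝ) {x : CoordIndex n d → ℝ}
    (hx : x ∈ interior (matrixSimplex n d)) : 0 < dirichletDensity a x :=
  Finset.prod_pos fun p _ => Real.rpow_pos_of_pos (det_re_pos hx p) _

lemma contDiffOn_dirichletDensity (a : Fin (n + 1) → ℝ) :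
    ContDiffOn ℝ ∞ (dirichletDensity a) (interior (matrixSimplex n d)) :=
  contDiffOn_prod fun p _ => (contDiff_det_re p).contDiffOn.rpow_const_of_ne
    fun _ hx => (det_re_pos hx p).ne'

/-- The logarithmic derivative of the density. -/
lemma partialDeriv_dirichletDensity (a : Fin (n + 1) → ℝ) {x : CoordIndex n d → ℝ}
    (hx : x ∈ interior (matrixSimplex n d)) (u : CoordIndex n d) :
    partialDeriv u (dirichletDensity a) x = dirichletDensity a x *
      ∑ q, (a q - 1) * ((detFun n d q x)⁻¹ * partialDeriv u (detFun n d q) x) := by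
  have h1 : ∀ y ∈ interior (matrixSimplex n d), dirichletDensity a y =
      Real.exp (∑ q, (a q - 1) * Real.log (detFun n d q y)) := fun y hy => by
    rw [Real.exp_sum]
    refine Finset.prod_congr rfl fun q _ => ?_
    rw [mul_comm]
    exact Real.rpow_def_of_pos (det_re_pos hy q) _
  have h2 : dirichletDensity a =ᶠ[𝓝 x]
      fun y => Real.exp (∑ q, (a q - 1) * Real.log (detFun n d q y)) := by
    filter_upwards [isOpen_interior.mem_nhds hx] with y hy using h1 y hy
  have h3 : ∀ q, HasFDerivAt (detFun n d q) (fderiv ℝ (detFun n d q) x) x := fun q =>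
    ((contDiff_det_re q (m := 1)).differentiable one_ne_zero x).hasFDerivAt
  have h4 := (HasFDerivAt.fun_sum (u := Finset.univ) fun q _ =>
    ((h3 q).log (det_re_pos hx q).ne').const_mul (a q - 1)).exp
  unfold partialDeriv
  rw [h2.fderiv_eq, h4.fderiv, h1 x hx]
  simp

lemma sum_coMetric_mul_partialDeriv_dirichletDensity (hA : A.IsSymm) (a : Fin (n + 1) → ℝ)
    {x : CoordIndex n d → ℝ} (hx : x ∈ interior (matrixSimplex n d)) (v : CoordIndex n d) :
    ∑ u, coMetric A u v x * partialDeriv u (dirichletDensity a) x =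
      dirichletDensity a x * ∑ q, (a q - 1) * (2 * logDetField A q v x) := by
  have h1 : ∀ u, coMetric A u v x * partialDeriv u (dirichletDensity a) x =
      ∑ q, dirichletDensity a x * ((a q - 1) * (detFun n d q x)⁻¹ *
        (coMetric A u v x * partialDeriv u (detFun n d q) x)) := fun u => by
    rw [partialDeriv_dirichletDensity a hx, ← Finset.mul_sum, mul_left_comm, Finset.mul_sum]
    congr 1
    exact Finset.sum_congr rfl fun q _ => by ring
  simp only [h1]
  rw [Finset.sum_comm, Finset.mul_sum]
  refine Finset.sum_congr rfl fun q _ => ?_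
  rw [← Finset.mul_sum, ← Finset.mul_sum, sum_coMetric_mul_partialDeriv_detFun hA hx q v]
  have : detFun n d q x ≠ 0 := (det_re_pos hx q).ne'
  field_simp

lemma isDivergenceForm_dirichlet (hA : A.IsSymm) (a : Fin (n + 1) → ℝ) {c : ℝ} (hc : 0 < c) :
    IsDivergenceForm (interior (matrixSimplex n d)) (coMetric A) (dirichletDrift A a)
      fun x => c * dirichletDensity a x where
  isOpen := isOpen_interior
  smooth_g u v := (isPolyFun_coMetric A u v).contDiff
  symm_g u v := funext fun x => coMetric_comm hA u v x
  smooth_b v := (isPolyFun_dirichletDrift a v).contDiff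
  smooth_ρ := contDiffOn_const.mul (contDiffOn_dirichletDensity a)
  pos x hx := mul_pos hc (dirichletDensity_pos a hx)
  drift x hx v := by
    have hdiff : DifferentiableAt ℝ (dirichletDensity a) x :=
      ((contDiffOn_dirichletDensity a).contDiffAt
        (isOpen_interior.mem_nhds hx)).differentiableAt (by simp)
    have h1 : ∀ u, partialDeriv u (fun x => c * dirichletDensity a x) x =
        c * partialDeriv u (dirichletDensity a) x := fun u => by
      unfold partialDeriv
      rw [fderiv_const_mul hdiff]
      simp
    simp only [h1, Finset.sum_add_distrib, ← Finset.sum_mul, sum_partialDeriv_coMetric hA,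
      mul_left_comm _ c, ← Finset.mul_sum,
      sum_coMetric_mul_partialDeriv_dirichletDensity hA a hx v]
    simp only [dirichletDrift, Finset.mul_sum, Finset.sum_mul, ← Finset.sum_add_distrib]
    exact Finset.sum_congr rfl fun q _ => by ring

lemma dirichletWeight_eq (a : Fin (n + 1) → ℝ) :
    dirichletWeight n d a =
      densityMeasure (interior (matrixSimplex n d)) (dirichletDensity a) := by
  rw [dirichletWeight, densityMeasure, volume_restrict_matrixSimplex]

lemma dirichletWeight_univ_lt_top {a : Fin (n + 1) → ℝ} (ha : ∀ k, 0 < a k) :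
    dirichletWeight n d a Set.univ < ⊤ := by
  rw [dirichletWeight_eq, densityMeasure, withDensity_apply _ MeasurableSet.univ,
    Measure.restrict_univ]
  exact lintegral_dirichletDensity_lt_top ha

lemma dirichletWeight_univ_pos (a : Fin (n + 1) → ℝ) : 0 < dirichletWeight n d a Set.univ := by
  have h := (isDivergenceForm_dirichlet (d := d) (A := 0) Matrix.isSymm_zero a one_pos).measure_pos
    isOpen_interior (interior_matrixSimplex_nonempty n d) subset_rfl
  simp only [one_mul] at h
  rw [dirichletWeight_eq]
  exact h.trans_le (measure_mono (Set.subset_univ _))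

/-- The normalized Dirichlet measure has a density on the interior of the simplex. -/
lemma exists_matrixDirichlet_eq {a : Fin (n + 1) → ℝ} (ha : ∀ k, 0 < a k) :
    ∃ c : ℝ, 0 < c ∧ matrixDirichlet n d a =
      densityMeasure (interior (matrixSimplex n d)) fun x => c * dirichletDensity a x := by
  have h0 : (dirichletWeight n d a Set.univ)⁻¹ ≠ 0 :=
    ENNReal.inv_ne_zero.2 (dirichletWeight_univ_lt_top ha).ne
  have h1 : (dirichletWeight n d a Set.univ)⁻¹ ≠ ⊤ :=
    ENNReal.inv_ne_top.2 (dirichletWeight_univ_pos a).ne'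
  refine ⟨((dirichletWeight n d a Set.univ)⁻¹).toReal, ENNReal.toReal_pos h0 h1, ?_⟩
  rw [matrixDirichlet]
  nth_rw 2 [dirichletWeight_eq]
  rw [densityMeasure, ← withDensity_smul' _ _ h1, densityMeasure]
  congr 1
  funext x
  rw [ENNReal.ofReal_mul ENNReal.toReal_nonneg, ENNReal.ofReal_toReal h1, Pi.smul_apply,
    smul_eq_mul]

lemma isProbabilityMeasure_matrixDirichlet {a : Fin (n + 1) → ℝ} (ha : ∀ k, 0 < a k) :
    IsProbabilityMeasure (matrixDirichlet n d a) := by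
  refine ⟨?_⟩
  rw [matrixDirichlet, Measure.smul_apply, smul_eq_mul]
  exact ENNReal.inv_mul_cancel (dirichletWeight_univ_pos a).ne' (dirichletWeight_univ_lt_top ha).ne

lemma prod_detFun_eq_zero {x : CoordIndex n d → ℝ} (hx : x ∈ matrixSimplex n d)
    (hx' : x ∉ interior (matrixSimplex n d)) : ∏ p, detFun n d p x = 0 := by
  rw [mem_interior_matrixSimplex_iff] at hx'
  push Not at hx'
  obtain ⟨p, hp⟩ := hx'
  refine Finset.prod_eq_zero (Finset.mem_univ p) ?_
  by_contra hne
  refine hp ((mem_matrixSimplex_iff.1 hx p).posDef_iff_isUnit.2 ?_)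
  rw [Matrix.isUnit_iff_isUnit_det, isUnit_iff_ne_zero]
  intro h0
  exact hne (by rw [detFun, h0, Complex.zero_re])

/-- Integration by parts on the whole simplex. -/
lemma integral_mul_diffusionOp_dirichlet (hA : A.IsSymm) {a : Fin (n + 1) → ℝ}
    (ha : ∀ k, 0 < a k) {f h : (CoordIndex n d → ℝ) → ℝ} (hf : ContDiff ℝ ∞ f)
    (hh : ContDiff ℝ ∞ h) :
    ∫ x, f x * diffusionOp (coMetric A) (dirichletDrift A a) h x ∂(matrixDirichlet n d a) =
      -∫ x, carreDuChamp (coMetric A) f h x ∂(matrixDirichlet n d a) := by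
  obtain ⟨c, hc, hμ⟩ := exists_matrixDirichlet_eq (d := d) ha
  have hprob := isProbabilityMeasure_matrixDirichlet (d := d) ha
  rw [hμ] at hprob ⊢
  -- `∏ det` is the density with all parameters equal to two
  have hD : ∀ x : CoordIndex n d → ℝ, ∏ p, detFun n d p x = dirichletDensity (fun _ => 2) x :=
    fun x => Finset.prod_congr rfl fun p _ => by
      rw [show (2 : ℝ) - 1 = 1 by norm_num, Real.rpow_one, detFun]
  refine (isDivergenceForm_dirichlet hA a hc).integral_mul_diffusionOp_eq_neg
    (D := fun x => ∏ p, detFun n d p x)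
    (F := fun v x => ∑ q, ((2 : ℝ) - 1) * (2 * logDetField A q v x))
    (isCompact_matrixSimplex n d) interior_subset
    (contDiff_prod fun p _ => contDiff_det_re p)
    (fun x hx => Finset.prod_pos fun p _ => det_re_pos hx p)
    (fun x hx hx' => (prod_detFun_eq_zero hx hx').le) (fun v => ?_) (fun x hx v => ?_) hf hh
  · refine continuous_finsetSum _ fun q _ => continuous_const.mul (continuous_const.mul ?_)
    exact (isPolyFun_logDetField q v).contDiff (k := 0) |>.continuous
  · simp only [hD]
    exact sum_coMetric_mul_partialDeriv_dirichletDensity hA (fun _ => 2) hx v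

end Generator

/-! ### Polynomial models on the matrix simplex -/

lemma isPolynomialModel_matrixSimplex {n d : ℕ} (hd : 1 ≤ d)
    {A : Matrix (Fin (n + 1)) (Fin (n + 1)) ℝ} (hA : A.IsSymm) (hnn : ∀ p q, p ≠ q → 0 ≤ A p q)
    (hirr : IsIrreducibleMatrix A) {a : Fin (n + 1) → ℝ} (ha : ∀ k, 0 < a k) :
    IsPolynomialModel (interior (matrixSimplex n d)) (coMetric A) (matrixDirichlet n d a) := by
  obtain ⟨c, hc, hμ⟩ := exists_matrixDirichlet_eq (d := d) ha
  have H := isDivergenceForm_dirichlet (d := d) hA a hc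
  have hprob := isProbabilityMeasure_matrixDirichlet (d := d) ha
  have hsymm : ∀ P Q : MvPolynomial (CoordIndex n d) ℝ,
      ∫ x, MvPolynomial.eval x P * diffusionOp (coMetric A) (dirichletDrift A a)
          (fun y => MvPolynomial.eval y Q) x ∂(matrixDirichlet n d a) =
        ∫ x, MvPolynomial.eval x Q * diffusionOp (coMetric A) (dirichletDrift A a)
          (fun y => MvPolynomial.eval y P) x ∂(matrixDirichlet n d a) := fun P Q => by
    rw [integral_mul_diffusionOp_dirichlet hA ha (contDiff_eval P) (contDiff_eval Q),
      integral_mul_diffusionOp_dirichlet hA ha (contDiff_eval Q) (contDiff_eval P)]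
    simp only [carreDuChamp_comm H.symm_g fun y => MvPolynomial.eval y P]
  have hae : ∀ᵐ x ∂(matrixDirichlet n d a), x ∈ matrixSimplex n d := by
    rw [hμ]
    exact (ae_mem_densityMeasure isOpen_interior).mono fun x hx => interior_subset hx
  exact
    { isOpen := isOpen_interior
      isConnected := isConnected_interior_matrixSimplex n d
      isBounded := (isBounded_matrixSimplex n d).subset interior_subset
      boundary := hasPiecewiseC1Boundary_interior_matrixSimplex n d
      smooth_coMetric := fun u v => (H.smooth_g u v).contDiffOn
      elliptic := (isEllipticOn_iff hd hA).2 ⟨hnn, hirr⟩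
      isProbability := hprob
      density := ⟨_, H.smooth_ρ, H.pos, hμ⟩
      generator := by
        refine ⟨dirichletDrift A a, ?_, hsymm, fun m => ?_⟩
        · rw [hμ] at hprob ⊢
          exact H.isSymmetricDiffusion
        · obtain ⟨N, e, ev, h1, h2⟩ := exists_basis_eigenvectors (isCompact_matrixSimplex n d) hae
            isOpen_interior (interior_matrixSimplex_nonempty n d)
            (fun U hU hne hUΩ => by rw [hμ]; exact H.measure_pos hU hne hUΩ)
            (fun u v => isPolyFun_coMetric A u v) (isPolyFun_dirichletDrift a) hsymm m
          exact ⟨N, e, ev, h1, fun s x _ => h2 s x⟩ }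

end

theorem theorem4p1 (n d : ℕ) (hd : 1 ≤ d)
    (A : Matrix (Fin (n + 1)) (Fin (n + 1)) ℝ) (hA : A.IsSymm) :
    -- `Γ_A` is the co-metric with the prescribed values on the matrix entries
    (∀ (x : CoordIndex n d → ℝ) (p q : Fin n) (i j k l : Fin d),
      carreDuChamp (coMetric A) (fun y => hermMatrix y p i j) (fun y => hermMatrix y q k l) x =
        gammaEntry A x p i j q k l) ∧
    -- its coefficients as a quadratic form in the entries of all `n + 1` matrices
    (∀ (x : CoordIndex n d → ℝ) (p q : Fin (n + 1)) (i j k l : Fin d),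
      carreDuChamp (coMetric A) (fun y => simplexMatrix y p i j)
          (fun y => simplexMatrix y q k l) x =
        ∑ r, ∑ s, ∑ a, ∑ b, ∑ c, ∑ e,
          (gammaTensor A p q i j k l r s a b c e : ℂ) *
            (simplexMatrix x r a b * simplexMatrix x s c e)) ∧
    -- ellipticity in the interior
    (IsEllipticOn (interior (matrixSimplex n d)) (coMetric A) ↔
      (∀ p q, p ≠ q → 0 ≤ A p q) ∧ IsIrreducibleMatrix A) ∧
    -- polynomial model and formula for the generator
    ((∀ p q, p ≠ q → 0 ≤ A p q) → IsIrreducibleMatrix A →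
      ∀ a : Fin (n + 1) → ℝ, (∀ k, 0 < a k) →
        IsPolynomialModel (interior (matrixSimplex n d)) (coMetric A) (matrixDirichlet n d a) ∧
        ∀ b : CoordIndex n d → (CoordIndex n d → ℝ) → ℝ,
          IsSymmetricDiffusion (interior (matrixSimplex n d)) (coMetric A) b
            (matrixDirichlet n d a) →
          ∀ x ∈ interior (matrixSimplex n d), ∀ (p : Fin n) (i j : Fin d),
            diffusionOp (coMetric A) b (fun y => hermMatrix y p i j) x =
              ∑ q, 2 * ((a p.castSucc + d - 1 : ℝ) : ℂ) * (A p.castSucc q : ℂ) *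
                  simplexMatrix x q i j -
                ∑ q, 2 * ((a q + d - 1 : ℝ) : ℂ) * (A p.castSucc q : ℂ) *
                  simplexMatrix x p.castSucc i j) := by
  refine ⟨fun x p q i j k l => ?_, fun x p q i j k l => ?_, isEllipticOn_iff hd hA,
    fun hnn hirr a ha => ⟨isPolynomialModel_matrixSimplex hd hA hnn hirr ha,
      fun b hb x hx p i j => ?_⟩⟩
  · rw [gammaEntry_eq_fullEntry, ← carreDuChamp_simplexMatrix hA]
    simp only [simplexMatrix_castSucc]
  · rw [carreDuChamp_simplexMatrix hA, fullEntry_eq_sum_gammaTensor A hA]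
  · obtain ⟨c, hc, hμ⟩ := exists_matrixDirichlet_eq (d := d) ha
    have hprob := isProbabilityMeasure_matrixDirichlet (d := d) ha
    rw [hμ] at hprob hb
    exact diffusionOp_hermMatrix hA a
      (fun v => (isDivergenceForm_dirichlet hA a hc).drift_unique hb hx v) p i j
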